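/- **Setting.** Let $E=(E^0,E^1,s,r)$ be a directed graph and $(E,C)$ a separated graph: $C=\bigsqcup_{v\in E^0}C_v$, where $C_v$ is a partition of $s^{-1}(v)$ into pairwise disjoint nonempty sets. Put $s(e^{-1})=r(e)$, $r(e^{-1})=s(e)$. The *Leavitt inverse semigroup* $\mathrm{LI}(E,C)$ is the universal inverse semigroup with zero generated by $E^0\cup E^1\cup E^{-1}$ subject to: (1) $vw=\delta_{v,w}v$ for $v,w\in E^0$; (2) $s(x)x=x$ and (3) $x\,r(x)=x$ for $x\in E^1\cup E^{-1}$; (4) $e^{-1}f=\delta_{e,f}r(e)$ for $e,f\in X\in C$; (5) $ee^{-1}=s(e)$ for $e\in E^1$ with $\{e\}\in C$. Let $\mathfrak F$ be the fundamental groupoid of $E$: reduced paths in $E^1\cup E^{-1}$ with product $g\cdot h=\mathrm{red}(gh)$ when $r(g)=s(h)$. Its units are the vertices. Let $\mathbb F=\mathbb F(E^1)$ be the free group and $\omega\colon\mathfrak F\to\mathbb F$ the canonical map (vertices go to $1$). Let $\le_p$ be the prefix order and $g^{\downarrow}$ the set of prefixes of $g$. A path in $\mathfrak F$ is *$C$-separated*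 if it has no subpath $x^{-1}y$ with $x,y\in X\in C$. A set $T$ of $C$-separated paths with a common source is *$C$-compatible* if $\nu^{-1}\cdot\gamma$ is $C$-separated for all $\gamma,\nu\in T$. An *$E$-tree* based at $v$ is a finite set of reduced paths with source $v$ that contains $v$ and is closed under prefixes; $\mathcal Y(v)$ is the set of $C$-compatible $E$-trees based at $v$. Let $\mathcal Y=\bigsqcup_v\mathcal Y(v)\sqcup\{0\}$, with product $ST=S\cup T$ if this is $C$-compatible, and $ST=0$ otherwise. The *free inverse semigroup* $\mathfrak F_{is}(E)$ consists of $0$ and the Munn $E$-trees $(T,g)$ ($T$ an $E$-tree, $g\in T$), with product $(T_1,g_1)(T_2,g_2)=(T_1\cup g_1\cdot T_2,\,g_1\cdot g_2)$ if $r(g_1)=s(g_2)$ and $0$ otherwise. Let $\sim_L$ be the congruence on $\mathfrak F_{is}(E)$ generated by $e^{-1}e\sim_L r(e)$ for $e\in E^1$ and $ee^{-1}\sim_L s(e)$ for $e\in E^1$ with $\{e\}\in C$; here an edge $x\in E^1\cup E^{-1}$ stands for $(x^{\downarrow},x)$ and a vertex $v$ for $(\{v\},v)$. An $E$-tree $T$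 based at $v$ is identified with the idempotent $(T,v)$; a *representative* of $T$ is an $E$-tree $T'$ with $T'\sim_L T$. For $g\in\mathfrak F$ write $g=g_Lw$, where $w$ is the longest suffix of $g$ all of whose letters are of the form $e^{-1}$, or $e$ with $\{e\}\in C$. For a set $T$ of reduced paths, let $T_L$ be the set of all prefixes of the paths $g_L$, $g\in T$. Let $\mathcal Y_L(v)$ be the set of the $T\in\mathcal Y(v)$ none of whose maximal elements ends in some $e^{-1}$, or in some $e\in E^1$ with $\{e\}\in C$, and put $\mathcal Y_L=\bigsqcup_v\mathcal Y_L(v)$. A *Leavitt–Munn $(E,C)$-tree* is a pair $(T,g)$ with $g$ a $C$-separated path, $T\in\mathcal Y_L(s(g))$ and $g_L\in T$. **Theorem.** Let $(E,C)$ be a separated graph. 0. For every $E$-tree $T$, $T_L$ is the unique representative of $T$ none of whose maximal elements ends in some $e^{-1}$, or in some $e\in E^1$ with $\{e\}\in C$. For every Leavitt–Munn tree $(T,g)$, $T\cup g^\downarrow$ is in $\mathcal Y$ and is a representative of $T$. On $\mathcal Y$, the relation $\sim_L$ (where $0$ is related only to $0$) is a congruence. 1. The Leavitt–Munn $(E,C)$-trees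 together with a zero form an inverse semigroup under $$(T_1,g_1)(T_2,g_2)=\begin{cases}\big((T_1'\cup g_1\cdot T_2')_L,\ g_1\cdot g_2\big)&\text{if } r(g_1)=s(g_2)\text{ and }T_1'\cup g_1\cdot T_2'\text{ is }C\text{-compatible},\\ 0&\text{otherwise,}\end{cases}$$ where $T_1',T_2'\in\mathcal Y$ are any representatives of $T_1,T_2$ with $g_1\in T_1'$, $g_2\in T_2'$. The inverse is $(T,g)^{-1}=((g^{-1}\cdot T')_L,\,g^{-1})$, where $T'\in\mathcal Y$ is any representative of $T$ with $g\in T'$. There is an isomorphism from $\mathrm{LI}(E,C)$ onto this inverse semigroup which sends $0$ to $0$, $v\in E^0$ to $(\{v\},v)$, and $x\in E^1\cup E^{-1}$ to $((x^{\downarrow})_L,x)$. 2. With this identification, $\pi(T,g)=\omega(g)$ is an idempotent pure partial homomorphism $\mathrm{LI}(E,C)\setminus\{0\}\to\mathbb F$, that is, $\pi(xy)=\pi(x)\pi(y)$ whenever $xy\neq0$, and $\pi(x)=1$ exactly when $x$ is idempotent. 3. Let $\mathcal Y^L=\mathcal Y/{\sim_L}$. The map $[T]\mapsto(T_L,v)$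 for $T\in\mathcal Y(v)$, $[0]\mapsto 0$, is an isomorphism from $\mathcal Y^L$ onto the semilattice of idempotents of $\mathrm{LI}(E,C)$. 4. There is a partial action $\theta=(D_\gamma,\theta_\gamma\colon D_{\gamma^{-1}}\to D_\gamma)_{\gamma\in\mathbb F}$ of $\mathbb F$ on $\mathcal Y^L$ (the $D_\gamma$ are ideals, the $\theta_\gamma$ are semigroup isomorphisms, $D_1=\mathcal Y^L$, $\theta_1=\mathrm{id}$, and $\theta_{\gamma\delta}$ extends $\theta_\gamma\circ\theta_\delta$) such that: - for each $C$-separated path $g$ of positive length, $D_{\omega(g)}=\{0\}\cup\{[T]: T\in\mathcal Y_L(s(g)),\ g_L\in T\}$; - $D_\gamma=\{0\}$ if $\gamma\ne1$ is not of the form $\omega(g)$ with $g$ $C$-separated; - for $g$ as in the first item and $T\in\mathcal Y_L(r(g))$ with $(g^{-1})_L\in T$, $\theta_{\omega(g)}([T])=[(g\cdot T')_L]$ with $(g\cdot T')_L\in\mathcal Y_L(s(g))$, where $T'\in\mathcal Y$ is any representative of $T$ containing $g^{-1}$. The map $(T,g)\mapsto([T],\omega(g))$, $0\mapsto0$, is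 an isomorphism from $\mathrm{LI}(E,C)$ onto the restricted semidirect product $\mathcal Y^L\rtimes^r_\theta\mathbb F$: the pairs $(a,\gamma)$ with $a\in D_\gamma$, all pairs $(0,\gamma)$ being identified to $0$, with product $(a,\gamma)(b,\delta)=(\theta_\gamma(\theta_{\gamma^{-1}}(a)\,b),\gamma\delta)$. -/

import Mathlib

universe u w

namespace LeavittMunn

noncomputable section

open scoped Classical

/-! ### Directed graphs, separations, reduced paths -/

/-- A directed graph `(E⁰, E¹, s, r)`; no finiteness or countability is assumed. -/
structure DirGraph where
  Vert : Type u
  Edge : Type w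
  src : Edge → Vert
  rng : Edge → Vert

/-- A separation of `E`: for each vertex `v` a partition `C_v` of `s⁻¹(v)` into pairwise disjoint
nonempty subsets. -/
structure Separation (E : DirGraph.{u, w}) where
  parts : E.Vert → Set (Set E.Edge)
  nonempty : ∀ v, ∀ X ∈ parts v, X.Nonempty
  disjoint : ∀ v, (parts v).PairwiseDisjoint id
  cover : ∀ v, ⋃₀ parts v = {e | E.src e = v}

/-- `X ∈ C`, where `C` is the union of all the `C_v`. -/
def Separation.IsPart {E : DirGraph.{u, w}} (C : Separation E) (X : Set E.Edge) : Prop :=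
  ∃ v, X ∈ C.parts v

theorem Separation.eq_of_mem {E : DirGraph.{u, w}} (C : Separation E) {X Y : Set E.Edge}
    (hX : C.IsPart X) (hY : C.IsPart Y) {e : E.Edge} (heX : e ∈ X) (heY : e ∈ Y) : X = Y := by
  obtain ⟨v, hv⟩ := hX
  obtain ⟨v', hv'⟩ := hY
  have h1 : e ∈ {e | E.src e = v} := C.cover v ▸ ⟨X, hv, heX⟩
  have h2 : e ∈ {e | E.src e = v'} := C.cover v' ▸ ⟨Y, hv', heY⟩
  have h3 : v = v' := h1.symm.trans h2
  subst h3
  by_contra hne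
  exact Set.disjoint_left.1 (C.disjoint v hv hv' hne) heX heY

/-- The edges of the double graph: `(e, true)` is `e` and `(e, false)` is `e⁻¹`. -/
abbrev Letter (E : DirGraph.{u, w}) := E.Edge × Bool

/-- Source of an edge of the double graph. -/
def lsrc {E : DirGraph.{u, w}} (x : Letter E) : E.Vert := if x.2 then E.src x.1 else E.rng x.1

/-- Range of an edge of the double graph. -/
def lrng {E : DirGraph.{u, w}} (x : Letter E) : E.Vert := if x.2 then E.rng x.1 else E.src x.1

/-- The word `l` is a path of the double graph that starts at `v`. -/
def IsPath {E : DirGraph.{u, w}} : E.Vert → List (Letter E) → Prop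
  | _, [] => True
  | v, x :: l => lsrc x = v ∧ IsPath (lrng x) l

/-- The vertex where the path `l` starting at `v` ends. -/
def endpt {E : DirGraph.{u, w}} : E.Vert → List (Letter E) → E.Vert
  | v, [] => v
  | _, x :: l => endpt (lrng x) l

section PathLemmas
variable {E : DirGraph.{u, w}}

theorem endpt_append (v : E.Vert) (l m : List (Letter E)) :
    endpt v (l ++ m) = endpt (endpt v l) m := by
  induction l generalizing v with
  | nil => rfl
  | cons x l ih => exact ih _

theorem isPath_append (v : E.Vert) (l m : List (Letter E)) :
    IsPath v (l ++ m) ↔ IsPath v l ∧ IsPath (endpt v l) m := by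
  induction l generalizing v with
  | nil => simp [IsPath, endpt]
  | cons x l ih => simp [IsPath, endpt, ih, and_assoc]

theorem lsrc_flip (x : Letter E) : lsrc (x.1, !x.2) = lrng x := by
  rcases x with ⟨e, _ | _⟩ <;> rfl

theorem lrng_flip (x : Letter E) : lrng (x.1, !x.2) = lsrc x := by
  rcases x with ⟨e, _ | _⟩ <;> rfl

theorem step_path {l m : List (Letter E)} (h : FreeGroup.Red.Step l m) (v : E.Vert)
    (hl : IsPath v l) : IsPath v m ∧ endpt v m = endpt v l := by
  cases h with
  | @not L₁ L₂ x b =>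
    rw [isPath_append] at hl ⊢
    rw [endpt_append, endpt_append]
    obtain ⟨h1, h2, h3, h4⟩ := hl
    have h5 : lrng (x, !b) = endpt v L₁ := by rw [← h2]; exact lrng_flip (x, b)
    rw [h5] at h4
    refine ⟨⟨h1, h4⟩, ?_⟩
    change _ = endpt (lrng (x, !b)) L₂
    rw [h5]

theorem red_path {l m : List (Letter E)} (h : FreeGroup.Red l m) (v : E.Vert)
    (hl : IsPath v l) : IsPath v m ∧ endpt v m = endpt v l := by
  induction h with
  | refl => exact ⟨hl, rfl⟩
  | tail _ hs ih =>
    obtain ⟨h1, h2⟩ := step_path hs v ih.1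
    exact ⟨h1, h2.trans ih.2⟩

theorem invRev_path (v : E.Vert) (l : List (Letter E)) (hl : IsPath v l) :
    IsPath (endpt v l) (FreeGroup.invRev l) ∧ endpt (endpt v l) (FreeGroup.invRev l) = v := by
  induction l generalizing v with
  | nil => exact ⟨trivial, rfl⟩
  | cons x l ih =>
    obtain ⟨h1, h2⟩ := hl
    obtain ⟨h3, h4⟩ := ih _ h2
    rw [FreeGroup.invRev_cons, isPath_append, endpt_append]
    change (IsPath (endpt (lrng x) l) _ ∧ IsPath (endpt (endpt (lrng x) l) _) _) ∧
      endpt (endpt (endpt (lrng x) l) _) _ = v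
    rw [h4]
    exact ⟨⟨h3, lsrc_flip x, trivial⟩, (lrng_flip x).trans h1⟩

end PathLemmas

/-- Reduced paths of the double graph, i.e. the elements of the fundamental groupoid of `E`.
The path of length `0` at `v` is identified with `v`. -/
@[ext] structure RedPath (E : DirGraph.{u, w}) where
  src : E.Vert
  word : List (Letter E)
  isPath : IsPath src word
  reduced : FreeGroup.IsReduced word

namespace RedPath
variable {E : DirGraph.{u, w}}

/-- The range `r(g)`. -/
def rng (g : RedPath E) : E.Vert := endpt g.src g.word

/-- The vertex `v`, a unit of the fundamental groupoid. -/
def unit (v : E.Vert) : RedPath E := ⟨v, [], trivial, FreeGroup.IsReduced.nil⟩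

/-- The path of length one given by an edge of the double graph. -/
def letter (x : Letter E) : RedPath E := ⟨lsrc x, [x], ⟨rfl, trivial⟩, FreeGroup.IsReduced.singleton⟩

/-- The product `g · h = red (gh)` of the fundamental groupoid, defined when `r(g) = s(h)`. -/
def comp (g h : RedPath E) (hc : g.rng = h.src) : RedPath E :=
  ⟨g.src, FreeGroup.reduce (g.word ++ h.word),
    (red_path FreeGroup.reduce.red _
      ((isPath_append _ _ _).2 ⟨g.isPath, by
        have := h.isPath
        rwa [← hc] at this⟩)).1,
    FreeGroup.isReduced_iff_reduce_eq.2 FreeGroup.reduce.idem⟩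

/-- The inverse of the fundamental groupoid. -/
def inv (g : RedPath E) : RedPath E :=
  ⟨g.rng, FreeGroup.invRev g.word, (invRev_path _ _ g.isPath).1,
    FreeGroup.isReduced_iff_reduce_eq.2 (by
      rw [FreeGroup.reduce_invRev, g.reduced.reduce_eq])⟩

/-- The map `ω` to the free group on the edges; it sends all the vertices to `1`. -/
def toFree (g : RedPath E) : FreeGroup E.Edge := FreeGroup.mk g.word

/-- The prefix order `g ≤_p h`. -/
def IsPrefix (g h : RedPath E) : Prop := g.src = h.src ∧ g.word <+: h.word

/-- The lower set `g↓` of all the prefixes of `g`. -/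
def lower (g : RedPath E) : Set (RedPath E) := {h | h.IsPrefix g}

/-- The translate `g · T`. -/
def translate (g : RedPath E) (T : Set (RedPath E)) : Set (RedPath E) :=
  {x | ∃ h ∈ T, ∃ hc : g.rng = h.src, x = g.comp h hc}

@[simp] theorem unit_src (v : E.Vert) : (unit v).src = v := rfl
@[simp] theorem unit_rng (v : E.Vert) : (unit v).rng = v := rfl
@[simp] theorem comp_src (g h : RedPath E) (hc) : (g.comp h hc).src = g.src := rfl
@[simp] theorem inv_src (g : RedPath E) : g.inv.src = g.rng := rfl
@[simp] theorem inv_rng (g : RedPath E) : g.inv.rng = g.src := (invRev_path _ _ g.isPath).2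

@[simp] theorem comp_rng (g h : RedPath E) (hc : g.rng = h.src) :
    (g.comp h hc).rng = h.rng := by
  have hp : IsPath g.src (g.word ++ h.word) := (isPath_append _ _ _).2 ⟨g.isPath, by
    have := h.isPath
    rwa [← hc] at this⟩
  have h1 := (red_path FreeGroup.reduce.red _ hp).2
  refine h1.trans ?_
  rw [endpt_append]
  exact congrArg (fun v => endpt v h.word) hc

@[simp] theorem toFree_unit (v : E.Vert) : (unit v).toFree = 1 := rfl
@[simp] theorem toFree_comp (g h : RedPath E) (hc : g.rng = h.src) :
    (g.comp h hc).toFree = g.toFree * h.toFree := by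
  simp only [toFree, comp, FreeGroup.reduce.self, FreeGroup.mul_mk]
@[simp] theorem toFree_inv (g : RedPath E) : g.inv.toFree = g.toFree⁻¹ := by
  simp only [toFree, inv, FreeGroup.inv_mk]

theorem ext_toFree {g h : RedPath E} (hs : g.src = h.src) (hw : g.toFree = h.toFree) : g = h := by
  refine RedPath.ext hs ?_
  have := FreeGroup.reduce.sound hw
  rwa [g.reduced.reduce_eq, h.reduced.reduce_eq] at this

theorem IsPrefix.refl (g : RedPath E) : g.IsPrefix g := ⟨rfl, List.prefix_refl _⟩

theorem IsPrefix.trans {g h k : RedPath E} (h1 : g.IsPrefix h) (h2 : h.IsPrefix k) :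
    g.IsPrefix k := ⟨h1.1.trans h2.1, h1.2.trans h2.2⟩

theorem mem_lower_self (g : RedPath E) : g ∈ g.lower := IsPrefix.refl g

/-- The prefix of `g` with underlying word `l`. -/
def pre (g : RedPath E) (l : List (Letter E)) (hl : l <+: g.word) : RedPath E :=
  ⟨g.src, l, by
    obtain ⟨m, hm⟩ := hl
    have := g.isPath
    rw [← hm, isPath_append] at this
    exact this.1, g.reduced.infix hl.isInfix⟩

theorem pre_isPrefix (g : RedPath E) (l : List (Letter E)) (hl : l <+: g.word) :
    (g.pre l hl).IsPrefix g := ⟨rfl, hl⟩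

end RedPath

/-! ### Munn trees and the free inverse semigroup of a graph -/

section Trees
variable {E : DirGraph.{u, w}}

/-- `T` is (the vertex set of) a finite connected subgraph of the Cayley graph of the fundamental
groupoid which contains the base point `v`: a finite set of reduced paths with source `v`,
containing `v` and closed under prefixes. -/
structure IsETree (v : E.Vert) (T : Set (RedPath E)) : Prop where
  finite : T.Finite
  unit_mem : RedPath.unit v ∈ T
  src_eq : ∀ g ∈ T, g.src = v
  lower : ∀ g ∈ T, ∀ h : RedPath E, h.IsPrefix g → h ∈ T

theorem isETree_unit (v : E.Vert) : IsETree v {RedPath.unit v} where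
  finite := Set.finite_singleton _
  unit_mem := rfl
  src_eq := by rintro g rfl; rfl
  lower := by
    rintro g rfl h ⟨h1, h2⟩
    exact RedPath.ext h1 (List.prefix_nil.1 h2)

theorem isETree_lower (g : RedPath E) : IsETree g.src g.lower where
  finite := by
    have h : Set.Finite {l : List (Letter E) | l <+: g.word} := by
      refine (List.finite_toSet g.word.inits).subset ?_
      intro l hl
      exact (List.mem_inits l g.word).2 hl
    refine Set.Finite.of_finite_image (f := RedPath.word) (h.subset ?_) ?_
    · rintro _ ⟨k, hk, rfl⟩
      exact hk.2
    · intro a ha b hb hab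
      exact RedPath.ext (ha.1.trans hb.1.symm) hab
  unit_mem := ⟨rfl, List.nil_prefix⟩
  src_eq := fun _ hk => hk.1
  lower := fun _ hk _ hh => hh.trans hk

theorem IsETree.union {v : E.Vert} {S T : Set (RedPath E)} (hS : IsETree v S) (hT : IsETree v T) :
    IsETree v (S ∪ T) where
  finite := hS.finite.union hT.finite
  unit_mem := Or.inl hS.unit_mem
  src_eq := by
    rintro g (hg | hg)
    exacts [hS.src_eq g hg, hT.src_eq g hg]
  lower := by
    rintro g (hg | hg) h hh
    exacts [Or.inl (hS.lower g hg h hh), Or.inr (hT.lower g hg h hh)]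

theorem IsETree.lower_subset {v : E.Vert} {T : Set (RedPath E)} (hT : IsETree v T) {g : RedPath E}
    (hg : g ∈ T) : g.lower ⊆ T := fun h hh => hT.lower g hg h hh

theorem reduce_concat (l : List (Letter E)) (x : Letter E) (hl : FreeGroup.IsReduced l) :
    FreeGroup.reduce (l ++ [x]) = l ++ [x] ∨ FreeGroup.reduce (l ++ [x]) <+: l := by
  rcases List.eq_nil_or_concat l with rfl | ⟨m, y, rfl⟩
  · left; rfl
  · rw [List.concat_eq_append] at hl ⊢
    by_cases hxy : y.1 = x.1 ∧ y.2 = !x.2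
    · right
      have hy : y = (x.1, !x.2) := Prod.ext hxy.1 hxy.2
      have h1 : FreeGroup.Red.Step (m ++ (x.1, !x.2) :: (x.1, x.2) :: []) (m ++ []) :=
        FreeGroup.Red.Step.not_rev
      have h2 : m ++ [y] ++ [x] = m ++ (x.1, !x.2) :: (x.1, x.2) :: [] := by simp [hy]
      rw [h2, FreeGroup.reduce.Step.eq h1, List.append_nil, FreeGroup.IsReduced.reduce_eq]
      · exact List.prefix_append _ _
      · exact hl.infix (List.prefix_append _ _).isInfix
    · left
      apply FreeGroup.IsReduced.reduce_eq
      refine FreeGroup.IsReduced.append_overlap hl ?_ (List.cons_ne_nil y [])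
      change FreeGroup.IsReduced [y, x]
      rw [FreeGroup.isReduced_cons_cons]
      refine ⟨fun h => ?_, FreeGroup.IsReduced.singleton⟩
      by_contra hne
      exact hxy ⟨h, by cases hy : y.2 <;> cases hx : x.2 <;> simp_all⟩

theorem comp_prefix_mem (v : E.Vert) (S T : Set (RedPath E)) (g : RedPath E) (hS : IsETree v S)
    (hg : g ∈ S) (hT : IsETree g.rng T) (n : ℕ) :
    ∀ h ∈ T, h.word.length = n → ∀ hc : g.rng = h.src, ∀ k : RedPath E,
      k.IsPrefix (g.comp h hc) → k ∈ S ∪ g.translate T := by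
  induction n with
  | zero =>
    intro h _ hn hc k hk
    have hw : h.word = [] := List.length_eq_zero_iff.1 hn
    left
    refine hS.lower g hg k ⟨hk.1, ?_⟩
    have := hk.2
    simpa [RedPath.comp, hw, g.reduced.reduce_eq] using this
  | succ n ih =>
    intro h hh hn hc k hk
    rcases List.eq_nil_or_concat h.word with hw | ⟨m, x, hw⟩
    · simp [hw] at hn
    · have hm : m <+: h.word := by rw [hw]; exact ⟨[x], by simp⟩
      have hh' : h.pre m hm ∈ T := hT.lower h hh _ (h.pre_isPrefix m hm)
      have hn' : (h.pre m hm).word.length = n := by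
        have h1 : (m ++ [x]).length = n + 1 := by rw [← List.concat_eq_append, ← hw]; exact hn
        simpa [RedPath.pre] using h1
      have hc' : g.rng = (h.pre m hm).src := hc
      have key : (g.comp h hc).word =
          FreeGroup.reduce ((g.comp (h.pre m hm) hc').word ++ [x]) := by
        change FreeGroup.reduce (g.word ++ h.word) =
          FreeGroup.reduce (FreeGroup.reduce (g.word ++ m) ++ [x])
        rw [hw, List.concat_eq_append, ← List.append_assoc]
        refine FreeGroup.reduce.sound ?_
        rw [← FreeGroup.mul_mk, ← FreeGroup.mul_mk (L₁ := FreeGroup.reduce _),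
          FreeGroup.reduce.self]
      rcases reduce_concat _ x (g.comp (h.pre m hm) hc').reduced with h1 | h1
      · rw [← key] at h1
        rcases List.prefix_concat_iff.1 (h1 ▸ hk.2) with h2 | h2
        · right
          refine ⟨h, hh, hc, RedPath.ext hk.1 ?_⟩
          rw [h2, h1]
        · exact ih _ hh' hn' hc' k ⟨hk.1, h2⟩
      · rw [← key] at h1
        exact ih _ hh' hn' hc' k ⟨hk.1, hk.2.trans h1⟩

theorem isETree_munn {v : E.Vert} {S T : Set (RedPath E)} {g : RedPath E} (hS : IsETree v S)
    (hg : g ∈ S) (hT : IsETree g.rng T) : IsETree v (S ∪ g.translate T) where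
  finite := by
    refine hS.finite.union ?_
    refine (hT.finite.image fun h => if hc : g.rng = h.src then g.comp h hc else g).subset ?_
    rintro x ⟨h, hh, hc, rfl⟩
    exact ⟨h, hh, by simp [hc]⟩
  unit_mem := Or.inl hS.unit_mem
  src_eq := by
    rintro x (hx | ⟨h, _, _, rfl⟩)
    exacts [hS.src_eq x hx, hS.src_eq g hg]
  lower := by
    rintro x (hx | ⟨h, hh, hc, rfl⟩) k hk
    · exact Or.inl (hS.lower x hx k hk)
    · exact comp_prefix_mem v S T g hS hg hT _ h hh rfl hc k hk

end Trees

/-- A Munn `E`-tree `(T, g)`. -/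
@[ext] structure MunnTree (E : DirGraph.{u, w}) where
  tree : Set (RedPath E)
  path : RedPath E
  isTree : IsETree path.src tree
  mem : path ∈ tree

/-- The free inverse semigroup of `E`, realised as the Munn `E`-trees together with a zero
(`none`). -/
def FreeIS (E : DirGraph.{u, w}) := Option (MunnTree E)

namespace FreeIS
variable {E : DirGraph.{u, w}}

instance : Zero (FreeIS E) := ⟨(none : Option (MunnTree E))⟩

/-- A Munn `E`-tree as a nonzero element. -/
def of (p : MunnTree E) : FreeIS E := (some p : Option (MunnTree E))

/-- `(T₁, g₁) (T₂, g₂) = (T₁ ∪ g₁ · T₂, g₁ · g₂)`, for two composable Munn trees. -/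
def mulTree (p q : MunnTree E) (hc : p.path.rng = q.path.src) : MunnTree E where
  tree := p.tree ∪ p.path.translate q.tree
  path := p.path.comp q.path hc
  isTree := isETree_munn p.isTree p.mem (hc ▸ q.isTree)
  mem := Or.inr ⟨q.path, q.mem, hc, rfl⟩

instance : Mul (FreeIS E) where
  mul a b := match a, b with
    | some p, some q => if hc : p.path.rng = q.path.src then of (mulTree p q hc) else 0
    | _, _ => 0

/-- The generator given by an edge `x` of the double graph. -/
def letter (x : Letter E) : FreeIS E :=
  of ⟨(RedPath.letter x).lower, RedPath.letter x, isETree_lower _, RedPath.mem_lower_self _⟩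

/-- The nonzero idempotent `(T, v)` given by an `E`-tree `T`. -/
def idem {v : E.Vert} {T : Set (RedPath E)} (hT : IsETree v T) : FreeIS E :=
  of ⟨T, RedPath.unit v, hT, hT.unit_mem⟩

/-- The generator given by a vertex. -/
def vert (v : E.Vert) : FreeIS E := idem (isETree_unit v)

end FreeIS

/-! ### `C`-separated paths, `C`-compatible trees, Leavitt-Munn trees -/

section Compat
variable {E : DirGraph.{u, w}} (C : Separation E)

/-- `C`-separated words: no subword `x⁻¹y` with `x, y ∈ X ∈ C`. -/
def SepWord (l : List (Letter E)) : Prop :=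
  ∀ X, C.IsPart X → ∀ x ∈ X, ∀ y ∈ X, ¬ [(x, false), (y, true)] <:+: l

/-- `C`-separated paths. -/
def IsSeparated (g : RedPath E) : Prop := SepWord C g.word

/-- `T` is a `C`-compatible set of `C`-separated paths: any two elements `γ, ν` have the same
source, and `ν⁻¹ · γ` is `C`-separated. -/
structure IsCompatible (T : Set (RedPath E)) : Prop where
  sep : ∀ g ∈ T, IsSeparated C g
  compat : ∀ γ ∈ T, ∀ ν ∈ T, ∃ hc : ν.inv.rng = γ.src, IsSeparated C (ν.inv.comp γ hc)

/-- `T ∈ 𝒴(v)`: nonempty finite lower `C`-compatible subsets of the set of `C`-separated paths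
starting at `v`. -/
structure IsY (v : E.Vert) (T : Set (RedPath E)) : Prop where
  isTree : IsETree v T
  compatible : IsCompatible C T

/-- The letters `e⁻¹`, for any edge `e`, and `e`, for the edges with `{e} ∈ C`. -/
def IsRedundant (x : Letter E) : Prop := x.2 = false ∨ C.IsPart {x.1}

/-- `g_L`, where `g = g_L w` with `w` the longest suffix of `g` all of whose letters are of the
form `e⁻¹`, or `e` with `{e} ∈ C`. -/
def pathL (g : RedPath E) : RedPath E :=
  g.pre (g.word.rdropWhile fun x => decide (IsRedundant C x)) (List.rdropWhile_prefix _ _)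

/-- The lower set `T_L` generated by the `g_L` with `g ∈ T`. -/
def treeL (T : Set (RedPath E)) : Set (RedPath E) := {h | ∃ g ∈ T, h.IsPrefix (pathL C g)}

/-- No maximal element of `T` ends in some `e⁻¹`, or in some `e` with `{e} ∈ C`. -/
def IsLReduced (T : Set (RedPath E)) : Prop :=
  ∀ g ∈ T, (∀ h ∈ T, g.IsPrefix h → h = g) → ∀ x, g.word.getLast? = some x → ¬ IsRedundant C x

/-- `T ∈ 𝒴_L(v)`: `T` is a Leavitt `(E, C)`-tree with base point `v`. -/
structure IsYL (v : E.Vert) (T : Set (RedPath E)) : Prop where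
  isY : IsY C v T
  lreduced : IsLReduced C T

end Compat

/-- A Leavitt-Munn `(E, C)`-tree `(T, g)`. -/
@[ext] structure LMTree {E : DirGraph.{u, w}} (C : Separation E) where
  tree : Set (RedPath E)
  path : RedPath E
  isYL : IsYL C path.src tree
  sep : IsSeparated C path
  mem : pathL C path ∈ tree

section CompatLemmas
variable {E : DirGraph.{u, w}} {C : Separation E}

theorem SepWord.infix {l m : List (Letter E)} (h : SepWord C m) (hl : l <:+: m) : SepWord C l :=
  fun X hX x hx y hy hi => h X hX x hx y hy (hi.trans hl)

theorem SepWord.invRev {l : List (Letter E)} (h : SepWord C l) :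
    SepWord C (FreeGroup.invRev l) := by
  rintro X hX x hx y hy ⟨a, b, hab⟩
  refine h X hX y hy x hx ⟨FreeGroup.invRev b, FreeGroup.invRev a, ?_⟩
  have := congrArg FreeGroup.invRev hab
  rw [FreeGroup.invRev_invRev] at this
  rw [← this]
  simp [FreeGroup.invRev]

theorem IsSeparated.of_prefix {g h : RedPath E} (hg : IsSeparated C g) (hh : h.IsPrefix g) :
    IsSeparated C h := SepWord.infix hg hh.2.isInfix

theorem IsCompatible.mono {S T : Set (RedPath E)} (hT : IsCompatible C T) (h : S ⊆ T) :
    IsCompatible C S :=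
  ⟨fun g hg => hT.sep g (h hg), fun γ hγ ν hν => hT.compat γ (h hγ) ν (h hν)⟩

theorem pathL_isPrefix (g : RedPath E) : (pathL C g).IsPrefix g :=
  RedPath.pre_isPrefix _ _ _

theorem treeL_subset {v : E.Vert} {T : Set (RedPath E)} (hT : IsETree v T) : treeL C T ⊆ T := by
  rintro h ⟨g, hg, hh⟩
  exact hT.lower g hg h (hh.trans (pathL_isPrefix g))

theorem pathL_mem_treeL {T : Set (RedPath E)} {g : RedPath E} (hg : g ∈ T) :
    pathL C g ∈ treeL C T := ⟨g, hg, RedPath.IsPrefix.refl _⟩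

theorem isYL_treeL {v : E.Vert} {T : Set (RedPath E)} (hT : IsY C v T) :
    IsYL C v (treeL C T) where
  isY :=
    { isTree :=
        { finite := hT.isTree.finite.subset (treeL_subset hT.isTree)
          unit_mem := ⟨_, hT.isTree.unit_mem, rfl, List.nil_prefix⟩
          src_eq := fun g hg => hT.isTree.src_eq g (treeL_subset hT.isTree hg)
          lower := by
            rintro g ⟨k, hk, hgk⟩ h hh
            exact ⟨k, hk, hh.trans hgk⟩ }
      compatible := hT.compatible.mono (treeL_subset hT.isTree) }
  lreduced := by
    rintro g ⟨k, hk, hgk⟩ hmax x hx hr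
    have h1 := hmax _ (pathL_mem_treeL hk) hgk
    rw [← h1] at hx
    have hne : k.word.rdropWhile (fun x => decide (IsRedundant C x)) ≠ [] := by
      intro h0
      have : (pathL C k).word = [] := h0
      rw [this] at hx
      simp at hx
    have h2 := List.rdropWhile_last_not (fun x => decide (IsRedundant C x)) k.word hne
    have h3 : (pathL C k).word.getLast? = some (List.getLast _ hne) :=
      List.getLast?_eq_some_getLast hne
    rw [h3] at hx
    rw [Option.some.inj hx] at h2
    exact h2 (by simpa using hr)


theorem sep_inv {g : RedPath E} (hg : IsSeparated C g) : IsSeparated C g.inv := SepWord.invRev hg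

/-- The geodesic between `d a` and `d b`, for words `a`, `b` that do not start with the same
letter. -/
theorem reduce_geodesic (d a b : List (Letter E)) (ha : FreeGroup.IsReduced a)
    (hb : FreeGroup.IsReduced b) (hab : ∀ x ∈ a.head?, ∀ y ∈ b.head?, x ≠ y) :
    FreeGroup.reduce (FreeGroup.invRev (d ++ b) ++ (d ++ a)) = FreeGroup.invRev b ++ a := by
  have h1 : FreeGroup.reduce (FreeGroup.invRev (d ++ b) ++ (d ++ a)) =
      FreeGroup.reduce (FreeGroup.invRev b ++ a) := by
    refine FreeGroup.reduce.sound ?_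
    simp only [← FreeGroup.mul_mk, ← FreeGroup.inv_mk]
    group
  rw [h1]
  apply FreeGroup.IsReduced.reduce_eq
  have hb' : FreeGroup.IsReduced (FreeGroup.invRev b) :=
    FreeGroup.isReduced_iff_reduce_eq.2 (by rw [FreeGroup.reduce_invRev, hb.reduce_eq])
  refine List.isChain_append.2 ⟨hb', ha, ?_⟩
  intro y hy x hx hyx
  have hy' : (y.1, !y.2) ∈ b.head? := by
    cases b with
    | nil => simp at hy
    | cons z b =>
      simp [FreeGroup.invRev] at hy
      simp [← hy]
  have := hab x hx _ hy'
  by_contra hne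
  apply this
  refine Prod.ext hyx.symm ?_
  cases hy : y.2 <;> cases hx : x.2 <;> simp_all

theorem exists_common_prefix (l m : List (Letter E)) :
    ∃ d a b, l = d ++ a ∧ m = d ++ b ∧ ∀ x ∈ a.head?, ∀ y ∈ b.head?, x ≠ y := by
  induction l generalizing m with
  | nil => exact ⟨[], [], m, rfl, rfl, by simp⟩
  | cons x l ih =>
    cases m with
    | nil => exact ⟨[], x :: l, [], rfl, rfl, by simp⟩
    | cons y m =>
      by_cases hxy : x = y
      · subst hxy
        obtain ⟨d, a, b, h1, h2, h3⟩ := ih m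
        exact ⟨x :: d, a, b, by simp [h1], by simp [h2], h3⟩
      · exact ⟨[], x :: l, y :: m, rfl, rfl, by simpa using hxy⟩

/-- A tree of `C`-separated paths is `C`-compatible if it has no branching `d x`, `d y` with distinct
`x, y ∈ X ∈ C`. -/
theorem isCompatible_of_local {v : E.Vert} {T : Set (RedPath E)} (hT : IsETree v T)
    (hsep : ∀ g ∈ T, IsSeparated C g)
    (hloc : ∀ X, C.IsPart X → ∀ x ∈ X, ∀ y ∈ X, ∀ d : List (Letter E), ∀ g ∈ T, ∀ h ∈ T,
      g.word = d ++ [(x, true)] → h.word = d ++ [(y, true)] → x = y) :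
    IsCompatible C T where
  sep := hsep
  compat := by
    intro γ hγ ν hν
    have hc : ν.inv.rng = γ.src := by
      rw [RedPath.inv_rng, hT.src_eq γ hγ, hT.src_eq ν hν]
    refine ⟨hc, ?_⟩
    obtain ⟨d, a, b, h1, h2, h3⟩ := exists_common_prefix γ.word ν.word
    have hw : (ν.inv.comp γ hc).word = FreeGroup.invRev b ++ a := by
      change FreeGroup.reduce (FreeGroup.invRev ν.word ++ γ.word) = _
      rw [h1, h2]
      refine reduce_geodesic d a b ?_ ?_ h3
      · exact γ.reduced.infix (h1 ▸ (List.suffix_append d a).isInfix)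
      · exact ν.reduced.infix (h2 ▸ (List.suffix_append d b).isInfix)
    have ha : SepWord C a := SepWord.infix (hsep γ hγ) (h1 ▸ (List.suffix_append d a).isInfix)
    have hb : SepWord C b := SepWord.infix (hsep ν hν) (h2 ▸ (List.suffix_append d b).isInfix)
    intro X hX x hx y hy hi
    rw [hw] at hi
    rcases List.infix_append_iff.1 hi with hi | hi | ⟨p, q, hpq, hp, hq⟩
    · exact hb.invRev X hX x hx y hy hi
    · exact ha X hX x hx y hy hi
    · rcases p with _ | ⟨p, _ | ⟨p', p''⟩⟩
      · rw [List.nil_append] at hpq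
        exact ha X hX x hx y hy (hpq ▸ hq.isInfix)
      · obtain ⟨rfl, rfl⟩ : (x, false) = p ∧ [(y, true)] = q := by simpa using hpq
        obtain ⟨a', rfl⟩ := hq
        obtain ⟨b', hb'⟩ := hp
        have hb2 : b = (x, true) :: FreeGroup.invRev b' := by
          have := congrArg FreeGroup.invRev hb'
          rw [FreeGroup.invRev_invRev] at this
          rw [← this]
          simp [FreeGroup.invRev]
        have p1 : d ++ [(y, true)] <+: γ.word := by rw [h1]; exact ⟨a', by simp⟩
        have p2 : d ++ [(x, true)] <+: ν.word := by 
          rw [h2, hb2]; exact ⟨FreeGroup.invRev b', by simp⟩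
        have hxy := hloc X hX x hx y hy d _ (hT.lower ν hν _ (ν.pre_isPrefix _ p2)) _
          (hT.lower γ hγ _ (γ.pre_isPrefix _ p1)) rfl rfl
        refine h3 (y, true) (by simp) (x, true) (by simp [hb2]) (by rw [hxy])
      · have hq0 : q = [] ∧ p'' = [] := by
          have := congrArg List.length hpq
          simp only [List.length_cons, List.length_append, List.length_nil] at this
          constructor <;> apply List.length_eq_zero_iff.1 <;> omega
        obtain ⟨rfl, rfl⟩ := hq0
        rw [List.append_nil] at hpq
        exact hb.invRev X hX x hx y hy (hpq ▸ hp.isInfix)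

theorem IsCompatible.local {T : Set (RedPath E)} (hT : IsCompatible C T) {X : Set E.Edge}
    (hX : C.IsPart X) {x y : E.Edge} (hx : x ∈ X) (hy : y ∈ X) (d : List (Letter E))
    {g h : RedPath E} (hg : g ∈ T) (hh : h ∈ T) (hgw : g.word = d ++ [(x, true)])
    (hhw : h.word = d ++ [(y, true)]) : x = y := by
  by_contra hne
  obtain ⟨hc, hs⟩ := hT.compat h hh g hg
  refine hs X hX x hx y hy ?_
  have hw : (g.inv.comp h hc).word = FreeGroup.invRev [(x, true)] ++ [(y, true)] := by
    change FreeGroup.reduce (FreeGroup.invRev g.word ++ h.word) = _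
    rw [hgw, hhw]
    refine reduce_geodesic d _ _ FreeGroup.IsReduced.singleton FreeGroup.IsReduced.singleton ?_
    intro a ha b hb hab
    simp at ha hb
    rw [← ha, ← hb] at hab
    exact hne (Prod.ext_iff.1 hab).1.symm
  rw [hw]
  exact List.infix_refl _

/-- The word `w` in the decomposition `g = g_L w` consists of redundant letters. -/
theorem redundant_of_prefix {g : RedPath E} {d : List (Letter E)} {x : Letter E}
    (h1 : d ++ [x] <+: g.word) (h2 : ¬ d ++ [x] <+: (pathL C g).word) : IsRedundant C x := by
  obtain ⟨m, hm⟩ := h1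
  set p : Letter E → Bool := fun x => decide (IsRedundant C x) with hp
  have h3 : (pathL C g).word ++ g.word.rtakeWhile p = g.word := by
    change List.rdropWhile p g.word ++ _ = _
    simp only [List.rdropWhile, List.rtakeWhile]
    rw [← List.reverse_append, List.takeWhile_append_dropWhile, List.reverse_reverse]
  have h4 : (pathL C g).word <+: d := by
    have h5 : (pathL C g).word <+: g.word := ⟨_, h3⟩
    rcases List.prefix_or_prefix_of_prefix h5 ⟨m, hm⟩ with h6 | h6
    · rcases List.prefix_concat_iff.1 h6 with h7 | h7
      · exact absurd (h7 ▸ List.prefix_refl _) h2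
      · exact h7
    · exact absurd h6 h2
  obtain ⟨c, hc⟩ := h4
  have h5 : x ∈ g.word.rtakeWhile p := by
    have : g.word.rtakeWhile p = c ++ x :: m := by
      apply List.append_cancel_left (as := (pathL C g).word)
      rw [h3, ← hm, ← hc]
      simp
    rw [this]
    simp
  simpa [hp] using List.mem_rtakeWhile_imp h5

/-- If `(T, g)` is a Leavitt-Munn tree, then `T ∪ g↓` is a `C`-compatible tree. -/
theorem LMTree.isY_union (p : LMTree C) : IsY C p.path.src (p.tree ∪ p.path.lower) := by
  have hT : IsETree p.path.src (p.tree ∪ p.path.lower) :=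
    p.isYL.isY.isTree.union (isETree_lower _)
  have mixed : ∀ X, C.IsPart X → ∀ x ∈ X, ∀ y ∈ X, ∀ d : List (Letter E), ∀ g ∈ p.tree,
      ∀ h ∈ p.path.lower, g.word = d ++ [(x, true)] → h.word = d ++ [(y, true)] → x = y := by
    intro X hX x hx y hy d g hg h hh hgw hhw
    by_cases hl : d ++ [(y, true)] <+: (pathL C p.path).word
    · have : h ∈ p.tree :=
        p.isYL.isY.isTree.lower _ p.mem _ ⟨hh.1, hhw ▸ hl⟩
      exact p.isYL.isY.compatible.local hX hx hy d hg this hgw hhw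
    · rcases redundant_of_prefix (hhw ▸ hh.2) hl with h0 | h0
      · simp at h0
      · have := C.eq_of_mem h0 hX (e := y) rfl hy
        exact (this.symm ▸ hx : x ∈ ({y} : Set E.Edge))
  refine ⟨hT, isCompatible_of_local hT ?_ ?_⟩
  · rintro g (hg | hg)
    · exact p.isYL.isY.compatible.sep g hg
    · exact p.sep.of_prefix hg
  · rintro X hX x hx y hy d g (hg | hg) h (hh | hh) hgw hhw
    · exact p.isYL.isY.compatible.local hX hx hy d hg hh hgw hhw
    · exact mixed X hX x hx y hy d g hg h hh hgw hhw
    · exact (mixed X hX y hy x hx d h hh g hg hhw hgw).symm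
    · have h1 := List.prefix_of_prefix_length_le hg.2 hh.2 (by simp [hgw, hhw])
      rw [hgw, hhw] at h1
      have h2 := h1.eq_of_length (by simp)
      have h3 := List.append_cancel_left h2
      simpa using h3

/-- Translation of a `C`-compatible tree by the inverse of one of its elements. -/
theorem IsY.translate_inv {g : RedPath E} {T : Set (RedPath E)} (hT : IsY C g.src T)
    (hg : g ∈ T) : IsY C g.rng (g.inv.translate T) where
  isTree := by
    have h1 : IsETree g.rng (g.inv.lower ∪ g.inv.translate T) :=
      isETree_munn (isETree_lower g.inv) (RedPath.mem_lower_self _)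
        (by rw [RedPath.inv_rng]; exact hT.isTree)
    have h2 : g.inv.lower ⊆ g.inv.translate T := by
      rintro k ⟨hk1, b, hb⟩
      have hw : g.word = FreeGroup.invRev b ++ FreeGroup.invRev k.word := by
        have := congrArg FreeGroup.invRev hb
        rw [FreeGroup.invRev_append] at this
        rw [this]
        exact FreeGroup.invRev_invRev.symm
      have hp : FreeGroup.invRev b <+: g.word := ⟨_, hw.symm⟩
      have hc : g.inv.rng = (g.pre _ hp).src := g.inv_rng
      refine ⟨g.pre _ hp, hT.isTree.lower g hg _ (g.pre_isPrefix _ hp), hc, ?_⟩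
      refine RedPath.ext_toFree hk1 ?_
      rw [RedPath.toFree_comp _ _ hc, RedPath.toFree_inv]
      change FreeGroup.mk k.word = (FreeGroup.mk g.word)⁻¹ * FreeGroup.mk (FreeGroup.invRev b)
      rw [hw, ← FreeGroup.mul_mk, ← FreeGroup.inv_mk, ← FreeGroup.inv_mk]
      group
    rwa [Set.union_eq_right.2 h2] at h1
  compatible :=
    { sep := by
        rintro _ ⟨h, hh, hc, rfl⟩
        exact (hT.compatible.compat h hh g hg).2
      compat := by
        rintro _ ⟨h, hh, hc, rfl⟩ _ ⟨k, hk, hc', rfl⟩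
        obtain ⟨h1, h2⟩ := hT.compatible.compat h hh k hk
        have h3 : (g.inv.comp k hc').inv.rng = (g.inv.comp h hc).src := by
          rw [RedPath.inv_rng, RedPath.comp_src, RedPath.comp_src]
        refine ⟨h3, ?_⟩
        have h4 : (g.inv.comp k hc').inv.comp (g.inv.comp h hc) h3 = k.inv.comp h h1 := by
          refine RedPath.ext_toFree ?_ ?_
          · rw [RedPath.comp_src, RedPath.comp_src, RedPath.inv_src, RedPath.inv_src,
              RedPath.comp_rng]
          · rw [RedPath.toFree_comp, RedPath.toFree_comp, RedPath.toFree_inv, RedPath.toFree_comp,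
              RedPath.toFree_comp, RedPath.toFree_inv, RedPath.toFree_inv]
            group
        rw [h4]
        exact h2 }

end CompatLemmas

/-! ### The Leavitt-Munn trees together with a zero -/

/-- The Leavitt-Munn `(E, C)`-trees together with a zero (`none`). -/
def LM {E : DirGraph.{u, w}} (C : Separation E) := Option (LMTree C)

namespace LM
variable {E : DirGraph.{u, w}} {C : Separation E}

instance : Zero (LM C) := ⟨(none : Option (LMTree C))⟩

/-- A Leavitt-Munn tree as a nonzero element. -/
def of (p : LMTree C) : LM C := (some p : Option (LMTree C))

/-- The tree `T₁' ∪ g₁ · T₂'` where `Tᵢ' = Tᵢ ∪ gᵢ↓`. -/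
def prodTree (p q : LMTree C) : Set (RedPath E) :=
  (p.tree ∪ p.path.lower) ∪ p.path.translate (q.tree ∪ q.path.lower)

theorem isETree_prodTree (p q : LMTree C) (hc : p.path.rng = q.path.src) :
    IsETree p.path.src (prodTree p q) :=
  isETree_munn p.isY_union.isTree (Or.inr (RedPath.mem_lower_self _)) (hc ▸ q.isY_union.isTree)

/-- `((T₁' ∪ g₁ · T₂')_L, g₁ · g₂)`, when `T₁' ∪ g₁ · T₂'` is `C`-compatible. -/
def mulTree (p q : LMTree C) (hc : p.path.rng = q.path.src)
    (h : IsCompatible C (prodTree p q)) : LMTree C :=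
  have hmem : p.path.comp q.path hc ∈ prodTree p q :=
    Or.inr ⟨q.path, Or.inr (RedPath.mem_lower_self _), hc, rfl⟩
  { tree := treeL C (prodTree p q)
    path := p.path.comp q.path hc
    isYL := isYL_treeL ⟨isETree_prodTree p q hc, h⟩
    sep := h.sep _ hmem
    mem := pathL_mem_treeL hmem }

instance : Mul (LM C) where
  mul a b := match a, b with
    | some p, some q =>
      if h : ∃ _ : p.path.rng = q.path.src, IsCompatible C (prodTree p q) then
        of (mulTree p q h.1 h.2)
      else 0
    | _, _ => 0

/-- `((g⁻¹ · T')_L, g⁻¹)` where `T' = T ∪ g↓`. -/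
def invTree (p : LMTree C) : LMTree C :=
  have hY : IsY C p.path.rng (p.path.inv.translate (p.tree ∪ p.path.lower)) :=
    p.isY_union.translate_inv (Or.inr (RedPath.mem_lower_self _))
  have hc : p.path.inv.rng = (RedPath.unit p.path.src).src := p.path.inv_rng
  { tree := treeL C (p.path.inv.translate (p.tree ∪ p.path.lower))
    path := p.path.inv
    isYL := isYL_treeL hY
    sep := sep_inv p.sep
    mem := pathL_mem_treeL ⟨RedPath.unit p.path.src, p.isY_union.isTree.unit_mem, hc,
      RedPath.ext_toFree rfl (by
        rw [RedPath.toFree_comp _ _ hc, RedPath.toFree_unit, mul_one])⟩ }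

instance : Inv (LM C) where
  inv a := match a with
    | some p => of (invTree p)
    | none => 0

end LM

/-! ### The congruence `∼_L` -/

section SimL
variable {E : DirGraph.{u, w}} (C : Separation E)

/-- The relations `e⁻¹e ∼ r(e)` for all edges, and `ee⁻¹ ∼ s(e)` when `{e} ∈ C`. -/
inductive LRel : FreeIS E → FreeIS E → Prop
  | inv_mul (e : E.Edge) :
      LRel (FreeIS.letter (e, false) * FreeIS.letter (e, true)) (FreeIS.vert (E.rng e))
  | mul_inv (e : E.Edge) (he : C.IsPart {e}) :
      LRel (FreeIS.letter (e, true) * FreeIS.letter (e, false)) (FreeIS.vert (E.src e))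

/-- The congruence `∼_L` on the free inverse semigroup of `E`. -/
def simL : Con (FreeIS E) := conGen (LRel C)

/-- `T'` is a representative of `T`, i.e. `T' ∼_L T`, for `E`-trees `T`, `T'` with base
point `v`. -/
def IsRep (v : E.Vert) (T T' : Set (RedPath E)) : Prop :=
  ∃ (h : IsETree v T) (h' : IsETree v T'), simL C (FreeIS.idem h') (FreeIS.idem h)

/-- A nonzero element of `𝒴`. -/
@[ext] structure YTree where
  root : E.Vert
  tree : Set (RedPath E)
  isY : IsY C root tree

/-- The semilattice `𝒴`, the disjoint union of all the `𝒴(v)` and a zero (`none`). -/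
def Y := Option (YTree C)

end SimL

namespace Y
variable {E : DirGraph.{u, w}} {C : Separation E}

instance : Zero (Y C) := ⟨(none : Option (YTree C))⟩

/-- An element of `𝒴(v)` as an element of `𝒴`. -/
def of {v : E.Vert} {T : Set (RedPath E)} (h : IsY C v T) : Y C :=
  (some ⟨v, T, h⟩ : Option (YTree C))

theorem isY_union (S T : YTree C) (h : IsCompatible C (S.tree ∪ T.tree)) :
    IsY C S.root (S.tree ∪ T.tree) := by
  obtain ⟨hc, -⟩ := h.compat (RedPath.unit S.root) (Or.inl S.isY.isTree.unit_mem)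
    (RedPath.unit T.root) (Or.inr T.isY.isTree.unit_mem)
  have hr : T.root = S.root := by simpa using hc
  exact ⟨S.isY.isTree.union (hr ▸ T.isY.isTree), h⟩

/-- `S T = S ∪ T` if `S ∪ T` is `C`-compatible, and `S T = 0` otherwise. -/
instance : Mul (Y C) where
  mul a b := match a, b with
    | some S, some T =>
      if h : IsCompatible C (S.tree ∪ T.tree) then of (isY_union S T h) else 0
    | _, _ => 0

/-- The inclusion of `𝒴` into the idempotents of the free inverse semigroup. -/
def toFreeIS : Y C → FreeIS E
  | some S => FreeIS.idem S.isY.isTree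
  | none => 0

end Y

section YL
variable {E : DirGraph.{u, w}} (C : Separation E)

/-- The congruence `∼_L` on `𝒴`: the congruence generated by the restriction to `𝒴` of `∼_L` on
the free inverse semigroup. -/
def simY : Con (Y C) := conGen fun a b => simL C a.toFreeIS b.toFreeIS

/-- `𝒴^L = 𝒴/∼_L`. -/
abbrev YL := (simY C).Quotient

instance : Zero (YL C) := ⟨((0 : Y C) : (simY C).Quotient)⟩

variable {C}

/-- The class in `𝒴^L` of an element of `𝒴(v)`. -/
def cls {v : E.Vert} {T : Set (RedPath E)} (h : IsY C v T) : YL C :=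
  ((Y.of h : Y C) : (simY C).Quotient)

end YL

/-! ### Inverse semigroups with zero -/

/-- Inverse semigroups with zero. -/
class InvSemigroupZero (S : Type*) extends SemigroupWithZero S, InvolutiveInv S where
  mul_inv_rev (s t : S) : (s * t)⁻¹ = t⁻¹ * s⁻¹
  mul_inv_mul (s : S) : s * s⁻¹ * s = s
  mul_inv_comm (s t : S) : s * s⁻¹ * (t * t⁻¹) = t * t⁻¹ * (s * s⁻¹)

namespace InvSemigroupZero
variable {S : Type*} [InvSemigroupZero S]

theorem inv_of_idem {x : S} (hx : x * x = x) : x⁻¹ = x := by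
  have h1 : x⁻¹ * x⁻¹ = x⁻¹ := by rw [← mul_inv_rev, hx]
  have h3 : x⁻¹ * x * (x * x⁻¹) = x⁻¹ := by
    calc x⁻¹ * x * (x * x⁻¹) = x⁻¹ * (x * x) * x⁻¹ := by simp only [mul_assoc]
      _ = x⁻¹ * (x⁻¹)⁻¹ * x⁻¹ := by rw [hx, inv_inv]
      _ = x⁻¹ := mul_inv_mul _
  have h4 : x * x⁻¹ * (x⁻¹ * x) = x := by
    calc x * x⁻¹ * (x⁻¹ * x) = x * (x⁻¹ * x⁻¹) * x := by simp only [mul_assoc]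
      _ = x := by rw [h1, mul_inv_mul]
  have h5 := mul_inv_comm x x⁻¹
  rw [inv_inv] at h5
  rw [← h3, ← h5, h4]

theorem idem_comm {x y : S} (hx : x * x = x) (hy : y * y = y) : x * y = y * x := by
  have h := mul_inv_comm x y
  rwa [inv_of_idem hx, inv_of_idem hy, hx, hy] at h

end InvSemigroupZero

/-- The semilattice of idempotents of `S`. -/
def Idem (S : Type*) [InvSemigroupZero S] := {x : S // x * x = x}

instance {S : Type*} [InvSemigroupZero S] : Mul (Idem S) where
  mul x y := ⟨x.1 * y.1, by
    have h := InvSemigroupZero.idem_comm x.2 y.2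
    calc x.1 * y.1 * (x.1 * y.1) = x.1 * (y.1 * x.1) * y.1 := by simp only [mul_assoc]
      _ = x.1 * x.1 * (y.1 * y.1) := by rw [← h]; simp only [mul_assoc]
      _ = x.1 * y.1 := by rw [x.2, y.2]⟩

/-- Partial homomorphisms from a semigroup with zero to a group. -/
def IsPartialHom {S G : Type*} [Mul S] [Zero S] [Group G] (π : {x : S // x ≠ 0} → G) : Prop :=
  ∀ x y : {x : S // x ≠ 0}, ∀ h : x.1 * y.1 ≠ 0, π ⟨x.1 * y.1, h⟩ = π x * π y

/-- Idempotent pure maps: `π⁻¹(1)` is the set of the nonzero idempotents. -/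
def IsIdempotentPure {S G : Type*} [Mul S] [Zero S] [Group G] (π : {x : S // x ≠ 0} → G) : Prop :=
  ∀ x : {x : S // x ≠ 0}, π x = 1 ↔ x.1 * x.1 = x.1

/-! ### The Leavitt inverse semigroup -/

/-- The generators `v ∈ E⁰`, `e ∈ E¹` and `e⁻¹ ∈ E⁻¹`. -/
inductive Gen (E : DirGraph.{u, w})
  | vert (v : E.Vert)
  | letter (x : Letter E)

/-- Formal terms in the generators, for the operations of inverse semigroups with zero. -/
inductive Term (E : DirGraph.{u, w})
  | gen (x : Gen E)
  | zero
  | mul (a b : Term E)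
  | inv (a : Term E)

namespace Term

/-- The smallest congruence on terms which contains the laws of inverse semigroups with zero and the
defining relations of the Leavitt inverse semigroup. -/
inductive Rel {E : DirGraph.{u, w}} (C : Separation E) : Term E → Term E → Prop
  | refl (a) : Rel C a a
  | symm {a b} : Rel C a b → Rel C b a
  | trans {a b c} : Rel C a b → Rel C b c → Rel C a c
  | mul_congr {a a' b b'} : Rel C a a' → Rel C b b' → Rel C (mul a b) (mul a' b')
  | inv_congr {a a'} : Rel C a a' → Rel C (inv a) (inv a')
  | assoc (a b c) : Rel C (mul (mul a b) c) (mul a (mul b c))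
  | zero_mul (a) : Rel C (mul zero a) zero
  | mul_zero (a) : Rel C (mul a zero) zero
  | inv_inv (a) : Rel C (inv (inv a)) a
  | mul_inv_rev (a b) : Rel C (inv (mul a b)) (mul (inv b) (inv a))
  | mul_inv_mul (a) : Rel C (mul (mul a (inv a)) a) a
  | mul_inv_comm (a b) :
      Rel C (mul (mul a (inv a)) (mul b (inv b))) (mul (mul b (inv b)) (mul a (inv a)))
  | vert_mul_self (v) : Rel C (mul (gen (.vert v)) (gen (.vert v))) (gen (.vert v))
  | vert_mul_vert (v v') : v ≠ v' → Rel C (mul (gen (.vert v)) (gen (.vert v'))) zero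
  | src_mul (x) : Rel C (mul (gen (.vert (lsrc x))) (gen (.letter x))) (gen (.letter x))
  | mul_rng (x) : Rel C (mul (gen (.letter x)) (gen (.vert (lrng x)))) (gen (.letter x))
  | inv_mul_self (X) (e) : C.IsPart X → e ∈ X →
      Rel C (mul (gen (.letter (e, false))) (gen (.letter (e, true)))) (gen (.vert (E.rng e)))
  | inv_mul_ne (X) (e f) : C.IsPart X → e ∈ X → f ∈ X → e ≠ f →
      Rel C (mul (gen (.letter (e, false))) (gen (.letter (f, true)))) zero
  | mul_inv_self (e) : C.IsPart {e} →
      Rel C (mul (gen (.letter (e, true))) (gen (.letter (e, false)))) (gen (.vert (E.src e)))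

/-- The congruence `Rel` as a setoid. -/
def setoid {E : DirGraph.{u, w}} (C : Separation E) : Setoid (Term E) :=
  ⟨Rel C, Rel.refl, Rel.symm, Rel.trans⟩

end Term

/-- The Leavitt inverse semigroup `LI(E, C)`: the universal inverse semigroup with zero generated
by `E⁰ ∪ E¹ ∪ E⁻¹` subject to its defining relations. -/
def LI {E : DirGraph.{u, w}} (C : Separation E) := Quotient (Term.setoid C)

namespace LI
variable {E : DirGraph.{u, w}} {C : Separation E}

instance : InvSemigroupZero (LI C) where
  mul := Quotient.map₂ Term.mul fun _ _ h _ _ h' => Term.Rel.mul_congr h h'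
  zero := Quotient.mk _ Term.zero
  inv := Quotient.map Term.inv fun _ _ h => Term.Rel.inv_congr h
  mul_assoc := by
    rintro ⟨a⟩ ⟨b⟩ ⟨c⟩
    exact Quotient.sound (Term.Rel.assoc a b c)
  zero_mul := by
    rintro ⟨a⟩
    exact Quotient.sound (Term.Rel.zero_mul a)
  mul_zero := by
    rintro ⟨a⟩
    exact Quotient.sound (Term.Rel.mul_zero a)
  inv_inv := by
    rintro ⟨a⟩
    exact Quotient.sound (Term.Rel.inv_inv a)
  mul_inv_rev := by
    rintro ⟨a⟩ ⟨b⟩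
    exact Quotient.sound (Term.Rel.mul_inv_rev a b)
  mul_inv_mul := by
    rintro ⟨a⟩
    exact Quotient.sound (Term.Rel.mul_inv_mul a)
  mul_inv_comm := by
    rintro ⟨a⟩ ⟨b⟩
    exact Quotient.sound (Term.Rel.mul_inv_comm a b)

variable (C)

/-- The generator given by a vertex. -/
def vert (v : E.Vert) : LI C := Quotient.mk _ (Term.gen (.vert v))

/-- The generator given by an edge of the double graph. -/
def letter (x : Letter E) : LI C := Quotient.mk _ (Term.gen (.letter x))

end LI

/-! ### Partial actions and restricted semidirect products -/

/-- A partial action of a group `G` on a semilattice with zero `S`: ideals `D g` and isomorphisms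
`θ g : D g⁻¹ → D g` such that `θ 1` is the identity of `S` and `θ (g h)` extends `θ g ∘ θ h`. -/
structure PartialAction (G S : Type*) [Group G] [Mul S] [Zero S] where
  D : G → Set S
  θ : G → PartialEquiv S S
  source_eq : ∀ g, (θ g).source = D g⁻¹
  target_eq : ∀ g, (θ g).target = D g
  zero_mem : ∀ g, 0 ∈ D g
  mul_mem_left : ∀ g, ∀ x : S, ∀ y ∈ D g, x * y ∈ D g
  mul_mem_right : ∀ g, ∀ x ∈ D g, ∀ y : S, x * y ∈ D g
  map_mul : ∀ g, ∀ x ∈ D g⁻¹, ∀ y ∈ D g⁻¹, θ g (x * y) = θ g x * θ g y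
  D_one : D 1 = Set.univ
  θ_one : ∀ x, θ 1 x = x
  θ_mul : ∀ g h, ∀ x ∈ D h⁻¹, θ h x ∈ D g⁻¹ → x ∈ D (g * h)⁻¹ ∧ θ (g * h) x = θ g (θ h x)

section Semidirect
variable {G S : Type*} [Group G] [Mul S] [Zero S]

/-- The nonzero elements of the restricted semidirect product: pairs `(x, g)` with `x ∈ D g`,
`x ≠ 0`. -/
def SemidirectPair (α : PartialAction G S) := {p : S × G // p.1 ∈ α.D p.2 ∧ p.1 ≠ 0}

/-- The restricted semidirect product `S ⋊ʳ G`: all the pairs `(x, g)` with `x ∈ D g`, where the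
pairs `(0, g)` are identified to a zero (`none`). -/
def RestrictedSemidirect (α : PartialAction G S) := Option (SemidirectPair α)

namespace RestrictedSemidirect
variable {α : PartialAction G S}

instance : Zero (RestrictedSemidirect α) := ⟨(none : Option (SemidirectPair α))⟩

/-- The class of the pair `(x, g)`, for `x ∈ D g`. -/
def mk (x : S) (g : G) (h : x ∈ α.D g) : RestrictedSemidirect α :=
  if h0 : x = 0 then 0 else (some ⟨(x, g), h, h0⟩ : Option (SemidirectPair α))

theorem mul_mem {x y : S} {g h : G} (hx : x ∈ α.D g) (hy : y ∈ α.D h) :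
    α.θ g (α.θ g⁻¹ x * y) ∈ α.D (g * h) := by
  have h1 : α.θ g⁻¹ x ∈ α.D g⁻¹ := by
    rw [← α.target_eq]
    apply (α.θ g⁻¹).map_source
    rw [α.source_eq, inv_inv]
    exact hx
  have h2 : α.θ g⁻¹ x * y ∈ α.D g⁻¹ := α.mul_mem_right _ _ h1 _
  have h3 : α.θ g⁻¹ x * y ∈ (α.θ h).target := by
    rw [α.target_eq]
    exact α.mul_mem_left _ _ _ hy
  obtain ⟨z, hz, hzx⟩ : ∃ z ∈ (α.θ h).source, α.θ h z = α.θ g⁻¹ x * y :=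
    ⟨_, (α.θ h).map_target h3, (α.θ h).right_inv h3⟩
  rw [α.source_eq] at hz
  obtain ⟨h4, h5⟩ := α.θ_mul g h z hz (hzx ▸ h2)
  rw [← hzx, ← h5, ← α.target_eq]
  apply (α.θ (g * h)).map_source
  rw [α.source_eq]
  exact h4

/-- `(x, g) (y, h) = (θ_g (θ_{g⁻¹}(x) y), g h)`. -/
instance : Mul (RestrictedSemidirect α) where
  mul a b := match a, b with
    | some p, some q => mk _ _ (mul_mem p.2.1 q.2.1)
    | _, _ => 0

end RestrictedSemidirect

end Semidirect

end

end LeavittMunn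

open LeavittMunn

namespace LeavittMunn

noncomputable section

open scoped Classical

/-! ### Translates, products and cancellation in the fundamental groupoid -/

namespace RedPath
variable {E : DirGraph.{u, w}}

/-! Call a letter redundant if it is some `e⁻¹`, or an `e` with `{e} ∈ C`. Everything rests on one
invariant of a tree `T`: the set `nred C T` of its paths that end in a non-redundant letter.
Together with the base point it determines `T_L` and is determined by it (`treeL_eq_iff`).

The invariant is compatible with the Munn product. When `g · t` is reduced, either `t` cancels
completely and a prefix of `g` remains, or the last letter of `t` survives. So `nred` of `S ∪ g · T`
depends only on `nred` of `S` and of `T` (`nred_munn_congr`). Whether this union is `C`-compatible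
depends on no more than that, once `S` and `T` lie in `𝒴`: a forbidden branching `dx`, `dy` with `x
≠ y` in the same `X ∈ C` uses two non-redundant edges (`isCompatible_munn_congr`). Hence `(T, g) ↦
(T_L, g)`, with incompatible trees sent to `0`, is a surjective homomorphism `toLM` from the free
inverse semigroup. The Leavitt–Munn trees inherit the laws of an inverse semigroup from it, and the
choice of representatives does not matter.

In any inverse semigroup with a representation of the double graph, a Munn tree has a value: the
product of the range idempotents `ε(t) = t t⁻¹` of its paths, times the value of `g`. If `x x⁻¹ =
s(x)` for the redundant letters, then `ε(kx) = ε(k)` for such `x`, so the value depends only on `g`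
and `nred` (`PathRep.act_congr`). Applied to the quotient of the free inverse semigroup by `∼_L`,
this shows that `∼_L` means equal path and equal `nred` (`simL_of_iff`).

Applied to `LI(E, C)`, it gives the isomorphism. Every nonzero element of `LI(E, C)` is the value of
a Munn tree, and this tree is compatible because the relations `e⁻¹f = 0` annihilate the others. Two
such elements with the same Leavitt–Munn tree are equal by `act_congr`.

The degree `(T, g) ↦ ω(g)` is multiplicative on nonzero products, and a reduced path of degree `1`
is a vertex, so it is idempotent pure. The rest is a general fact about inverse semigroups
(`PureGrading`): an idempotent pure partial homomorphism to a group makes an element recoverable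
from its range idempotent and its degree. The maps `x x⁻¹ ↦ x⁻¹ x`, sorted by degree, then form a
partial action, and `x ↦ (x x⁻¹, deg x)` is the isomorphism onto the restricted semidirect product.
-/

theorem mem_translate {g x : RedPath E} {T : Set (RedPath E)} :
    x ∈ g.translate T ↔
      x.src = g.src ∧ ∃ h ∈ T, g.rng = h.src ∧ x.toFree = g.toFree * h.toFree := by
  constructor
  · rintro ⟨h, hh, hc, rfl⟩
    exact ⟨rfl, h, hh, hc, toFree_comp _ _ hc⟩
  · rintro ⟨hs, h, hh, hc, hx⟩
    exact ⟨h, hh, hc, ext_toFree hs (hx.trans (toFree_comp _ _ hc).symm)⟩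

theorem translate_union (g : RedPath E) (S T : Set (RedPath E)) :
    g.translate (S ∪ T) = g.translate S ∪ g.translate T := by
  ext x
  simp only [mem_translate, Set.mem_union]
  constructor
  · rintro ⟨hs, h, hh | hh, h2⟩
    exacts [Or.inl ⟨hs, h, hh, h2⟩, Or.inr ⟨hs, h, hh, h2⟩]
  · rintro (⟨hs, h, hh, h2⟩ | ⟨hs, h, hh, h2⟩)
    exacts [⟨hs, h, Or.inl hh, h2⟩, ⟨hs, h, Or.inr hh, h2⟩]

/-- A path is determined by its source and its image in the free group. Allowing any such `k` in
place of the composite makes the rule usable when the product is a unit or an inverse. -/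
theorem translate_translate {g h k : RedPath E} (hc : g.rng = h.src) (hks : k.src = g.src)
    (hk : k.toFree = g.toFree * h.toFree) (T : Set (RedPath E)) :
    g.translate (h.translate T) = k.translate T := by
  obtain rfl : k = g.comp h hc := ext_toFree hks (hk.trans (toFree_comp _ _ hc).symm)
  ext x
  simp only [mem_translate, comp_src, comp_rng, toFree_comp]
  constructor
  · rintro ⟨hs, y, ⟨hy, t, ht, h1, h2⟩, h3, h4⟩
    exact ⟨hs, t, ht, h1, by rw [h4, h2, mul_assoc]⟩
  · rintro ⟨hs, t, ht, h1, h2⟩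
    exact ⟨hs, h.comp t h1, ⟨rfl, t, ht, h1, toFree_comp _ _ h1⟩, hc,
      by rw [h2, toFree_comp, mul_assoc]⟩

theorem translate_unit {v : E.Vert} {T : Set (RedPath E)} (hT : ∀ t ∈ T, t.src = v) :
    (unit v).translate T = T := by
  ext x
  simp only [mem_translate, unit_src, unit_rng, toFree_unit, one_mul]
  constructor
  · rintro ⟨hs, t, ht, h1, h2⟩
    rwa [ext_toFree (hs.trans h1) h2]
  · intro hx
    exact ⟨hT x hx, x, hx, (hT x hx).symm, rfl⟩

@[simp] theorem inv_inv (g : RedPath E) : g.inv.inv = g :=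
  ext_toFree (by simp) (by simp)

theorem inv_translate_translate (g : RedPath E) {T : Set (RedPath E)}
    (hT : ∀ t ∈ T, t.src = g.rng) : g.inv.translate (g.translate T) = T := by
  rw [translate_translate (k := unit g.rng) (by simp) (by simp) (by simp)]
  exact translate_unit hT

theorem translate_inv_translate (g : RedPath E) {T : Set (RedPath E)}
    (hT : ∀ t ∈ T, t.src = g.src) : g.translate (g.inv.translate T) = T := by
  have := inv_translate_translate g.inv (T := T) (by simpa using hT)
  simpa using this

theorem eq_unit_of_toFree {g : RedPath E} (h : g.toFree = 1) : g = unit g.src :=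
  ext_toFree rfl (by rw [h, toFree_unit])

/-- What cancels in `g · h` is the longest common prefix `d` of `h` and `g⁻¹`. Once it is removed
the two remaining words do not interact, by `reduce_geodesic`. -/
theorem comp_decomp (g h : RedPath E) (hc : g.rng = h.src) :
    ∃ d a b, g.word = FreeGroup.invRev a ++ FreeGroup.invRev d ∧ h.word = d ++ b ∧
      (g.comp h hc).word = FreeGroup.invRev a ++ b := by
  obtain ⟨d, b, a, h1, h2, h3⟩ := exists_common_prefix h.word g.inv.word
  have hg : g.word = FreeGroup.invRev (d ++ a) := by
    rw [← h2]; exact FreeGroup.invRev_invRev.symm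
  refine ⟨d, a, b, ?_, h1, ?_⟩
  · rw [hg, FreeGroup.invRev_append]
  · change FreeGroup.reduce (g.word ++ h.word) = _
    rw [hg, h1]
    refine reduce_geodesic d b a ?_ ?_ h3
    · exact h.reduced.infix (h1 ▸ (List.suffix_append d b).isInfix)
    · exact g.inv.reduced.infix (h2 ▸ (List.suffix_append d a).isInfix)

/-- The two cases are `b = []`, where all of `h` is cancelled, and `b ≠ []`, where the last letter
of `h` survives. This dichotomy is why translation interacts well with last letters. -/
theorem comp_prefix_or_last (g h : RedPath E) (hc : g.rng = h.src) :
    (g.comp h hc).IsPrefix g ∨ (g.comp h hc).word.getLast? = h.word.getLast? := by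
  obtain ⟨d, a, b, h1, h2, h3⟩ := comp_decomp g h hc
  rcases List.eq_nil_or_concat b with rfl | ⟨b, x, rfl⟩
  · left
    exact ⟨rfl, by rw [h3, h1, List.append_nil]; exact List.prefix_append _ _⟩
  · right
    rw [h3, h2]
    simp

theorem eq_unit_of_word_eq_nil {g : RedPath E} (h : g.word = []) : g = unit g.src :=
  RedPath.ext rfl h

/-- The flipped letter is the inverse path. -/
theorem inv_letter (x : Letter E) : (letter x).inv = letter (x.1, !x.2) :=
  RedPath.ext (lsrc_flip x).symm rfl

theorem lower_letter (x : Letter E) : (letter x).lower = {unit (lsrc x), letter x} := by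
  ext k
  simp only [Set.mem_insert_iff, Set.mem_singleton_iff]
  constructor
  · rintro ⟨h1, h2⟩
    rcases List.prefix_concat_iff.1 (show k.word <+: [] ++ [x] from h2) with h3 | h3
    · exact Or.inr (RedPath.ext h1 h3)
    · exact Or.inl (RedPath.ext h1 (List.prefix_nil.1 h3))
  · rintro (rfl | rfl)
    · exact ⟨rfl, List.nil_prefix⟩
    · exact mem_lower_self _

end RedPath

/-! ### The non-redundant paths of a tree -/

section NonRedundant
variable {E : DirGraph.{u, w}} (C : Separation E)

/-- The paths in `T` whose last letter is not redundant. -/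
def nred (T : Set (RedPath E)) : Set (RedPath E) :=
  {t | t ∈ T ∧ ∃ x, t.word.getLast? = some x ∧ ¬ IsRedundant C x}

variable {C}

theorem nred_mono {S T : Set (RedPath E)} (h : S ⊆ T) : nred C S ⊆ nred C T :=
  fun _ ht => ⟨h ht.1, ht.2⟩

theorem pathL_eq_self {g : RedPath E} {x : Letter E} (hx : g.word.getLast? = some x)
    (hr : ¬ IsRedundant C x) : pathL C g = g := by
  refine RedPath.ext rfl ?_
  change List.rdropWhile _ g.word = g.word
  rw [List.rdropWhile_eq_self_iff]
  intro hl
  rw [List.getLast?_eq_some_getLast hl] at hx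
  rw [Option.some.inj hx]
  simpa using hr

theorem pathL_cases (g : RedPath E) : (pathL C g).word = [] ∨
    ∃ x, (pathL C g).word.getLast? = some x ∧ ¬ IsRedundant C x := by
  by_cases h : (pathL C g).word = []
  · exact Or.inl h
  · refine Or.inr ⟨_, List.getLast?_eq_some_getLast h, ?_⟩
    have h2 := List.rdropWhile_last_not (fun x => decide (IsRedundant C x)) g.word h
    exact fun hr => h2 (decide_eq_true hr)

/-- Each `g_L` is trivial or ends in a non-redundant letter, and a path of the latter kind is its
own `g_L`. So `T_L` is generated by the base point and `nred C T`. -/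
theorem mem_treeL_iff {v : E.Vert} {T : Set (RedPath E)} (hT : IsETree v T) {h : RedPath E} :
    h ∈ treeL C T ↔ h = RedPath.unit v ∨ ∃ k ∈ nred C T, h.IsPrefix k := by
  constructor
  · rintro ⟨g, hg, hh⟩
    rcases pathL_cases (C := C) g with h0 | h0
    · left
      refine RedPath.ext (hh.1.trans (hT.src_eq g hg)) ?_
      have := hh.2
      rw [h0] at this
      exact List.prefix_nil.1 this
    · exact Or.inr ⟨_, ⟨hT.lower g hg _ (pathL_isPrefix g), h0⟩, hh⟩
  · rintro (rfl | ⟨k, ⟨hk, x, hx, hr⟩, hh⟩)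
    · exact ⟨_, hT.unit_mem, rfl, List.nil_prefix⟩
    · exact ⟨k, hk, by rwa [pathL_eq_self hx hr]⟩

theorem nred_treeL {v : E.Vert} {T : Set (RedPath E)} (hT : IsETree v T) :
    nred C (treeL C T) = nred C T := by
  refine Set.Subset.antisymm (nred_mono (treeL_subset hT)) ?_
  intro k hk
  exact ⟨(mem_treeL_iff hT).2 (Or.inr ⟨k, hk, RedPath.IsPrefix.refl k⟩), hk.2⟩

theorem treeL_eq_iff {v : E.Vert} {S T : Set (RedPath E)} (hS : IsETree v S) (hT : IsETree v T) :
    treeL C S = treeL C T ↔ nred C S = nred C T := by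
  constructor
  · intro h
    rw [← nred_treeL hS, h, nred_treeL hT]
  · intro h
    ext k
    rw [mem_treeL_iff hS, mem_treeL_iff hT, h]

theorem isETree_treeL {v : E.Vert} {T : Set (RedPath E)} (hT : IsETree v T) :
    IsETree v (treeL C T) where
  finite := hT.finite.subset (treeL_subset hT)
  unit_mem := ⟨_, hT.unit_mem, rfl, List.nil_prefix⟩
  src_eq := fun g hg => hT.src_eq g (treeL_subset hT hg)
  lower := by
    rintro g ⟨k, hk, hgk⟩ h hh
    exact ⟨k, hk, hh.trans hgk⟩

theorem isLReduced_treeL (T : Set (RedPath E)) : IsLReduced C (treeL C T) := by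
  rintro g ⟨k, hk, hgk⟩ hmax x hx hr
  rw [← hmax _ (pathL_mem_treeL hk) hgk] at hx
  rcases pathL_cases (C := C) k with h0 | ⟨y, hy, hyr⟩
  · simp [h0] at hx
  · rw [hx] at hy
    exact hyr (Option.some.inj hy ▸ hr)

/-- As `T` is finite, each of its paths has a longest extension `m` in `T`. This `m` is maximal,
hence trivial or with a non-redundant last letter, and it places the path in `T_L`. -/
theorem IsLReduced.treeL_eq {v : E.Vert} {T : Set (RedPath E)} (hT : IsETree v T)
    (h : IsLReduced C T) : treeL C T = T := by
  refine Set.Subset.antisymm (treeL_subset hT) ?_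
  intro k hk
  obtain ⟨m, ⟨hm, hkm⟩, hmax⟩ := Set.exists_max_image {m | m ∈ T ∧ k.IsPrefix m}
    (fun m => m.word.length) (hT.finite.subset fun _ h => h.1) ⟨k, hk, RedPath.IsPrefix.refl k⟩
  have hmax' : ∀ h ∈ T, m.IsPrefix h → h = m := by
    intro n hn hmn
    have h1 := hmax n ⟨hn, hkm.trans hmn⟩
    exact (RedPath.ext hmn.1 (hmn.2.eq_of_length_le h1)).symm
  rw [mem_treeL_iff hT]
  rcases List.eq_nil_or_concat m.word with h0 | ⟨l, x, hl⟩
  · left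
    refine RedPath.ext (hT.src_eq k hk) ?_
    have := hkm.2
    rw [h0] at this
    exact List.prefix_nil.1 this
  · right
    have hx : m.word.getLast? = some x := by rw [hl]; simp
    exact ⟨m, ⟨hm, x, hx, h m hm hmax' x hx⟩, hkm⟩

/-- The non-redundant part of `S ∪ g · T` depends only on those of `S` and `T`. -/
theorem nred_munn_subset {v : E.Vert} {S S' T T' : Set (RedPath E)} {g : RedPath E}
    (hS' : IsETree v S') (hg : g ∈ S') (h1 : nred C S ⊆ nred C S')
    (h2 : nred C T ⊆ nred C T') :
    nred C (S ∪ g.translate T) ⊆ nred C (S' ∪ g.translate T') := by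
  rintro k ⟨hk | ⟨t, ht, hc, rfl⟩, x, hx, hr⟩
  · exact nred_mono Set.subset_union_left (h1 ⟨hk, x, hx, hr⟩)
  · rcases RedPath.comp_prefix_or_last g t hc with h | h
    · exact ⟨Or.inl (hS'.lower g hg _ h), x, hx, hr⟩
    · exact ⟨Or.inr ⟨t, (h2 ⟨ht, x, h ▸ hx, hr⟩).1, hc, rfl⟩, x, hx, hr⟩

theorem nred_munn_congr {v : E.Vert} {S S' T T' : Set (RedPath E)} {g : RedPath E}
    (hS : IsETree v S) (hgS : g ∈ S) (hS' : IsETree v S') (hg : g ∈ S')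
    (h1 : nred C S = nred C S') (h2 : nred C T = nred C T') :
    nred C (S ∪ g.translate T) = nred C (S' ∪ g.translate T') :=
  Set.Subset.antisymm (nred_munn_subset hS' hg h1.subset h2.subset)
    (nred_munn_subset hS hgS h1.superset h2.superset)

/-- A prefix of `g⁻¹` is `g⁻¹ · p`, where `p` is the complementary prefix of `g`. -/
theorem lower_inv_subset {v : E.Vert} {T : Set (RedPath E)} (hT : IsETree v T) {g : RedPath E}
    (hg : g ∈ T) : g.inv.lower ⊆ g.inv.translate T := by
  rintro k ⟨hk1, b, hb⟩
  have hw : g.word = FreeGroup.invRev b ++ FreeGroup.invRev k.word := by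
    have := congrArg FreeGroup.invRev hb
    rw [FreeGroup.invRev_append] at this
    rw [this]
    exact FreeGroup.invRev_invRev.symm
  have hp : FreeGroup.invRev b <+: g.word := ⟨_, hw.symm⟩
  refine RedPath.mem_translate.2 ⟨hk1, g.pre _ hp, hT.lower g hg _ (g.pre_isPrefix _ hp),
    g.inv_rng, ?_⟩
  rw [RedPath.toFree_inv]
  change FreeGroup.mk k.word = (FreeGroup.mk g.word)⁻¹ * FreeGroup.mk (FreeGroup.invRev b)
  rw [hw, ← FreeGroup.mul_mk, ← FreeGroup.inv_mk, ← FreeGroup.inv_mk]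
  group

theorem IsETree.translate_inv {T : Set (RedPath E)} {g : RedPath E} (hT : IsETree g.src T)
    (hg : g ∈ T) : IsETree g.rng (g.inv.translate T) := by
  have h1 : IsETree g.rng (g.inv.lower ∪ g.inv.translate T) :=
    isETree_munn (isETree_lower g.inv) (RedPath.mem_lower_self _) (by rwa [RedPath.inv_rng])
  rwa [Set.union_eq_right.2 (lower_inv_subset hT hg)] at h1

/-- Since `g⁻¹ · S` already contains the prefixes of `g⁻¹`, it is the Munn union of `(g⁻¹)↓` with
the translate of `S`, to which `nred_munn_congr` applies. -/
theorem nred_translate_inv_congr {S T : Set (RedPath E)} {g : RedPath E} (hS : IsETree g.src S)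
    (hT : IsETree g.src T) (hgS : g ∈ S) (hgT : g ∈ T) (h : nred C S = nred C T) :
    nred C (g.inv.translate S) = nred C (g.inv.translate T) := by
  have := nred_munn_congr (isETree_lower g.inv) (RedPath.mem_lower_self _) (isETree_lower g.inv)
    (RedPath.mem_lower_self _) rfl h
  rwa [Set.union_eq_right.2 (lower_inv_subset hS hgS),
    Set.union_eq_right.2 (lower_inv_subset hT hgT)] at this

/-- Compatibility of `S ∪ T` depends only on the non-redundant parts of `S` and `T`. -/
theorem isCompatible_union_congr {v : E.Vert} {S S' T T' : Set (RedPath E)} (hS' : IsY C v S')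
    (hT' : IsY C v T') (h1 : nred C S' ⊆ nred C S) (h2 : nred C T' ⊆ nred C T)
    (h : IsCompatible C (S ∪ T)) : IsCompatible C (S' ∪ T') := by
  have key : ∀ X, C.IsPart X → ∀ x ∈ X, ∀ y ∈ X, ∀ d : List (Letter E), ∀ g ∈ S', ∀ k ∈ T',
      g.word = d ++ [(x, true)] → k.word = d ++ [(y, true)] → x = y := by
    intro X hX x hx y hy d g hg k hk hgw hkw
    by_contra hne
    -- If `x ≠ y` then `X` is not a singleton, so no edge of `X` is redundant. The branching
    -- therefore already occurs in `S ∪ T`.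
    have hr : ∀ z ∈ X, ¬ IsRedundant C (z, true) := by
      rintro z hz (h0 | h0)
      · simp at h0
      · have h3 := C.eq_of_mem h0 hX (e := z) rfl hz
        rw [← h3] at hx hy
        exact hne (hx.trans hy.symm)
    have hg' := h1 ⟨hg, _, by rw [hgw]; simp, hr x hx⟩
    have hk' := h2 ⟨hk, _, by rw [hkw]; simp, hr y hy⟩
    exact hne (h.local hX hx hy d (Or.inl hg'.1) (Or.inr hk'.1) hgw hkw)
  refine isCompatible_of_local (hS'.isTree.union hT'.isTree) ?_ ?_
  · rintro g (hg | hg)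
    exacts [hS'.compatible.sep g hg, hT'.compatible.sep g hg]
  · rintro X hX x hx y hy d g (hg | hg) k (hk | hk) hgw hkw
    · exact hS'.compatible.local hX hx hy d hg hk hgw hkw
    · exact key X hX x hx y hy d g hg k hk hgw hkw
    · exact (key X hX y hy x hx d k hk g hg hkw hgw).symm
    · exact hT'.compatible.local hX hx hy d hg hk hgw hkw

theorem inv_translate_munn {S T : Set (RedPath E)} (g : RedPath E)
    (hT : IsETree g.rng T) :
    g.inv.translate (S ∪ g.translate T) = g.inv.translate S ∪ T := by
  rw [RedPath.translate_union, RedPath.inv_translate_translate g hT.src_eq]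

theorem isCompatible_munn_right {S T : Set (RedPath E)} {g : RedPath E} (hS : IsETree g.src S)
    (hg : g ∈ S) (hT : IsETree g.rng T) (h : IsCompatible C (S ∪ g.translate T)) :
    IsCompatible C (g.inv.translate S ∪ T) := by
  have h1 : IsY C g.src (S ∪ g.translate T) := ⟨isETree_munn hS hg hT, h⟩
  have h2 := (h1.translate_inv (Or.inl hg)).compatible
  rwa [inv_translate_munn g hT] at h2

/-- Translation by `g⁻¹` preserves compatibility and turns `S ∪ g · T` into `g⁻¹ · S ∪ T`, a union
of two trees based at `r(g)`. The criterion for unions applies there. As `g⁻¹` lies in `g⁻¹ · S'`,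
one can then translate back. -/
theorem isCompatible_munn_congr {S S' T T' : Set (RedPath E)} {g : RedPath E}
    (hS : IsETree g.src S) (hS' : IsY C g.src S') (hT : IsETree g.rng T) (hT' : IsY C g.rng T')
    (hg : g ∈ S) (hg' : g ∈ S') (h1 : nred C S = nred C S') (h2 : nred C T = nred C T')
    (h : IsCompatible C (S ∪ g.translate T)) : IsCompatible C (S' ∪ g.translate T') := by
  have h3 : IsCompatible C (g.inv.translate S' ∪ T') :=
    isCompatible_union_congr (hS'.translate_inv hg') hT'
      (nred_translate_inv_congr hS hS'.isTree hg hg' h1).superset h2.superset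
      (isCompatible_munn_right hS hg hT h)
  have h4 : IsY C g.inv.src (g.inv.translate S' ∪ T') :=
    ⟨(hS'.isTree.translate_inv hg').union hT'.isTree, h3⟩
  have h5 := (h4.translate_inv
    (Or.inl (lower_inv_subset hS'.isTree hg' (RedPath.mem_lower_self _)))).compatible
  rwa [RedPath.inv_inv, RedPath.translate_union,
    RedPath.translate_inv_translate g hS'.isTree.src_eq] at h5

/-- The prefixes of one path form a chain, so there is no branching: prefixes of equal length
coincide. -/
theorem isY_lower {g : RedPath E} (hg : IsSeparated C g) : IsY C g.src g.lower where
  isTree := isETree_lower g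
  compatible := by
    refine isCompatible_of_local (isETree_lower g) (fun k hk => hg.of_prefix hk) ?_
    intro X hX x hx y hy d k hk m hm hkw hmw
    have h1 := List.prefix_of_prefix_length_le hk.2 hm.2 (by simp [hkw, hmw])
    rw [hkw, hmw] at h1
    have h2 := h1.eq_of_length (by simp)
    simpa using List.append_cancel_left h2

theorem isSeparated_letter (x : Letter E) : IsSeparated C (RedPath.letter x) := by
  intro X _ a _ b _ h
  have := h.length_le
  simp [RedPath.letter] at this

theorem isSeparated_unit (v : E.Vert) : IsSeparated C (RedPath.unit v) := by
  intro X _ a _ b _ h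
  have := h.length_le
  simp [RedPath.unit] at this

theorem nred_unit (v : E.Vert) : nred C {RedPath.unit v} = ∅ := by
  ext k
  simp only [nred, Set.mem_singleton_iff, Set.mem_ofPred_eq, Set.mem_empty_iff_false, iff_false]
  rintro ⟨rfl, x, hx, -⟩
  simp [RedPath.unit] at hx

theorem nred_lower_letter {x : Letter E} (hx : IsRedundant C x) :
    nred C (RedPath.letter x).lower = ∅ := by
  rw [RedPath.lower_letter]
  ext k
  simp only [nred, Set.mem_insert_iff, Set.mem_singleton_iff, Set.mem_ofPred_eq,
    Set.mem_empty_iff_false, iff_false]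
  rintro ⟨rfl | rfl, y, hy, hr⟩
  · simp [RedPath.unit] at hy
  · simp only [RedPath.letter, List.getLast?_singleton, Option.some.injEq] at hy
    exact hr (hy ▸ hx)

/-- The prefixes of `g` beyond `g_L` end in redundant letters, and `g_L` is already in `T`. -/
theorem LMTree.nred_union (p : LMTree C) :
    nred C (p.tree ∪ p.path.lower) = nred C p.tree := by
  refine Set.Subset.antisymm ?_ (nred_mono Set.subset_union_left)
  rintro k ⟨hk | hk, x, hx, hr⟩
  · exact ⟨hk, x, hx, hr⟩
  · refine ⟨p.isYL.isY.isTree.lower _ p.mem k ⟨hk.1, ?_⟩, x, hx, hr⟩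
    by_contra hcon
    obtain ⟨l, hl⟩ := List.getLast?_eq_some_iff.1 hx
    rw [hl] at hcon
    exact hr (redundant_of_prefix (hl ▸ hk.2) hcon)

theorem LMTree.treeL_eq (p : LMTree C) : treeL C p.tree = p.tree :=
  p.isYL.lreduced.treeL_eq p.isYL.isY.isTree

theorem LMTree.treeL_union (p : LMTree C) : treeL C (p.tree ∪ p.path.lower) = p.tree := by
  rw [← p.treeL_eq, treeL_eq_iff (p.treeL_eq.symm ▸ p.isY_union.isTree) p.isYL.isY.isTree,
    p.treeL_eq, p.nred_union]

end NonRedundant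

/-! ### The Munn trees as an inverse semigroup -/

namespace FreeIS
variable {E : DirGraph.{u, w}}

@[elab_as_elim]
theorem cases_of {P : FreeIS E → Prop} (zero : P 0) (of : ∀ p, P (of p)) (a : FreeIS E) : P a := by
  rcases a with _ | p
  exacts [zero, of p]

theorem of_ne_zero (p : MunnTree E) : of p ≠ 0 := Option.some_ne_none p

theorem of_injective : Function.Injective (of (E := E)) := Option.some_injective _

theorem of_mul_of {p q : MunnTree E} (hc : p.path.rng = q.path.src) :
    of p * of q = of (mulTree p q hc) := dif_pos hc

theorem of_mul_of_ne {p q : MunnTree E} (hc : p.path.rng ≠ q.path.src) :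
    of p * of q = 0 := dif_neg hc

protected theorem zero_mul (a : FreeIS E) : 0 * a = 0 := rfl

protected theorem mul_zero (a : FreeIS E) : a * 0 = 0 := by
  rcases a with _ | p <;> rfl

/-- `(T, g)⁻¹ = (g⁻¹ · T, g⁻¹)`. -/
def invTree (p : MunnTree E) : MunnTree E where
  tree := p.path.inv.translate p.tree
  path := p.path.inv
  isTree := p.isTree.translate_inv p.mem
  mem := lower_inv_subset p.isTree p.mem (RedPath.mem_lower_self _)

instance : Inv (FreeIS E) where
  inv a := match a with
    | some p => of (invTree p)
    | none => 0

theorem inv_of (p : MunnTree E) : (of p)⁻¹ = of (invTree p) := rfl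

theorem mulTree_eq_of {p q r : MunnTree E} (hc : p.path.rng = q.path.src)
    (h1 : r.tree = p.tree ∪ p.path.translate q.tree) (hs : r.path.src = p.path.src)
    (h2 : r.path.toFree = p.path.toFree * q.path.toFree) : of p * of q = of r := by
  rw [of_mul_of hc]
  refine congrArg of (MunnTree.ext h1.symm (RedPath.ext_toFree hs.symm ?_))
  rw [h2]
  exact RedPath.toFree_comp _ _ hc

protected theorem mul_assoc (a b c : FreeIS E) : a * b * c = a * (b * c) := by
  induction a using cases_of with
  | zero => rfl
  | of p =>
  induction b using cases_of with
  | zero => rw [FreeIS.mul_zero, FreeIS.zero_mul, FreeIS.mul_zero]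
  | of q =>
  induction c using cases_of with
  | zero => simp only [FreeIS.mul_zero]
  | of r =>
  by_cases h1 : p.path.rng = q.path.src
  · by_cases h2 : q.path.rng = r.path.src
    · rw [of_mul_of h1, of_mul_of h2]
      have h3 : (mulTree p q h1).path.rng = r.path.src := (RedPath.comp_rng _ _ h1).trans h2
      have h4 : p.path.rng = (mulTree q r h2).path.src := h1
      rw [of_mul_of h3]
      symm
      refine mulTree_eq_of h4 ?_ rfl ?_
      · change (p.tree ∪ p.path.translate q.tree) ∪ (p.path.comp q.path h1).translate r.tree =
          p.tree ∪ p.path.translate (q.tree ∪ q.path.translate r.tree)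
        rw [RedPath.translate_union, Set.union_assoc,
          RedPath.translate_translate (k := p.path.comp q.path h1) h1 rfl (by simp)]
      · simp only [mulTree, RedPath.toFree_comp, mul_assoc]
    · rw [of_mul_of h1, of_mul_of_ne h2, FreeIS.mul_zero, of_mul_of_ne]
      exact fun h => h2 ((RedPath.comp_rng _ _ h1).symm.trans h)
  · rw [of_mul_of_ne h1, FreeIS.zero_mul]
    by_cases h2 : q.path.rng = r.path.src
    · rw [of_mul_of h2, of_mul_of_ne]
      exact h1
    · rw [of_mul_of_ne h2, FreeIS.mul_zero]

theorem of_mul_inv (p : MunnTree E) : of p * (of p)⁻¹ = idem p.isTree := by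
  rw [inv_of]
  refine mulTree_eq_of (r := ⟨p.tree, _, _, _⟩) rfl ?_ rfl ?_
  · change p.tree = p.tree ∪ p.path.translate (p.path.inv.translate p.tree)
    rw [RedPath.translate_inv_translate _ p.isTree.src_eq, Set.union_self]
  · simp [invTree]

theorem idem_mul_of {v : E.Vert} {T : Set (RedPath E)} (hT : IsETree v T) (q : MunnTree E)
    (hv : q.path.src = v) {r : MunnTree E} (h1 : r.tree = T ∪ q.tree) (h2 : r.path = q.path) :
    idem hT * of q = of r := by
  refine mulTree_eq_of (p := ⟨T, _, _, _⟩) hv.symm ?_ (by rw [h2, hv]; rfl) (by simp [h2])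
  rw [h1]
  congr 1
  exact (RedPath.translate_unit fun t ht => (q.isTree.src_eq t ht).trans hv).symm

theorem idem_mul_idem {v : E.Vert} {S T : Set (RedPath E)} (hS : IsETree v S)
    (hT : IsETree v T) : idem hS * idem hT = idem (hS.union hT) :=
  idem_mul_of hS _ rfl rfl rfl

theorem idem_mul_idem_ne {v v' : E.Vert} {S T : Set (RedPath E)} (hS : IsETree v S)
    (hT : IsETree v' T) (h : v ≠ v') : idem hS * idem hT = 0 :=
  of_mul_of_ne h

theorem idem_congr {v : E.Vert} {S T : Set (RedPath E)} (hS : IsETree v S)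
    (hT : IsETree v T) (h : S = T) : idem hS = idem hT := by
  subst h; rfl

instance : InvSemigroupZero (FreeIS E) where
  mul_assoc := FreeIS.mul_assoc
  zero_mul := FreeIS.zero_mul
  mul_zero := FreeIS.mul_zero
  inv_inv a := by
    induction a using cases_of with
    | zero => rfl
    | of p =>
      rw [inv_of, inv_of]
      refine congrArg of (MunnTree.ext ?_ (RedPath.inv_inv _))
      change p.path.inv.inv.translate (p.path.inv.translate p.tree) = p.tree
      rw [RedPath.inv_inv]
      exact RedPath.translate_inv_translate _ p.isTree.src_eq
  mul_inv_rev a b := by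
    induction a using cases_of with
    | zero => exact (FreeIS.mul_zero _).symm
    | of p =>
    induction b using cases_of with
    | zero => rw [FreeIS.mul_zero]; rfl
    | of q =>
    by_cases h : p.path.rng = q.path.src
    · rw [of_mul_of h, inv_of, inv_of, inv_of]
      symm
      have h' : q.path.inv.rng = p.path.inv.src := by
        rw [RedPath.inv_rng, RedPath.inv_src]; exact h.symm
      refine mulTree_eq_of h' ?_ ?_ ?_
      · change (p.path.comp q.path h).inv.translate (p.tree ∪ p.path.translate q.tree) =
          q.path.inv.translate q.tree ∪ q.path.inv.translate (p.path.inv.translate p.tree)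
        rw [← RedPath.translate_translate (g := q.path.inv) (h := p.path.inv) h' (by simp)
          (by simp), ← RedPath.translate_union, inv_translate_munn _ (h ▸ q.isTree),
          Set.union_comm]
      · change (p.path.comp q.path h).inv.src = q.path.inv.src
        simp
      · simp [invTree, mulTree]
    · rw [of_mul_of_ne h, inv_of, inv_of, of_mul_of_ne]
      · rfl
      · simp only [invTree, RedPath.inv_rng, RedPath.inv_src]
        exact fun h' => h h'.symm
  mul_inv_mul a := by
    induction a using cases_of with
    | zero => rfl
    | of p =>
      rw [of_mul_inv]
      exact idem_mul_of _ _ rfl (Set.union_self _).symm rfl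
  mul_inv_comm a b := by
    induction a using cases_of with
    | zero => exact (FreeIS.mul_zero _).symm
    | of p =>
    induction b using cases_of with
    | zero => exact FreeIS.mul_zero _
    | of q =>
      rw [of_mul_inv, of_mul_inv]
      by_cases h : p.path.src = q.path.src
      · have hq : IsETree p.path.src q.tree := h ▸ q.isTree
        have hi : idem q.isTree = idem hq := by
          refine congrArg of (MunnTree.ext rfl ?_)
          change RedPath.unit _ = RedPath.unit _
          rw [h]
        rw [hi, idem_mul_idem, idem_mul_idem]
        exact idem_congr _ _ (Set.union_comm _ _)
      · rw [idem_mul_idem_ne _ _ h, idem_mul_idem_ne _ _ (Ne.symm h)]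

theorem letter_inv (x : Letter E) : (letter x)⁻¹ = letter (x.1, !x.2) := by
  refine congrArg of (MunnTree.ext ?_ (RedPath.inv_letter x))
  change (RedPath.letter x).inv.translate (RedPath.letter x).lower =
    (RedPath.letter (x.1, !x.2)).lower
  rw [RedPath.lower_letter, RedPath.lower_letter]
  have h : (RedPath.letter x).inv.src = lsrc (x.1, !x.2) := by rw [RedPath.inv_letter]; rfl
  have h' : (RedPath.letter x).inv.rng = lsrc x := RedPath.inv_rng _
  ext k
  simp only [RedPath.mem_translate, Set.mem_insert_iff, Set.mem_singleton_iff,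
    exists_eq_or_imp, exists_eq_left]
  constructor
  · rintro ⟨h1, ⟨h2, h3⟩ | ⟨h2, h3⟩⟩
    · right
      refine RedPath.ext_toFree (h1.trans h) ?_
      rw [h3, RedPath.toFree_unit, mul_one, RedPath.inv_letter]
    · left
      exact RedPath.ext_toFree (h1.trans h) (by simp [h3])
  · rintro (rfl | rfl)
    · exact ⟨h.symm, Or.inr ⟨h', by simp⟩⟩
    · exact ⟨h.symm, Or.inl ⟨h', by rw [← RedPath.inv_letter]; simp⟩⟩

theorem letter_mul_flip (x : Letter E) :
    letter x * letter (x.1, !x.2) = idem (isETree_lower (RedPath.letter x)) := by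
  rw [← letter_inv]
  exact of_mul_inv _

theorem vert_mul_of (q : MunnTree E) : vert q.path.src * of q = of q :=
  idem_mul_of _ _ rfl (Set.union_eq_right.2 (Set.singleton_subset_iff.2 q.isTree.unit_mem)).symm
    rfl

/-- This is the mirror image of `vert_mul_of` under inversion, as vertices are self-inverse. -/
theorem of_mul_vert (q : MunnTree E) : of q * vert q.path.rng = of q := by
  have h1 := vert_mul_of (invTree q)
  have h2 := congrArg (·⁻¹) h1
  have h3 : (vert q.path.rng)⁻¹ = vert q.path.rng :=
    InvSemigroupZero.inv_of_idem ((idem_mul_idem _ _).trans (idem_congr _ _ (Set.union_self _)))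
  simp only [InvSemigroupZero.mul_inv_rev, ← inv_of, inv_inv] at h2
  change of q * (vert q.path.rng)⁻¹ = of q at h2
  rwa [h3] at h2

end FreeIS

/-! ### The homomorphism from Munn trees to Leavitt–Munn trees -/

namespace LM
variable {E : DirGraph.{u, w}} {C : Separation E}

theorem of_ne_zero (p : LMTree C) : of p ≠ 0 := Option.some_ne_none p

theorem of_injective : Function.Injective (of (C := C)) := Option.some_injective _

theorem eq_zero_or_of (a : LM C) : a = 0 ∨ ∃ p, a = of p := by
  rcases a with _ | p
  exacts [Or.inl rfl, Or.inr ⟨p, rfl⟩]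

theorem of_mul_of {p q : LMTree C} (hc : p.path.rng = q.path.src)
    (h : IsCompatible C (prodTree p q)) : of p * of q = of (mulTree p q hc h) :=
  dif_pos ⟨hc, h⟩

theorem of_mul_of_eq_zero {p q : LMTree C}
    (h : ¬ ∃ _ : p.path.rng = q.path.src, IsCompatible C (prodTree p q)) :
    of p * of q = 0 := dif_neg h

protected theorem zero_mul (a : LM C) : 0 * a = 0 := rfl

protected theorem mul_zero (a : LM C) : a * 0 = 0 := by
  rcases a with _ | p <;> rfl

/-- The Leavitt-Munn tree `(T_L, g)`, for a Munn tree `(T, g)` with `T` in `𝒴`. -/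
def ofMunn (p : MunnTree E) (h : IsCompatible C p.tree) : LMTree C where
  tree := treeL C p.tree
  path := p.path
  isYL := isYL_treeL ⟨p.isTree, h⟩
  sep := h.sep _ p.mem
  mem := pathL_mem_treeL p.mem

end LM

variable {E : DirGraph.{u, w}} (C : Separation E)

/-- The map `(T, g) ↦ (T_L, g)`, with value `0` if `T` is not `C`-compatible. -/
def toLM : FreeIS E → LM C
  | some p => if h : IsCompatible C p.tree then LM.of (LM.ofMunn p h) else 0
  | none => 0

variable {C}

theorem toLM_zero : toLM C (0 : FreeIS E) = 0 := rfl

theorem toLM_of {p : MunnTree E} (h : IsCompatible C p.tree) :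
    toLM C (FreeIS.of p) = LM.of (LM.ofMunn p h) := dif_pos h

theorem toLM_of_eq_zero {p : MunnTree E} (h : ¬ IsCompatible C p.tree) :
    toLM C (FreeIS.of p) = 0 := dif_neg h

theorem toLM_congr {p q : MunnTree E} (hp : IsCompatible C p.tree) (hq : IsCompatible C q.tree)
    (h : p.path = q.path) (hn : nred C p.tree = nred C q.tree) :
    toLM C (FreeIS.of p) = toLM C (FreeIS.of q) := by
  rw [toLM_of hp, toLM_of hq]
  refine congrArg LM.of (LMTree.ext ?_ h)
  exact (treeL_eq_iff p.isTree (h ▸ q.isTree)).2 hn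

/-- The Munn tree `(T ∪ g↓, g)` of a Leavitt-Munn tree `(T, g)`. -/
def LMTree.toMunn (p : LMTree C) : MunnTree E where
  tree := p.tree ∪ p.path.lower
  path := p.path
  isTree := p.isY_union.isTree
  mem := Or.inr (RedPath.mem_lower_self _)

theorem toLM_toMunn (p : LMTree C) : toLM C (FreeIS.of p.toMunn) = LM.of p := by
  rw [toLM_of (p := p.toMunn) p.isY_union.compatible]
  exact congrArg LM.of (LMTree.ext p.treeL_union rfl)

/-- The representative `T' = T_L ∪ g↓` of a compatible Munn tree. -/
theorem nred_toMunn_ofMunn (p : MunnTree E) (h : IsCompatible C p.tree) :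
    nred C (LM.ofMunn p h).toMunn.tree = nred C p.tree :=
  (LM.ofMunn p h).nred_union.trans (nred_treeL p.isTree)

theorem toLM_surjective : Function.Surjective (toLM C) := by
  rintro (_ | p)
  exacts [⟨0, rfl⟩, ⟨_, toLM_toMunn p⟩]

/-- Both sides come from the same Munn product, taken on the left with the given trees and on the
right with the representatives `T_L ∪ g↓`. These have the same `nred`, so compatibility and the
resulting `T_L` agree. -/
theorem toLM_mul (a b : FreeIS E) : toLM C (a * b) = toLM C a * toLM C b := by
  induction a using FreeIS.cases_of with
  | zero => rfl
  | of p =>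
  induction b using FreeIS.cases_of with
  | zero => rw [FreeIS.mul_zero, toLM_zero, LM.mul_zero]
  | of q =>
  by_cases hc : p.path.rng = q.path.src
  · have hqt : IsETree p.path.rng q.tree := hc ▸ q.isTree
    rw [FreeIS.of_mul_of hc]
    by_cases hp : IsCompatible C p.tree
    · by_cases hq : IsCompatible C q.tree
      · rw [toLM_of hp, toLM_of hq]
        set p' := LM.ofMunn p hp with hp'
        set q' := LM.ofMunn q hq with hq'
        have e1 : nred C p'.toMunn.tree = nred C p.tree := nred_toMunn_ofMunn p hp
        have e2 : nred C q'.toMunn.tree = nred C q.tree := nred_toMunn_ofMunn q hq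
        have hq't : IsY C p.path.rng q'.toMunn.tree := by
          have := q'.isY_union
          rw [hc]
          exact this
        by_cases h : IsCompatible C (FreeIS.mulTree p q hc).tree
        · have h' : IsCompatible C (LM.prodTree p' q') :=
            isCompatible_munn_congr p.isTree p'.isY_union hqt hq't p.mem p'.toMunn.mem
              e1.symm e2.symm h
          rw [toLM_of h, LM.of_mul_of hc h']
          refine congrArg LM.of (LMTree.ext ?_ rfl)
          exact (treeL_eq_iff (FreeIS.mulTree p q hc).isTree
            (LM.isETree_prodTree p' q' hc)).2 (nred_munn_congr p.isTree p.mem p'.toMunn.isTree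
              p'.toMunn.mem e1.symm e2.symm)
        · rw [toLM_of_eq_zero h, LM.of_mul_of_eq_zero]
          rintro ⟨_, h'⟩
          exact h (isCompatible_munn_congr p'.isY_union.isTree ⟨p.isTree, hp⟩ hq't.isTree
            ⟨hqt, hq⟩ p'.toMunn.mem p.mem e1 e2 h')
      · rw [toLM_of_eq_zero hq, LM.mul_zero, toLM_of_eq_zero]
        -- A compatible product would contain a translate of the second tree; translating by the
        -- inverse of `p.path` would make the second tree itself compatible.
        exact fun h => hq ((isCompatible_munn_right p.isTree p.mem hqt h).mono
          Set.subset_union_right)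
    · rw [toLM_of_eq_zero hp, LM.zero_mul, toLM_of_eq_zero]
      exact fun h => hp (h.mono Set.subset_union_left)
  · rw [FreeIS.of_mul_of_ne hc, toLM_zero]
    by_cases hp : IsCompatible C p.tree
    · by_cases hq : IsCompatible C q.tree
      · rw [toLM_of hp, toLM_of hq, LM.of_mul_of_eq_zero]
        exact fun ⟨h, _⟩ => hc h
      · rw [toLM_of_eq_zero hq, LM.mul_zero]
    · rw [toLM_of_eq_zero hp, LM.zero_mul]

theorem toLM_inv (a : FreeIS E) : toLM C a⁻¹ = (toLM C a)⁻¹ := by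
  induction a using FreeIS.cases_of with
  | zero => rfl
  | of p =>
  rw [FreeIS.inv_of]
  by_cases hp : IsCompatible C p.tree
  · have h1 : IsCompatible C (FreeIS.invTree p).tree :=
      (IsY.translate_inv ⟨p.isTree, hp⟩ p.mem).compatible
    rw [toLM_of h1, toLM_of hp]
    refine congrArg LM.of (LMTree.ext ?_ rfl)
    refine (treeL_eq_iff (FreeIS.invTree p).isTree
      (FreeIS.invTree (LM.ofMunn p hp).toMunn).isTree).2 ?_
    exact nred_translate_inv_congr p.isTree (LM.ofMunn p hp).toMunn.isTree p.mem
      (LM.ofMunn p hp).toMunn.mem (nred_toMunn_ofMunn p hp).symm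
  · rw [toLM_of_eq_zero hp, toLM_of_eq_zero]
    · rfl
    · intro h
      have h1 : IsY C (FreeIS.invTree p).path.src (FreeIS.invTree p).tree :=
        ⟨(FreeIS.invTree p).isTree, h⟩
      have h2 := (h1.translate_inv (FreeIS.invTree p).mem).compatible
      apply hp
      change IsCompatible C (p.path.inv.inv.translate (p.path.inv.translate p.tree)) at h2
      rwa [RedPath.inv_inv, RedPath.translate_inv_translate _ p.isTree.src_eq] at h2

/-- The Leavitt–Munn trees are the image of an inverse semigroup under `toLM`, so every law is
inherited. None is checked on the truncated product directly. -/
instance : InvSemigroupZero (LM C) where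
  mul_assoc a b c := by
    obtain ⟨a, rfl⟩ := toLM_surjective a
    obtain ⟨b, rfl⟩ := toLM_surjective b
    obtain ⟨c, rfl⟩ := toLM_surjective c
    simp only [← toLM_mul, mul_assoc]
  zero_mul := LM.zero_mul
  mul_zero := LM.mul_zero
  inv_inv a := by
    obtain ⟨a, rfl⟩ := toLM_surjective a
    simp only [← toLM_inv, inv_inv]
  mul_inv_rev a b := by
    obtain ⟨a, rfl⟩ := toLM_surjective a
    obtain ⟨b, rfl⟩ := toLM_surjective b
    simp only [← toLM_mul, ← toLM_inv, InvSemigroupZero.mul_inv_rev]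
  mul_inv_mul a := by
    obtain ⟨a, rfl⟩ := toLM_surjective a
    simp only [← toLM_mul, ← toLM_inv, InvSemigroupZero.mul_inv_mul]
  mul_inv_comm a b := by
    obtain ⟨a, rfl⟩ := toLM_surjective a
    obtain ⟨b, rfl⟩ := toLM_surjective b
    simp only [← toLM_mul, ← toLM_inv]
    rw [InvSemigroupZero.mul_inv_comm]

/-! ### Representations of the double graph and normal forms -/

/-- A representation of the double graph of `E` in an inverse semigroup with zero: images of the
generators which satisfy the defining relations of the free inverse semigroup of `E`. -/
structure PathRep (S : Type*) [InvSemigroupZero S] (E : DirGraph.{u, w}) where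
  vert : E.Vert → S
  letter : Letter E → S
  vert_mul_self : ∀ v, vert v * vert v = vert v
  vert_mul_vert : ∀ v v', v ≠ v' → vert v * vert v' = 0
  src_mul : ∀ x, vert (lsrc x) * letter x = letter x
  mul_rng : ∀ x, letter x * vert (lrng x) = letter x
  letter_inv : ∀ x, (letter x)⁻¹ = letter (x.1, !x.2)

namespace InvSemigroupZero
variable {S : Type*} [InvSemigroupZero S]

theorem mul_inv_idem (s : S) : s * s⁻¹ * (s * s⁻¹) = s * s⁻¹ := by
  rw [← mul_assoc, mul_inv_mul]

theorem inv_mul_comm (s t : S) : s⁻¹ * s * (t * t⁻¹) = t * t⁻¹ * (s⁻¹ * s) := by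
  have := mul_inv_comm s⁻¹ t
  rwa [inv_inv] at this

theorem inv_zero : (0 : S)⁻¹ = 0 := inv_of_idem (mul_zero 0)

end InvSemigroupZero

namespace PathRep
open InvSemigroupZero
variable {S : Type*} [InvSemigroupZero S] {E : DirGraph.{u, w}} (F : PathRep S E)

/-- The value of a path, given by its source and its word. -/
def wordVal : E.Vert → List (Letter E) → S
  | v, [] => F.vert v
  | _, x :: l => F.letter x * wordVal (lrng x) l

theorem vert_mul_wordVal {v : E.Vert} {l : List (Letter E)} (h : IsPath v l) :
    F.vert v * F.wordVal v l = F.wordVal v l := by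
  cases l with
  | nil => exact F.vert_mul_self v
  | cons x l =>
    obtain ⟨rfl, -⟩ := h
    rw [wordVal, ← mul_assoc, F.src_mul]

theorem wordVal_mul_vert (v : E.Vert) (l : List (Letter E)) :
    F.wordVal v l * F.vert (endpt v l) = F.wordVal v l := by
  induction l generalizing v with
  | nil => exact F.vert_mul_self v
  | cons x l ih => rw [wordVal, mul_assoc]; exact congrArg _ (ih _)

theorem wordVal_append {v : E.Vert} {l m : List (Letter E)} (h : IsPath v (l ++ m)) :
    F.wordVal v (l ++ m) = F.wordVal v l * F.wordVal (endpt v l) m := by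
  induction l generalizing v with
  | nil => exact (F.vert_mul_wordVal h).symm
  | cons x l ih =>
    rw [List.cons_append, wordVal, wordVal, ih h.2, mul_assoc]
    rfl

theorem wordVal_singleton (v : E.Vert) (x : Letter E) : F.wordVal v [x] = F.letter x :=
  F.mul_rng x

theorem vert_inv (v : E.Vert) : (F.vert v)⁻¹ = F.vert v := inv_of_idem (F.vert_mul_self v)

theorem wordVal_inv {v : E.Vert} {l : List (Letter E)} (h : IsPath v l) :
    (F.wordVal v l)⁻¹ = F.wordVal (endpt v l) (FreeGroup.invRev l) := by
  induction l generalizing v with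
  | nil => exact F.vert_inv v
  | cons x l ih =>
    have h1 : IsPath (endpt v (x :: l)) (FreeGroup.invRev l ++ [(x.1, !x.2)]) := by
      have := (invRev_path v _ h).1
      rwa [FreeGroup.invRev_cons] at this
    rw [FreeGroup.invRev_cons]
    change _ = F.wordVal (endpt v (x :: l)) (FreeGroup.invRev l ++ [(x.1, !x.2)])
    rw [F.wordVal_append h1, wordVal_singleton, wordVal, InvSemigroupZero.mul_inv_rev, ih h.2, F.letter_inv]
    rfl

/-- The value of a reduced path. -/
def val (g : RedPath E) : S := F.wordVal g.src g.word

theorem val_unit (v : E.Vert) : F.val (RedPath.unit v) = F.vert v := rfl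

theorem val_letter (x : Letter E) : F.val (RedPath.letter x) = F.letter x :=
  F.wordVal_singleton _ x

theorem vert_mul_val (g : RedPath E) : F.vert g.src * F.val g = F.val g :=
  F.vert_mul_wordVal g.isPath

theorem val_mul_vert (g : RedPath E) : F.val g * F.vert g.rng = F.val g :=
  F.wordVal_mul_vert _ _

theorem val_inv (g : RedPath E) : F.val g.inv = (F.val g)⁻¹ := (F.wordVal_inv g.isPath).symm

/-- The range idempotent of a reduced path. -/
def rangeIdem (g : RedPath E) : S := F.val g * (F.val g)⁻¹

theorem rangeIdem_mul_self (g : RedPath E) : F.rangeIdem g * F.rangeIdem g = F.rangeIdem g :=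
  mul_inv_idem _

theorem rangeIdem_comm (g h : RedPath E) :
    F.rangeIdem g * F.rangeIdem h = F.rangeIdem h * F.rangeIdem g :=
  mul_inv_comm _ _

theorem rangeIdem_mul_val (g : RedPath E) : F.rangeIdem g * F.val g = F.val g := mul_inv_mul _

theorem val_eq_of_word {g : RedPath E} {l m : List (Letter E)} (h : g.word = l ++ m) :
    F.val g = F.wordVal g.src l * F.wordVal (endpt g.src l) m := by
  have := g.isPath
  rw [h] at this
  rw [val, h, F.wordVal_append this]

/-- With `g = G D` and `h = D⁻¹ B`, where `D` is the part that cancels, `G⁻¹G` commutes with `D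
D⁻¹`. Hence `G D D⁻¹ B = (G D)(G D)⁻¹ G B`, so cancellation costs only the range idempotent of `g`.
-/
theorem val_mul_val (g h : RedPath E) (hc : g.rng = h.src) :
    F.val g * F.val h = F.rangeIdem g * F.val (g.comp h hc) := by
  obtain ⟨d, a, b, h1, h2, h3⟩ := RedPath.comp_decomp g h hc
  have hp := g.isPath
  rw [h1, isPath_append] at hp
  have hr : endpt (endpt g.src (FreeGroup.invRev a)) (FreeGroup.invRev d) = h.src := by
    rw [← endpt_append, ← h1]
    exact hc
  have hd := F.wordVal_inv hp.2
  have hd2 := (invRev_path _ _ hp.2).2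
  rw [FreeGroup.invRev_invRev, hr] at hd hd2
  rw [rangeIdem, F.val_eq_of_word h1, F.val_eq_of_word h2, F.val_eq_of_word h3, hd2, ← hd]
  set G := F.wordVal g.src (FreeGroup.invRev a)
  set D := F.wordVal (endpt g.src (FreeGroup.invRev a)) (FreeGroup.invRev d)
  change G * D * (D⁻¹ * F.wordVal (endpt g.src (FreeGroup.invRev a)) b) =
    G * D * (G * D)⁻¹ * (G * F.wordVal (endpt g.src (FreeGroup.invRev a)) b)
  set B := F.wordVal (endpt g.src (FreeGroup.invRev a)) b
  calc G * D * (D⁻¹ * B) = G * G⁻¹ * G * (D * D⁻¹) * B := by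
        rw [mul_inv_mul]; simp only [mul_assoc]
    _ = G * (G⁻¹ * G * (D * D⁻¹)) * B := by simp only [mul_assoc]
    _ = G * (D * D⁻¹ * (G⁻¹ * G)) * B := by rw [inv_mul_comm]
    _ = G * D * (G * D)⁻¹ * (G * B) := by rw [InvSemigroupZero.mul_inv_rev]; simp only [mul_assoc]

theorem val_mul_val_of_ne {g h : RedPath E} (hc : g.rng ≠ h.src) : F.val g * F.val h = 0 := by
  rw [← F.val_mul_vert g, ← F.vert_mul_val h, mul_assoc, ← mul_assoc (F.vert _),
    F.vert_mul_vert _ _ hc, zero_mul, mul_zero]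

/-- Range idempotents move to the left across a path by translation. This is the algebraic source of
the term `g₁ · T₂` in the Munn product. -/
theorem val_mul_rangeIdem (g t : RedPath E) (hc : g.rng = t.src) :
    F.val g * F.rangeIdem t = F.rangeIdem (g.comp t hc) * F.val g := by
  have h := F.val_mul_val g t hc
  simp only [rangeIdem] at h ⊢
  set s := F.val g
  set r := F.val t
  set k := F.val (g.comp t hc)
  calc s * (r * r⁻¹) = s * s⁻¹ * s * (r * r⁻¹) := by rw [mul_inv_mul]
    _ = s * (s⁻¹ * s * (r * r⁻¹)) := by simp only [mul_assoc]
    _ = s * (r * r⁻¹ * (s⁻¹ * s)) := by rw [inv_mul_comm]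
    _ = s * r * (s * r)⁻¹ * s := by rw [InvSemigroupZero.mul_inv_rev]; simp only [mul_assoc]
    _ = s * s⁻¹ * (k * k⁻¹) * (s * s⁻¹ * s) := by
        rw [h, InvSemigroupZero.mul_inv_rev, InvSemigroupZero.mul_inv_rev, inv_inv]; simp only [mul_assoc]
    _ = k * k⁻¹ * s := by
        rw [mul_inv_mul, mul_inv_comm, mul_assoc, mul_inv_mul]

theorem val_eq_of_prefix {k g : RedPath E} (h : k.IsPrefix g) : ∃ y, F.val g = F.val k * y := by
  obtain ⟨h1, m, hm⟩ := h
  exact ⟨_, (F.val_eq_of_word hm.symm).trans (by rw [← h1]; rfl)⟩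

theorem rangeIdem_mul_of_prefix {k g : RedPath E} (h : k.IsPrefix g) :
    F.rangeIdem k * F.val g = F.val g := by
  obtain ⟨y, hy⟩ := F.val_eq_of_prefix h
  rw [hy, ← mul_assoc, rangeIdem_mul_val]

/-- The product of the range idempotents of the paths of `L`, applied to `y`. -/
def act (L : List (RedPath E)) (y : S) : S := L.foldr (fun t z => F.rangeIdem t * z) y

theorem act_cons (t : RedPath E) (L : List (RedPath E)) (y : S) :
    F.act (t :: L) y = F.rangeIdem t * F.act L y := rfl

theorem act_append (L M : List (RedPath E)) (y : S) :
    F.act (L ++ M) y = F.act L (F.act M y) := List.foldr_append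

theorem rangeIdem_mul_act (t : RedPath E) (L : List (RedPath E)) (y : S) :
    F.rangeIdem t * F.act L y = F.act L (F.rangeIdem t * y) := by
  induction L with
  | nil => rfl
  | cons s L ih => rw [act_cons, act_cons, ← ih, ← mul_assoc, rangeIdem_comm, mul_assoc]

theorem act_act_comm (L M : List (RedPath E)) (y : S) :
    F.act L (F.act M y) = F.act M (F.act L y) := by
  induction L with
  | nil => rfl
  | cons s L ih => rw [act_cons, act_cons, ih, rangeIdem_mul_act]

theorem rangeIdem_mul_act_of_mem {t : RedPath E} {L : List (RedPath E)} (ht : t ∈ L) (y : S) :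
    F.rangeIdem t * F.act L y = F.act L y := by
  induction L with
  | nil => simp at ht
  | cons s L ih =>
    rw [act_cons]
    rcases List.mem_cons.1 ht with rfl | ht
    · rw [← mul_assoc, rangeIdem_mul_self]
    · rw [← mul_assoc, rangeIdem_comm, mul_assoc, ih ht]

theorem act_eq_self {L : List (RedPath E)} {y : S} (h : ∀ t ∈ L, F.rangeIdem t * y = y) :
    F.act L y = y := by
  induction L with
  | nil => rfl
  | cons s L ih =>
    rw [act_cons, ih fun t ht => h t (List.mem_cons_of_mem _ ht), h s List.mem_cons_self]

/-- If each side absorbs the idempotents of the other, both are equal to `F.act L (F.act M y)`,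
because range idempotents commute. -/
theorem act_eq_act {L M : List (RedPath E)} {y : S}
    (h1 : ∀ t ∈ L, F.rangeIdem t * F.act M y = F.act M y)
    (h2 : ∀ t ∈ M, F.rangeIdem t * F.act L y = F.act L y) : F.act L y = F.act M y := by
  rw [← F.act_eq_self h2, act_act_comm, F.act_eq_self h1]

theorem act_mul (L : List (RedPath E)) (y z : S) : F.act L y * z = F.act L (y * z) := by
  induction L with
  | nil => rfl
  | cons s L ih => rw [act_cons, act_cons, mul_assoc, ih]

theorem act_zero (L : List (RedPath E)) : F.act L 0 = 0 := by
  induction L with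
  | nil => rfl
  | cons s L ih => rw [act_cons, ih, mul_zero]

theorem val_mul_act (g : RedPath E) (M : List (RedPath E)) (hM : ∀ t ∈ M, t.src = g.rng) (y : S) :
    ∃ M' : List (RedPath E), (∀ t ∈ M', t.src = g.src) ∧
      F.val g * F.act M y = F.act M' (F.val g * y) := by
  induction M with
  | nil => exact ⟨[], by simp, rfl⟩
  | cons s M ih =>
    obtain ⟨M', h1, h2⟩ := ih fun t ht => hM t (List.mem_cons_of_mem _ ht)
    have hc : g.rng = s.src := (hM s List.mem_cons_self).symm
    refine ⟨g.comp s hc :: M', ?_, ?_⟩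
    · intro t ht
      rcases List.mem_cons.1 ht with rfl | ht
      exacts [rfl, h1 t ht]
    · rw [act_cons, act_cons, ← mul_assoc, F.val_mul_rangeIdem g s hc, mul_assoc, h2]

/-- The elements of the form `ε(t₁) ⋯ ε(tₙ) g`, for reduced paths with a common source. -/
def IsNormal (x : S) : Prop :=
  ∃ (L : List (RedPath E)) (g : RedPath E), (∀ t ∈ L, t.src = g.src) ∧ x = F.act L (F.val g)

variable {F}

/-- The idempotents of the second factor move left across `g`, and `g h` becomes `ε(g)` times the
value of the reduced path. For paths that do not compose, two distinct vertices meet and give zero.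
-/
theorem IsNormal.mul {x y : S} (hx : F.IsNormal x) (hy : F.IsNormal y) :
    x * y = 0 ∨ F.IsNormal (x * y) := by
  obtain ⟨L, g, hL, rfl⟩ := hx
  obtain ⟨M, h, hM, rfl⟩ := hy
  by_cases hc : g.rng = h.src
  · right
    obtain ⟨M', h1, h2⟩ := F.val_mul_act g M (fun t ht => (hM t ht).trans hc.symm) (F.val h)
    refine ⟨L ++ (M' ++ [g]), g.comp h hc, ?_, ?_⟩
    · intro t ht
      rcases List.mem_append.1 ht with ht | ht
      · exact hL t ht
      rcases List.mem_append.1 ht with ht | ht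
      · exact h1 t ht
      · rw [List.mem_singleton.1 ht]; rfl
    · rw [act_mul, h2, act_append, act_append, F.val_mul_val g h hc]
      rfl
  · left
    have h0 : F.val g * F.act M (F.val h) = 0 := by
      rw [← F.val_mul_vert g, mul_assoc]
      have : F.vert g.rng * F.act M (F.val h) = 0 := by
        rw [← F.val_unit]
        -- A vertex is its own range idempotent, so it commutes past the others until it meets `h`.
        have h3 : F.val (RedPath.unit g.rng) = F.rangeIdem (RedPath.unit g.rng) := by
          rw [rangeIdem, val_unit, vert_inv, vert_mul_self]
        rw [h3, rangeIdem_mul_act, ← h3, F.val_mul_val_of_ne (g := RedPath.unit g.rng) hc, act_zero]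
      rw [this, mul_zero]
    rw [act_mul, h0, act_zero]

/-- By induction on the list: `(ε(s) y)⁻¹ = y⁻¹ ε(s)`, and `ε(s)` is itself normal. -/
theorem IsNormal.of_inv_or {x : S} (hx : F.IsNormal x) : x⁻¹ = 0 ∨ F.IsNormal x⁻¹ := by
  obtain ⟨L, g, hL, rfl⟩ := hx
  induction L with
  | nil =>
    right
    exact ⟨[], g.inv, by simp, (F.val_inv g).symm⟩
  | cons s L ih =>
    have h1 : F.IsNormal (F.rangeIdem s) :=
      ⟨[s], RedPath.unit s.src, by simp, by
        rw [act_cons, val_unit, ← F.vert_inv s.src]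
        change _ = F.rangeIdem s * (F.vert s.src)⁻¹
        rw [rangeIdem, mul_assoc, ← InvSemigroupZero.mul_inv_rev, vert_mul_val]⟩
    rw [act_cons, InvSemigroupZero.mul_inv_rev, inv_of_idem (F.rangeIdem_mul_self s)]
    rcases ih fun t ht => hL t (List.mem_cons_of_mem _ ht) with h | h
    · left
      rw [h, zero_mul]
    · exact h.mul h1

variable (F)

theorem isNormal_vert (v : E.Vert) : F.IsNormal (F.vert v) :=
  ⟨[], RedPath.unit v, by simp, rfl⟩

theorem isNormal_letter (x : Letter E) : F.IsNormal (F.letter x) :=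
  ⟨[], RedPath.letter x, by simp, (F.val_letter x).symm⟩

section Map
variable {S' : Type*} [InvSemigroupZero S'] {F' : PathRep S' E} {f : S → S'}

theorem map_val (hm : ∀ a b, f (a * b) = f a * f b) (hv : ∀ v, f (F.vert v) = F'.vert v)
    (hl : ∀ x, f (F.letter x) = F'.letter x) (g : RedPath E) : f (F.val g) = F'.val g := by
  have h : ∀ l v, f (F.wordVal v l) = F'.wordVal v l := by
    intro l
    induction l with
    | nil => exact hv
    | cons x l ih => intro v; rw [wordVal, wordVal, hm, hl, ih]
  exact h _ _

theorem map_act (hm : ∀ a b, f (a * b) = f a * f b) (hi : ∀ a, f a⁻¹ = (f a)⁻¹)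
    (hv : ∀ v, f (F.vert v) = F'.vert v) (hl : ∀ x, f (F.letter x) = F'.letter x)
    (L : List (RedPath E)) (y : S) : f (F.act L y) = F'.act L (f y) := by
  induction L with
  | nil => rfl
  | cons s L ih =>
    rw [act_cons, act_cons, hm, ih, rangeIdem, rangeIdem, hm, hi, F.map_val hm hv hl]

theorem map_act_val (hm : ∀ a b, f (a * b) = f a * f b) (hi : ∀ a, f a⁻¹ = (f a)⁻¹)
    (hv : ∀ v, f (F.vert v) = F'.vert v) (hl : ∀ x, f (F.letter x) = F'.letter x)
    (L : List (RedPath E)) (g : RedPath E) :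
    f (F.act L (F.val g)) = F'.act L (F'.val g) := by
  rw [F.map_act hm hi hv hl, F.map_val hm hv hl]

/-- The image of a representation under a homomorphism. -/
def map (f : S → S') (hm : ∀ a b, f (a * b) = f a * f b) (hi : ∀ a, f a⁻¹ = (f a)⁻¹)
    (h0 : f 0 = 0) : PathRep S' E where
  vert v := f (F.vert v)
  letter x := f (F.letter x)
  vert_mul_self v := by rw [← hm, F.vert_mul_self]
  vert_mul_vert v v' h := by rw [← hm, F.vert_mul_vert v v' h, h0]
  src_mul x := by rw [← hm, F.src_mul]
  mul_rng x := by rw [← hm, F.mul_rng]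
  letter_inv x := by rw [← hi, F.letter_inv]

end Map

end PathRep

/-! ### Values of trees and their dependence on the non-redundant paths -/

/-- The set of the prefixes of the paths in `g :: L`. -/
def hull {E : DirGraph.{u, w}} (L : List (RedPath E)) (g : RedPath E) : Set (RedPath E) :=
  {k | ∃ t ∈ g :: L, k.IsPrefix t}

section Hull
variable {E : DirGraph.{u, w}}

theorem hull_nil (g : RedPath E) : hull [] g = g.lower := by
  ext k
  simp [hull, RedPath.lower]

theorem hull_cons (s : RedPath E) (L : List (RedPath E)) (g : RedPath E) :
    hull (s :: L) g = s.lower ∪ hull L g := by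
  ext k
  simp only [hull, RedPath.lower, List.mem_cons, exists_eq_or_imp, Set.mem_ofPred_eq,
    Set.mem_union]
  tauto

theorem self_mem_hull (L : List (RedPath E)) (g : RedPath E) : g ∈ hull L g :=
  ⟨g, List.mem_cons_self, RedPath.IsPrefix.refl g⟩

theorem mem_hull {L : List (RedPath E)} {t : RedPath E} (ht : t ∈ L) (g : RedPath E) :
    t ∈ hull L g :=
  ⟨t, List.mem_cons_of_mem _ ht, RedPath.IsPrefix.refl t⟩

theorem isETree_hull {L : List (RedPath E)} {g : RedPath E} (hL : ∀ t ∈ L, t.src = g.src) :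
    IsETree g.src (hull L g) := by
  induction L with
  | nil => rw [hull_nil]; exact isETree_lower g
  | cons s L ih =>
    rw [hull_cons]
    refine IsETree.union ?_ (ih fun t ht => hL t (List.mem_cons_of_mem _ ht))
    rw [← hL s List.mem_cons_self]
    exact isETree_lower s

theorem exists_hull_eq {T : Set (RedPath E)} {g : RedPath E} (hT : IsETree g.src T) (hg : g ∈ T) :
    ∃ L : List (RedPath E), (∀ t ∈ L, t.src = g.src) ∧ hull L g = T := by
  refine ⟨hT.finite.toFinset.toList, fun t ht => hT.src_eq t (by simpa using ht), ?_⟩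
  ext k
  constructor
  · rintro ⟨t, ht, hk⟩
    refine hT.lower t ?_ k hk
    rcases List.mem_cons.1 ht with rfl | ht
    exacts [hg, by simpa using ht]
  · intro hk
    exact mem_hull (by simpa using hk) g

end Hull

namespace PathRep
open InvSemigroupZero
variable {S : Type*} [InvSemigroupZero S] {E : DirGraph.{u, w}} (F : PathRep S E)

/-- If `k` is a prefix of `t`, then `ε(k)` fixes the value of `t` and hence `ε(t)`, so it is
absorbed wherever `t` occurs. -/
theorem rangeIdem_mul_act_of_mem_hull {L : List (RedPath E)} {g k : RedPath E}
    (hk : k ∈ hull L g) : F.rangeIdem k * F.act L (F.val g) = F.act L (F.val g) := by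
  obtain ⟨t, ht, hkt⟩ := hk
  rcases List.mem_cons.1 ht with rfl | ht
  · rw [rangeIdem_mul_act, F.rangeIdem_mul_of_prefix hkt]
  · rw [← F.rangeIdem_mul_act_of_mem ht, ← mul_assoc]
    conv_lhs => rw [rangeIdem.eq_def F t, ← mul_assoc, F.rangeIdem_mul_of_prefix hkt]
    rfl

variable {C : Separation E}

/-- In `ε(kx) = k x x⁻¹ k⁻¹` the middle factor collapses to the vertex at the end of `k`. -/
theorem rangeIdem_eq_of_redundant
    (hF : ∀ x, IsRedundant C x → F.letter x * F.letter (x.1, !x.2) = F.vert (lsrc x))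
    {t k : RedPath E} {x : Letter E} (hs : k.src = t.src) (hw : t.word = k.word ++ [x])
    (hx : IsRedundant C x) : F.rangeIdem t = F.rangeIdem k := by
  have hp := t.isPath
  rw [hw, isPath_append] at hp
  have hr : lsrc x = k.rng := by
    rw [RedPath.rng, hs]
    exact hp.2.1
  have h1 : F.val t = F.val k * F.letter x := by
    rw [F.val_eq_of_word hw, wordVal_singleton, ← hs]
    rfl
  rw [rangeIdem, rangeIdem, h1, InvSemigroupZero.mul_inv_rev, F.letter_inv]
  calc F.val k * F.letter x * (F.letter (x.1, !x.2) * (F.val k)⁻¹)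
      = F.val k * (F.letter x * F.letter (x.1, !x.2)) * (F.val k)⁻¹ := by simp only [mul_assoc]
    _ = F.val k * (F.val k)⁻¹ := by rw [hF x hx, hr, val_mul_vert]

/-- Redundant last letters can be stripped one at a time without changing the range idempotent,
until the path is a vertex or lies in `nred C T`. -/
theorem rangeIdem_mul_of_nred
    (hF : ∀ x, IsRedundant C x → F.letter x * F.letter (x.1, !x.2) = F.vert (lsrc x))
    {v : E.Vert} {T : Set (RedPath E)} (hT : IsETree v T) {y : S}
    (hu : F.rangeIdem (RedPath.unit v) * y = y)
    (hn : ∀ k ∈ nred C T, F.rangeIdem k * y = y) (n : ℕ) :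
    ∀ t ∈ T, t.word.length = n → F.rangeIdem t * y = y := by
  induction n with
  | zero =>
    intro t ht h0
    rw [RedPath.eq_unit_of_word_eq_nil (List.length_eq_zero_iff.1 h0), hT.src_eq t ht, hu]
  | succ n ih =>
    intro t ht hl
    rcases List.eq_nil_or_concat t.word with h0 | ⟨l, x, hw⟩
    · simp [h0] at hl
    rw [List.concat_eq_append] at hw
    by_cases hx : IsRedundant C x
    · have hp : l <+: t.word := ⟨[x], hw.symm⟩
      rw [F.rangeIdem_eq_of_redundant hF (t := t) (k := t.pre l hp) rfl hw hx]
      refine ih _ (hT.lower t ht _ (t.pre_isPrefix l hp)) ?_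
      have := congrArg List.length hw
      rw [List.length_append, hl] at this
      exact (Nat.succ.inj this).symm
    · exact hn t ⟨ht, x, by rw [hw]; simp, hx⟩

/-- The value of a Munn tree depends only on its non-redundant part, if `x x⁻¹ = s(x)` for
the redundant letters. -/
theorem act_congr
    (hF : ∀ x, IsRedundant C x → F.letter x * F.letter (x.1, !x.2) = F.vert (lsrc x))
    {L M : List (RedPath E)} {g : RedPath E} (hL : ∀ t ∈ L, t.src = g.src)
    (hM : ∀ t ∈ M, t.src = g.src) (h : nred C (hull L g) = nred C (hull M g)) :
    F.act L (F.val g) = F.act M (F.val g) := by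
  have key : ∀ L M : List (RedPath E), (∀ t ∈ L, t.src = g.src) → (∀ t ∈ M, t.src = g.src) →
      nred C (hull L g) = nred C (hull M g) →
      ∀ t ∈ L, F.rangeIdem t * F.act M (F.val g) = F.act M (F.val g) := by
    intro L M hL hM h t ht
    refine F.rangeIdem_mul_of_nred hF (isETree_hull hL) ?_ ?_ _ t (mem_hull ht g) rfl
    · exact F.rangeIdem_mul_act_of_mem_hull (isETree_hull hM).unit_mem
    · intro k hk
      rw [h] at hk
      exact F.rangeIdem_mul_act_of_mem_hull hk.1
  exact F.act_eq_act (key L M hL hM h) (key M L hM hL h.symm)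

end PathRep

/-! ### Munn trees are normal forms in the free inverse semigroup -/

namespace FreeIS
variable {E : DirGraph.{u, w}}

variable (E) in
/-- The tautological representation in the free inverse semigroup. -/
def rep : PathRep (FreeIS E) E where
  vert := vert
  letter := letter
  vert_mul_self _ := (idem_mul_idem _ _).trans (idem_congr _ _ (Set.union_self _))
  vert_mul_vert _ _ h := idem_mul_idem_ne _ _ h
  src_mul x := vert_mul_of (⟨(RedPath.letter x).lower, RedPath.letter x, _, _⟩ : MunnTree E)
  mul_rng x := of_mul_vert (⟨(RedPath.letter x).lower, RedPath.letter x, _, _⟩ : MunnTree E)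
  letter_inv := letter_inv

theorem lower_cons {v : E.Vert} {x : Letter E} {l : List (Letter E)} (hp : IsPath v (x :: l))
    (hr : FreeGroup.IsReduced (x :: l)) (hr' : FreeGroup.IsReduced l) :
    (⟨v, x :: l, hp, hr⟩ : RedPath E).lower =
      (RedPath.letter x).lower ∪ (RedPath.letter x).translate (⟨_, l, hp.2, hr'⟩ : RedPath E).lower
      := by
  obtain ⟨rfl, hp2⟩ := hp
  rw [RedPath.lower_letter]
  ext k
  simp only [Set.mem_union, Set.mem_insert_iff, Set.mem_singleton_iff, RedPath.mem_translate]
  constructor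
  · rintro ⟨h1, h2⟩
    rcases List.prefix_cons_iff.1 h2 with h3 | ⟨m, h3, h4⟩
    · exact Or.inl (Or.inl (RedPath.ext h1 h3))
    · refine Or.inr ⟨h1, RedPath.pre ⟨_, l, hp2, hr'⟩ m h4, RedPath.pre_isPrefix _ _ _, rfl, ?_⟩
      change FreeGroup.mk k.word = FreeGroup.mk [x] * FreeGroup.mk m
      rw [h3, FreeGroup.mul_mk]
      rfl
  · rintro ((rfl | rfl) | ⟨h1, m, ⟨hm1, hm2⟩, h3, h4⟩)
    · exact ⟨rfl, List.nil_prefix⟩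
    · exact ⟨rfl, List.prefix_append [x] l⟩
    · have hm : x :: m.word <+: x :: l := (List.prefix_cons_inj x).2 hm2
      have : k = RedPath.pre ⟨_, x :: l, ⟨rfl, hp2⟩, hr⟩ (x :: m.word) hm := by
        refine RedPath.ext_toFree h1 ?_
        rw [h4]
        change FreeGroup.mk [x] * FreeGroup.mk m.word = FreeGroup.mk (x :: m.word)
        rw [FreeGroup.mul_mk]
        rfl
      rw [this]
      exact RedPath.pre_isPrefix _ _ _

theorem val_rep (g : RedPath E) :
    (rep E).val g = of ⟨g.lower, g, isETree_lower g, RedPath.mem_lower_self g⟩ := by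
  have h : ∀ l v, ∀ (hp : IsPath v l) (hr : FreeGroup.IsReduced l), (rep E).wordVal v l =
      of ⟨(⟨v, l, hp, hr⟩ : RedPath E).lower, ⟨v, l, hp, hr⟩, isETree_lower _,
        RedPath.mem_lower_self _⟩ := by
    intro l
    induction l with
    | nil =>
      intro v hp hr
      change of ⟨{RedPath.unit v}, RedPath.unit v, _, _⟩ = _
      refine congrArg of (MunnTree.ext ?_ rfl)
      ext k
      constructor
      · rintro rfl
        exact RedPath.mem_lower_self _
      · rintro ⟨h1, h2⟩
        exact RedPath.ext h1 (List.prefix_nil.1 h2)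
    | cons x l ih =>
      intro v hp hr
      have hr' : FreeGroup.IsReduced l := hr.infix (List.suffix_cons x l).isInfix
      rw [PathRep.wordVal, ih _ hp.2 hr']
      refine mulTree_eq_of (p := ⟨(RedPath.letter x).lower, RedPath.letter x, isETree_lower _,
        RedPath.mem_lower_self _⟩) rfl (r := ⟨_, ⟨v, x :: l, hp, hr⟩, _, _⟩) (lower_cons hp hr hr') hp.1.symm ?_
      change FreeGroup.mk (x :: l) = FreeGroup.mk [x] * FreeGroup.mk l
      rw [FreeGroup.mul_mk]
      rfl
  exact h _ _ _ _

/-- Multiplication by `ε(s)` adjoins the prefixes of `s` to the tree. With `exists_hull_eq`, every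
Munn tree is thus a normal form, and its image under a homomorphism can be computed in the target.
-/
theorem act_rep {L : List (RedPath E)} {g : RedPath E} (hL : ∀ t ∈ L, t.src = g.src) :
    (rep E).act L ((rep E).val g) = of ⟨hull L g, g, isETree_hull hL, self_mem_hull L g⟩ := by
  induction L with
  | nil =>
    rw [val_rep]
    exact congrArg of (MunnTree.ext (hull_nil g).symm rfl)
  | cons s L ih =>
    have hL' : ∀ t ∈ L, t.src = g.src := fun t ht => hL t (List.mem_cons_of_mem _ ht)
    have h1 : (rep E).rangeIdem s = idem (isETree_lower s) := by
      rw [PathRep.rangeIdem, val_rep]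
      exact of_mul_inv _
    rw [PathRep.act_cons, ih hL', h1]
    exact idem_mul_of _ _ (hL s List.mem_cons_self).symm (hull_cons s L g) rfl

end FreeIS

/-! ### Description of the congruence `∼_L` -/

section SimL
variable {E : DirGraph.{u, w}} (C : Separation E)

/-- The congruence which relates the Munn trees with the same path and the same non-redundant
part. -/
def nredCon : Con (FreeIS E) where
  r a b := (a = 0 ∧ b = 0) ∨ ∃ p q : MunnTree E, a = FreeIS.of p ∧ b = FreeIS.of q ∧
    p.path = q.path ∧ nred C p.tree = nred C q.tree
  iseqv := by
    refine ⟨fun a => ?_, ?_, ?_⟩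
    · induction a using FreeIS.cases_of with
      | zero => exact Or.inl ⟨rfl, rfl⟩
      | of p => exact Or.inr ⟨p, p, rfl, rfl, rfl, rfl⟩
    · rintro a b (⟨h1, h2⟩ | ⟨p, q, h1, h2, h3, h4⟩)
      exacts [Or.inl ⟨h2, h1⟩, Or.inr ⟨q, p, h2, h1, h3.symm, h4.symm⟩]
    · rintro a b c (⟨rfl, rfl⟩ | ⟨p, q, rfl, rfl, h3, h4⟩) (⟨h5, h6⟩ | ⟨p', q', h5, h6, h7, h8⟩)
      · exact Or.inl ⟨rfl, h6⟩
      · exact absurd h5.symm (FreeIS.of_ne_zero _)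
      · exact absurd h5 (FreeIS.of_ne_zero _)
      · obtain rfl := FreeIS.of_injective h5
        exact Or.inr ⟨p, q', rfl, h6, h3.trans h7, h4.trans h8⟩
  mul' := by
    rintro a b c d (⟨rfl, rfl⟩ | ⟨p, q, rfl, rfl, h3, h4⟩) h
    · exact Or.inl ⟨zero_mul c, zero_mul d⟩
    rcases h with ⟨rfl, rfl⟩ | ⟨p', q', rfl, rfl, h7, h8⟩
    · exact Or.inl ⟨mul_zero _, mul_zero _⟩
    by_cases hc : p.path.rng = p'.path.src
    · have hc' : q.path.rng = q'.path.src := by rw [← h3, ← h7]; exact hc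
      rw [FreeIS.of_mul_of hc, FreeIS.of_mul_of hc']
      refine Or.inr ⟨_, _, rfl, rfl, ?_, ?_⟩
      · refine RedPath.ext_toFree ?_ ?_
        · change p.path.src = q.path.src
          rw [h3]
        · simp only [FreeIS.mulTree, RedPath.toFree_comp, h3, h7]
      · have := nred_munn_congr (T := p'.tree) (T' := q'.tree) p.isTree p.mem
          (h3.symm ▸ q.isTree) (h3.symm ▸ q.mem) h4 h8
        rw [FreeIS.mulTree, FreeIS.mulTree, this, h3]
    · have hc' : q.path.rng ≠ q'.path.src := by rw [← h3, ← h7]; exact hc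
      rw [FreeIS.of_mul_of_ne hc, FreeIS.of_mul_of_ne hc']
      exact Or.inl ⟨rfl, rfl⟩

variable {C}

theorem letter_mul_flip_simL {x : Letter E} (hx : IsRedundant C x) :
    simL C (FreeIS.letter x * FreeIS.letter (x.1, !x.2)) (FreeIS.vert (lsrc x)) := by
  obtain ⟨e, _ | _⟩ := x
  · exact ConGen.Rel.of _ _ (LRel.inv_mul e)
  · rcases hx with h | h
    · simp at h
    · exact ConGen.Rel.of _ _ (LRel.mul_inv e h)

theorem LRel.exists_letter {a b : FreeIS E} (h : LRel C a b) : ∃ x, IsRedundant C x ∧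
    a = FreeIS.letter x * FreeIS.letter (x.1, !x.2) ∧ b = FreeIS.vert (lsrc x) := by
  cases h with
  | inv_mul e => exact ⟨(e, false), Or.inl rfl, rfl, rfl⟩
  | mul_inv e he => exact ⟨(e, true), Or.inr he, rfl, rfl⟩

theorem simL_le_nredCon : simL C ≤ nredCon C := by
  refine Con.conGen_le.2 ?_
  intro a b h
  obtain ⟨x, hx, rfl, rfl⟩ := h.exists_letter
  rw [FreeIS.letter_mul_flip]
  refine Or.inr ⟨_, _, rfl, rfl, rfl, ?_⟩
  exact (nred_lower_letter hx).trans (nred_unit _).symm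

/-- `simL` is generated for the product only, so inverses need an argument. The pairs whose inverses
are related form a congruence, which contains the generators because `x x⁻¹` and the vertices are
self-inverse. The quotient is then an inverse semigroup, as `PathRep.act_congr` requires. -/
theorem simL_inv {a b : FreeIS E} (h : simL C a b) : simL C a⁻¹ b⁻¹ := by
  let c : Con (FreeIS E) :=
    { r := fun a b => simL C a⁻¹ b⁻¹
      iseqv := ⟨fun a => (simL C).refl _, fun h => (simL C).symm h,
        fun h h' => (simL C).trans h h'⟩
      mul' := by
        intro a b c d h h'
        rw [InvSemigroupZero.mul_inv_rev, InvSemigroupZero.mul_inv_rev]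
        exact (simL C).mul h' h }
  have hle : simL C ≤ c := by
    refine Con.conGen_le.2 ?_
    intro a b h
    obtain ⟨x, hx, rfl, rfl⟩ := h.exists_letter
    change simL C _ _
    rw [← FreeIS.letter_inv, InvSemigroupZero.mul_inv_rev, inv_inv, FreeIS.letter_inv]
    rw [show (FreeIS.vert (lsrc x))⁻¹ = FreeIS.vert (lsrc x) from (FreeIS.rep E).vert_inv (lsrc x)]
    exact letter_mul_flip_simL hx
  exact hle h

instance : InvSemigroupZero (simL C).Quotient where
  mul_assoc a b c := by
    induction a using Con.induction_on
    induction b using Con.induction_on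
    induction c using Con.induction_on
    simp only [← Con.coe_mul, mul_assoc]
  zero := ((0 : FreeIS E) : (simL C).Quotient)
  zero_mul a := by
    induction a using Con.induction_on with | _ a
    exact congrArg _ (zero_mul a)
  mul_zero a := by
    induction a using Con.induction_on with | _ a
    exact congrArg _ (mul_zero a)
  inv := Quotient.map (·⁻¹) fun _ _ h => simL_inv h
  inv_inv a := by
    induction a using Con.induction_on with | _ a
    exact congrArg (fun b : FreeIS E => (b : (simL C).Quotient)) (inv_inv a)
  mul_inv_rev a b := by
    induction a using Con.induction_on with | _ a
    induction b using Con.induction_on with | _ b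
    exact congrArg (fun b : FreeIS E => (b : (simL C).Quotient))
      (InvSemigroupZero.mul_inv_rev a b)
  mul_inv_mul a := by
    induction a using Con.induction_on with | _ a
    exact congrArg (fun b : FreeIS E => (b : (simL C).Quotient)) (InvSemigroupZero.mul_inv_mul a)
  mul_inv_comm a b := by
    induction a using Con.induction_on with | _ a
    induction b using Con.induction_on with | _ b
    exact congrArg (fun b : FreeIS E => (b : (simL C).Quotient))
      (InvSemigroupZero.mul_inv_comm a b)

/-- One direction holds because `nredCon` is a congruence that contains the generators. For the
other, redundant letters satisfy `x x⁻¹ = s(x)` in the quotient, so `PathRep.act_congr` identifies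
the two normal forms there. -/
theorem simL_of_iff {p q : MunnTree E} :
    simL C (FreeIS.of p) (FreeIS.of q) ↔ p.path = q.path ∧ nred C p.tree = nred C q.tree := by
  constructor
  · intro h
    rcases simL_le_nredCon h with ⟨h1, -⟩ | ⟨p', q', h1, h2, h3⟩
    · exact absurd h1 (FreeIS.of_ne_zero p)
    · rwa [FreeIS.of_injective h1, FreeIS.of_injective h2]
  · obtain ⟨T, g, hT, hg⟩ := p
    obtain ⟨T', g', hT', hg'⟩ := q
    rintro ⟨h1, h2⟩
    dsimp only at h1 h2
    subst h1
    obtain ⟨L, hL, rfl⟩ := exists_hull_eq hT hg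
    obtain ⟨M, hM, rfl⟩ := exists_hull_eq hT' hg'
    let f : FreeIS E → (simL C).Quotient := fun a => a
    let F := (FreeIS.rep E).map f (fun _ _ => rfl) (fun _ => rfl) rfl
    have hF : ∀ x, IsRedundant C x → F.letter x * F.letter (x.1, !x.2) = F.vert (lsrc x) :=
      fun x hx => (Con.eq _).2 (letter_mul_flip_simL hx)
    have h3 := F.act_congr hF hL hM h2
    have h4 : ∀ N : List (RedPath E), f ((FreeIS.rep E).act N ((FreeIS.rep E).val g)) =
        F.act N (F.val g) := fun N => (FreeIS.rep E).map_act_val (F' := F) (f := f)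
      (fun _ _ => rfl) (fun _ => rfl) (fun _ => rfl) (fun _ => rfl) N g
    rw [← h4, ← h4, FreeIS.act_rep hL, FreeIS.act_rep hM] at h3
    exact (Con.eq _).1 h3

theorem simL_zero_iff {a : FreeIS E} : simL C a 0 ↔ a = 0 := by
  constructor
  · intro h
    rcases simL_le_nredCon h with ⟨h1, -⟩ | ⟨p', q', h1, h2, h3⟩
    · exact h1
    · exact absurd h2.symm (FreeIS.of_ne_zero _)
  · rintro rfl
    exact (simL C).refl _

theorem isRep_iff {v : E.Vert} {T T' : Set (RedPath E)} (hT : IsETree v T) :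
    IsRep C v T T' ↔ IsETree v T' ∧ nred C T' = nred C T := by
  constructor
  · rintro ⟨h, h', hs⟩
    exact ⟨h', (simL_of_iff.1 hs).2⟩
  · rintro ⟨h', hn⟩
    exact ⟨hT, h', simL_of_iff.2 ⟨rfl, hn⟩⟩

end SimL

/-- Uniqueness of inverses follows from commuting idempotents. In `LI(E, C)` the generator `e⁻¹` is
not declared to be the inverse of `e`, and this is what forces it. -/
theorem InvSemigroupZero.inv_eq_of_mul {S : Type*} [InvSemigroupZero S] {a b : S}
    (h1 : a * b * a = a) (h2 : b * a * b = b) : a⁻¹ = b := by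
  have hab : a * b * (a * b) = a * b := by rw [← mul_assoc, h1]
  have hba : b * a * (b * a) = b * a := by rw [← mul_assoc, h2]
  have ha1 : a * a⁻¹ * (a * a⁻¹) = a * a⁻¹ := mul_inv_idem a
  have ha2 : a⁻¹ * a * (a⁻¹ * a) = a⁻¹ * a := by
    have := mul_inv_idem a⁻¹
    rwa [inv_inv] at this
  have ha3 : a⁻¹ * a * a⁻¹ = a⁻¹ := by
    have := mul_inv_mul a⁻¹
    rwa [inv_inv] at this
  calc a⁻¹ = a⁻¹ * (a * b * a) * a⁻¹ := by rw [h1, ha3]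
    _ = a⁻¹ * (a * b * (a * a⁻¹)) := by simp only [mul_assoc]
    _ = a⁻¹ * (a * a⁻¹ * (a * b)) := by rw [idem_comm hab ha1]
    _ = a⁻¹ * a * a⁻¹ * (a * b) := by simp only [mul_assoc]
    _ = a⁻¹ * a * (b * a * b) := by rw [ha3, h2, mul_assoc]
    _ = a⁻¹ * a * (b * a) * b := by simp only [mul_assoc]
    _ = b * a * (a⁻¹ * a) * b := by rw [idem_comm hba ha2]
    _ = b * (a * a⁻¹ * a) * b := by simp only [mul_assoc]
    _ = b := by rw [mul_inv_mul, h2]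

/-! ### Normal forms in the Leavitt inverse semigroup -/

namespace LI
variable {E : DirGraph.{u, w}} (C : Separation E)

theorem exists_part (e : E.Edge) : ∃ X, C.IsPart X ∧ e ∈ X := by
  have h : e ∈ ⋃₀ C.parts (E.src e) := by rw [C.cover]; rfl
  obtain ⟨X, hX, he⟩ := h
  exact ⟨X, ⟨_, hX⟩, he⟩

theorem letter_false_mul_true (e : E.Edge) :
    letter C (e, false) * letter C (e, true) = vert C (E.rng e) := by
  obtain ⟨X, hX, he⟩ := exists_part C e
  exact Quotient.sound (Term.Rel.inv_mul_self X e hX he)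

theorem src_mul (x : Letter E) : vert C (lsrc x) * letter C x = letter C x :=
  Quotient.sound (Term.Rel.src_mul x)

theorem mul_rng (x : Letter E) : letter C x * vert C (lrng x) = letter C x :=
  Quotient.sound (Term.Rel.mul_rng x)

theorem letter_inv (x : Letter E) : (letter C x)⁻¹ = letter C (x.1, !x.2) := by
  have h : ∀ e : E.Edge, (letter C (e, true))⁻¹ = letter C (e, false) := by
    intro e
    refine InvSemigroupZero.inv_eq_of_mul ?_ ?_
    · rw [mul_assoc, letter_false_mul_true]
      exact mul_rng C (e, true)
    · rw [letter_false_mul_true]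
      exact src_mul C (e, false)
  obtain ⟨e, _ | _⟩ := x
  · rw [← h, inv_inv]
    rfl
  · exact h e

/-- The tautological representation in the Leavitt inverse semigroup. -/
def rep : PathRep (LI C) E where
  vert := vert C
  letter := letter C
  vert_mul_self v := Quotient.sound (Term.Rel.vert_mul_self v)
  vert_mul_vert v v' h := Quotient.sound (Term.Rel.vert_mul_vert v v' h)
  src_mul := src_mul C
  mul_rng := mul_rng C
  letter_inv := letter_inv C

theorem rep_redundant (x : Letter E) (hx : IsRedundant C x) :
    (rep C).letter x * (rep C).letter (x.1, !x.2) = (rep C).vert (lsrc x) := by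
  obtain ⟨e, _ | _⟩ := x
  · exact letter_false_mul_true C e
  · rcases hx with h | h
    · simp at h
    · exact Quotient.sound (Term.Rel.mul_inv_self e h)

/-- The class of a term. -/
def mk (t : Term E) : LI C := Quotient.mk _ t

/-- Zero and the normal elements contain the generators and are closed under product and inverse. -/
theorem eq_zero_or_isNormal (x : LI C) : x = 0 ∨ (rep C).IsNormal x := by
  obtain ⟨t, rfl⟩ : ∃ t, mk C t = x := Quotient.exists_rep x
  induction t with
  | gen y =>
    cases y with
    | vert v => exact Or.inr ((rep C).isNormal_vert v)
    | letter x => exact Or.inr ((rep C).isNormal_letter x)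
  | zero => exact Or.inl rfl
  | mul a b iha ihb =>
    change mk C a * mk C b = 0 ∨ (rep C).IsNormal (mk C a * mk C b)
    rcases iha with ha | ha
    · left; rw [ha, zero_mul]
    rcases ihb with hb | hb
    · left; rw [hb, mul_zero]
    exact ha.mul hb
  | inv a ih =>
    change (mk C a)⁻¹ = 0 ∨ (rep C).IsNormal (mk C a)⁻¹
    rcases ih with ha | ha
    · left; rw [ha, InvSemigroupZero.inv_zero]
    · exact ha.of_inv_or

variable {C}

/-- In a subpath `x⁻¹y` with `x, y ∈ X` the edges differ, as the path is reduced, so the relation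
`x⁻¹y = 0` annihilates the whole path. -/
theorem isSeparated_of_val_ne_zero {g : RedPath E} (h : (rep C).val g ≠ 0) :
    IsSeparated C g := by
  rintro X hX x hx y hy ⟨a, b, hab⟩
  apply h
  have hxy : x ≠ y := by
    rintro rfl
    have h1 : FreeGroup.IsReduced [(x, false), (x, true)] := g.reduced.infix ⟨a, b, hab⟩
    rw [FreeGroup.isReduced_cons_cons] at h1
    simpa using h1.1 rfl
  rw [List.append_assoc] at hab
  have h0 : letter C (x, false) * letter C (y, true) = 0 :=
    Quotient.sound (Term.Rel.inv_mul_ne X x y hX hx hy hxy)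
  rw [(rep C).val_eq_of_word hab.symm]
  change _ * (letter C (x, false) * (letter C (y, true) * _)) = 0
  rw [← mul_assoc (letter C (x, false)), h0, zero_mul, mul_zero]

/-- The element absorbs `ε(ν) ε(γ)`, which contains the factor `ν⁻¹ γ`. That factor is an idempotent
times the value of the reduced path `ν⁻¹ · γ`, so this path has nonzero value and is separated. -/
theorem isCompatible_of_act_ne_zero {L : List (RedPath E)} {g : RedPath E}
    (h : (rep C).act L ((rep C).val g) ≠ 0) : IsCompatible C (hull L g) where
  sep γ hγ := by
    refine isSeparated_of_val_ne_zero fun h0 => h ?_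
    rw [← (rep C).rangeIdem_mul_act_of_mem_hull hγ, PathRep.rangeIdem, h0, zero_mul, zero_mul]
  compat γ hγ ν hν := by
    have h1 : (rep C).val ν.inv * (rep C).val γ ≠ 0 := by
      intro h0
      apply h
      rw [← (rep C).rangeIdem_mul_act_of_mem_hull hν, ← (rep C).rangeIdem_mul_act_of_mem_hull hγ,
        PathRep.rangeIdem, PathRep.rangeIdem, ← (rep C).val_inv ν]
      calc (rep C).val ν * (rep C).val ν.inv * ((rep C).val γ * ((rep C).val γ)⁻¹ *
            (rep C).act L ((rep C).val g))
          = (rep C).val ν * ((rep C).val ν.inv * (rep C).val γ) * ((rep C).val γ)⁻¹ *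
            (rep C).act L ((rep C).val g) := by simp only [mul_assoc]
        _ = 0 := by rw [h0, mul_zero, zero_mul, zero_mul]
    by_cases hc : ν.inv.rng = γ.src
    · refine ⟨hc, isSeparated_of_val_ne_zero fun h0 => h1 ?_⟩
      rw [(rep C).val_mul_val _ _ hc, h0, mul_zero]
    · exact absurd ((rep C).val_mul_val_of_ne hc) h1

end LI

/-! ### The isomorphism with the Leavitt–Munn trees -/

section Eval
variable {E : DirGraph.{u, w}} (C : Separation E)

/-- The representation in the semigroup of Leavitt-Munn trees. -/
def LM.rep : PathRep (LM C) E := (FreeIS.rep E).map (toLM C) toLM_mul toLM_inv rfl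

variable {C}

theorem toLM_letter_mul_flip {x : Letter E} (hx : IsRedundant C x) :
    toLM C (FreeIS.letter x * FreeIS.letter (x.1, !x.2)) = toLM C (FreeIS.vert (lsrc x)) := by
  rw [FreeIS.letter_mul_flip]
  refine toLM_congr (isY_lower (isSeparated_letter x)).compatible ?_ rfl
    ((nred_lower_letter hx).trans (nred_unit _).symm)
  refine (isY_lower (isSeparated_unit (C := C) (lsrc x))).compatible.mono ?_
  exact Set.singleton_subset_iff.2 (RedPath.mem_lower_self _)

theorem toLM_inv_mul_ne {X : Set E.Edge} {e f : E.Edge} (hX : C.IsPart X) (he : e ∈ X)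
    (hf : f ∈ X) (hne : e ≠ f) :
    toLM C (FreeIS.letter (e, false) * FreeIS.letter (f, true)) = 0 := by
  by_cases hc : (RedPath.letter (e, false)).rng = (RedPath.letter (f, true)).src
  · rw [FreeIS.letter, FreeIS.letter, FreeIS.of_mul_of hc, toLM_of_eq_zero]
    intro h
    refine h.sep _ (MunnTree.mem _) X hX e he f hf ?_
    have hr : FreeGroup.IsReduced [(e, false), (f, true)] := by
      rw [FreeGroup.isReduced_cons_cons]
      exact ⟨fun h => absurd h hne, FreeGroup.IsReduced.singleton⟩
    change _ <:+: FreeGroup.reduce [(e, false), (f, true)]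
    rw [hr.reduce_eq]
  · rw [FreeIS.letter, FreeIS.letter, FreeIS.of_mul_of_ne hc, toLM_zero]

variable (C)

/-- The value of a term in the semigroup of Leavitt-Munn trees. -/
def Term.toLM : Term E → LM C
  | .gen (.vert v) => (LM.rep C).vert v
  | .gen (.letter x) => (LM.rep C).letter x
  | .zero => 0
  | .mul a b => a.toLM * b.toLM
  | .inv a => a.toLM⁻¹

variable {C}

theorem Term.Rel.toLM_eq {a b : Term E} (h : Term.Rel C a b) : a.toLM C = b.toLM C := by
  induction h with
  | refl => rfl
  | symm _ ih => exact ih.symm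
  | trans _ _ ih ih' => exact ih.trans ih'
  | mul_congr _ _ ih ih' => simp only [Term.toLM, ih, ih']
  | inv_congr _ ih => simp only [Term.toLM, ih]
  | assoc a b c => exact mul_assoc _ _ _
  | zero_mul a => exact MulZeroClass.zero_mul _
  | mul_zero a => exact MulZeroClass.mul_zero _
  | inv_inv a => exact _root_.inv_inv _
  | mul_inv_rev a b => exact InvSemigroupZero.mul_inv_rev _ _
  | mul_inv_mul a => exact InvSemigroupZero.mul_inv_mul _
  | mul_inv_comm a b => exact InvSemigroupZero.mul_inv_comm _ _
  | vert_mul_self v => exact (LM.rep C).vert_mul_self v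
  | vert_mul_vert v v' h => exact (LM.rep C).vert_mul_vert v v' h
  | src_mul x => exact (LM.rep C).src_mul x
  | mul_rng x => exact (LM.rep C).mul_rng x
  | inv_mul_self X e hX he =>
    exact (toLM_mul _ _).symm.trans (toLM_letter_mul_flip (C := C) (x := (e, false)) (Or.inl rfl))
  | inv_mul_ne X e f hX he hf hne =>
    exact (toLM_mul _ _).symm.trans (toLM_inv_mul_ne hX he hf hne)
  | mul_inv_self e he =>
    exact (toLM_mul _ _).symm.trans (toLM_letter_mul_flip (C := C) (x := (e, true)) (Or.inr he))

variable (C)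

/-- The homomorphism from the Leavitt inverse semigroup to the semigroup of Leavitt-Munn trees. -/
def LI.toLM : LI C → LM C := Quotient.lift (Term.toLM C) fun _ _ h => Term.Rel.toLM_eq h

variable {C}

theorem LI.toLM_mul (x y : LI C) : LI.toLM C (x * y) = LI.toLM C x * LI.toLM C y := by
  obtain ⟨x, rfl⟩ := Quotient.exists_rep x
  obtain ⟨y, rfl⟩ := Quotient.exists_rep y
  rfl

theorem LI.toLM_inv (x : LI C) : LI.toLM C x⁻¹ = (LI.toLM C x)⁻¹ := by
  obtain ⟨x, rfl⟩ := Quotient.exists_rep x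
  rfl

/-- Both sides are the value of one normal form in `LM C`: the maps from `LI C` and from `FreeIS E`
carry their representations to the same `LM.rep C`. -/
theorem LI.toLM_act_val {L : List (RedPath E)} {g : RedPath E} (hL : ∀ t ∈ L, t.src = g.src) :
    LI.toLM C ((LI.rep C).act L ((LI.rep C).val g)) =
      LeavittMunn.toLM C (FreeIS.of ⟨hull L g, g, isETree_hull hL, self_mem_hull L g⟩) := by
  rw [← FreeIS.act_rep hL, (LI.rep C).map_act_val (F' := LM.rep C) LI.toLM_mul LI.toLM_inv
    (fun _ => rfl) (fun _ => rfl), (FreeIS.rep E).map_act_val (F' := LM.rep C)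
    LeavittMunn.toLM_mul LeavittMunn.toLM_inv (fun _ => rfl) (fun _ => rfl)]

/-- A nonzero element of the Leavitt inverse semigroup, in normal form. -/
theorem LI.exists_normal {x : LI C} (hx : x ≠ 0) :
    ∃ (L : List (RedPath E)) (g : RedPath E) (hL : ∀ t ∈ L, t.src = g.src)
      (hY : IsCompatible C (hull L g)), x = (LI.rep C).act L ((LI.rep C).val g) ∧
      LI.toLM C x = LM.of (LM.ofMunn ⟨hull L g, g, isETree_hull hL, self_mem_hull L g⟩ hY) := by
  rcases LI.eq_zero_or_isNormal C x with h | ⟨L, g, hL, rfl⟩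
  · exact absurd h hx
  · have hY := LI.isCompatible_of_act_ne_zero hx
    exact ⟨L, g, hL, hY, rfl, (LI.toLM_act_val hL).trans (toLM_of hY)⟩

/-- Nonzero elements are values of compatible trees, so their images are nonzero. Equal images mean
the same path and the same `nred`, and `PathRep.act_congr` in `LI C` gives equality. -/
theorem LI.toLM_injective : Function.Injective (LI.toLM C) := by
  have h0 : ∀ x : LI C, LI.toLM C x = 0 → x = 0 := by
    intro x hx
    by_contra hne
    obtain ⟨L, g, hL, hY, -, h⟩ := LI.exists_normal hne
    exact LM.of_ne_zero _ (h.symm.trans hx)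
  intro x y hxy
  by_cases hx : x = 0
  · subst hx
    exact (h0 y hxy.symm).symm
  by_cases hy : y = 0
  · subst hy
    exact h0 x hxy
  obtain ⟨L, g, hL, hY, hxe, h1⟩ := LI.exists_normal hx
  obtain ⟨M, k, hM, hY', hye, h2⟩ := LI.exists_normal hy
  have h3 := LM.of_injective (h1.symm.trans (hxy.trans h2))
  obtain rfl : g = k := congrArg LMTree.path h3
  rw [hxe, hye]
  exact (LI.rep C).act_congr (LI.rep_redundant C) hL hM
    ((treeL_eq_iff (isETree_hull hL) (isETree_hull hM)).1 (congrArg LMTree.tree h3))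

theorem LI.toLM_surjective : Function.Surjective (LI.toLM C) := by
  intro a
  rcases LM.eq_zero_or_of a with rfl | ⟨p, rfl⟩
  · exact ⟨0, rfl⟩
  · obtain ⟨L, hL, hT⟩ := exists_hull_eq (g := p.path) p.toMunn.isTree p.toMunn.mem
    refine ⟨(LI.rep C).act L ((LI.rep C).val p.path), ?_⟩
    rw [LI.toLM_act_val hL]
    refine Eq.trans ?_ (toLM_toMunn p)
    exact congrArg _ (congrArg FreeIS.of (MunnTree.ext hT rfl))

variable (C)

/-- The isomorphism of the Leavitt inverse semigroup with the semigroup of Leavitt-Munn trees. -/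
def LI.equivLM : LI C ≃* LM C :=
  MulEquiv.ofBijective (⟨LI.toLM C, LI.toLM_mul⟩ : LI C →ₙ* LM C)
    ⟨LI.toLM_injective, LI.toLM_surjective⟩

end Eval

/-! ### From an idempotent pure grading to a partial action -/

/-- An idempotent pure partial homomorphism on an inverse semigroup with zero, together with an
identification of the semilattice of idempotents with `A`. -/
structure PureGrading (S A G : Type*) [InvSemigroupZero S] [Mul A] [Zero A] [Group G] where
  π : {x : S // x ≠ 0} → G
  isPartialHom : IsPartialHom π
  isIdempotentPure : IsIdempotentPure π
  idem : A ≃* Idem S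
  idem_zero : (idem 0).1 = 0

namespace PureGrading
open InvSemigroupZero
variable {S A G : Type*} [InvSemigroupZero S] [Mul A] [Zero A] [Group G] (P : PureGrading S A G)

theorem mul_inv_ne_zero {x : S} (hx : x ≠ 0) : x * x⁻¹ ≠ 0 := by
  intro h
  apply hx
  rw [← mul_inv_mul x, h, zero_mul]

/-- The element `x` has degree `γ`; the zero has all degrees. -/
def HasDeg (x : S) (γ : G) : Prop := ∀ h : x ≠ 0, P.π ⟨x, h⟩ = γ

variable {P}

theorem HasDeg.mul {x y : S} {γ δ : G} (hx : P.HasDeg x γ) (hy : P.HasDeg y δ) :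
    P.HasDeg (x * y) (γ * δ) := by
  intro h
  have hx0 : x ≠ 0 := fun h0 => h (by rw [h0, zero_mul])
  have hy0 : y ≠ 0 := fun h0 => h (by rw [h0, mul_zero])
  rw [← hx hx0, ← hy hy0]
  exact P.isPartialHom ⟨x, hx0⟩ ⟨y, hy0⟩ h

theorem hasDeg_of_idem {x : S} (hx : x * x = x) : P.HasDeg x 1 :=
  fun h => (P.isIdempotentPure ⟨x, h⟩).2 hx

theorem HasDeg.idem_of_one {x : S} (hx : P.HasDeg x 1) : x * x = x := by
  by_cases h : x = 0
  · rw [h, zero_mul]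
  · exact (P.isIdempotentPure ⟨x, h⟩).1 (hx h)

theorem HasDeg.inv {x : S} {γ : G} (hx : P.HasDeg x γ) : P.HasDeg x⁻¹ γ⁻¹ := by
  intro h
  have hx0 : x ≠ 0 := fun h0 => h (by rw [h0, InvSemigroupZero.inv_zero])
  have h1 := P.isPartialHom ⟨x, hx0⟩ ⟨x⁻¹, h⟩ (mul_inv_ne_zero hx0)
  rw [hasDeg_of_idem (mul_inv_idem x), hx hx0] at h1
  exact (inv_eq_of_mul_eq_one_right h1.symm).symm

/-- The product `x y⁻¹` has degree `1`, so it is idempotent and equal to its own inverse. -/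
theorem HasDeg.mul_inv_comm {x y : S} {γ : G} (hx : P.HasDeg x γ) (hy : P.HasDeg y γ) :
    x * y⁻¹ = y * x⁻¹ := by
  have h := hx.mul hy.inv
  rw [mul_inv_cancel] at h
  have h1 := inv_of_idem h.idem_of_one
  rw [InvSemigroupZero.mul_inv_rev, inv_inv] at h1
  exact h1.symm

theorem HasDeg.inv_mul_comm {x y : S} {γ : G} (hx : P.HasDeg x γ) (hy : P.HasDeg y γ) :
    x⁻¹ * y = y⁻¹ * x := by
  have := hx.inv.mul_inv_comm hy.inv
  rwa [inv_inv, inv_inv] at this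

/-- An element is determined by its range idempotent and its degree. -/
theorem HasDeg.eq {x y : S} {γ : G} (hx : P.HasDeg x γ) (hy : P.HasDeg y γ)
    (h : x * x⁻¹ = y * y⁻¹) : x = y := by
  have key : ∀ {x y : S}, P.HasDeg x γ → P.HasDeg y γ → x * x⁻¹ = y * y⁻¹ →
      x = y * x⁻¹ * y := by
    intro x y hx hy h
    calc x = y * y⁻¹ * x := by rw [← h, mul_inv_mul]
      _ = y * (x⁻¹ * y) := by rw [hx.inv_mul_comm hy, mul_assoc]
      _ = y * x⁻¹ * y := by rw [mul_assoc]
  have h1 := key hx hy h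
  have h2 := key hy hx h.symm
  have hf : x * y⁻¹ * (x * y⁻¹) = x * y⁻¹ := by
    have h := hx.mul hy.inv
    rw [mul_inv_cancel] at h
    exact h.idem_of_one
  rw [← hx.mul_inv_comm hy] at h1
  -- Now `x = (x y⁻¹) y` and `y = (x y⁻¹) x`: substituting the second into the first, the idempotent
  -- `x y⁻¹` absorbs its own repetition.
  calc x = x * y⁻¹ * (x * y⁻¹ * x) := by rw [← h2, ← h1]
    _ = x * y⁻¹ * (x * y⁻¹) * x := by simp only [mul_assoc]
    _ = y := by rw [hf, ← h2]

variable (P)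

/-- The range idempotent of `x`, as an element of the semilattice of idempotents. -/
def ranIdem (x : S) : Idem S := ⟨x * x⁻¹, mul_inv_idem x⟩

/-- The range idempotent of `x`, as an element of `A`. -/
def ran (x : S) : A := P.idem.symm (ranIdem x)

theorem idem_ran (x : S) : (P.idem (P.ran x)).1 = x * x⁻¹ := by
  rw [ran, MulEquiv.apply_symm_apply]
  rfl

theorem ran_eq_iff {x : S} {a : A} : P.ran x = a ↔ (P.idem a).1 = x * x⁻¹ := by
  rw [ran, MulEquiv.symm_apply_eq, eq_comm]
  exact Subtype.ext_iff

theorem ran_congr {x y : S} (h : x * x⁻¹ = y * y⁻¹) : P.ran x = P.ran y :=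
  congrArg P.idem.symm (Subtype.ext h)

theorem ran_zero : P.ran 0 = 0 := by
  rw [ran_eq_iff, P.idem_zero, zero_mul]

theorem ran_eq_zero {x : S} : P.ran x = 0 ↔ x = 0 := by
  constructor
  · intro h
    rw [ran_eq_iff, P.idem_zero] at h
    by_contra hx
    exact mul_inv_ne_zero hx h.symm
  · rintro rfl
    exact P.ran_zero

theorem ran_idem (a : A) : P.ran (P.idem a).1 = a := by
  rw [ran_eq_iff, inv_of_idem (P.idem a).2, (P.idem a).2]

theorem mul_ran (a : A) (x : S) : a * P.ran x = P.ran ((P.idem a).1 * x) := by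
  symm
  rw [ran_eq_iff, map_mul]
  change (P.idem a).1 * (P.idem (P.ran x)).1 = _
  rw [idem_ran, InvSemigroupZero.mul_inv_rev, inv_of_idem (P.idem a).2]
  have h := idem_comm (P.idem a).2 (mul_inv_idem x)
  calc (P.idem a).1 * (x * x⁻¹) = (P.idem a).1 * (P.idem a).1 * (x * x⁻¹) := by rw [(P.idem a).2]
    _ = (P.idem a).1 * (x * x⁻¹ * (P.idem a).1) := by rw [← h, mul_assoc]
    _ = (P.idem a).1 * x * (x⁻¹ * (P.idem a).1) := by simp only [mul_assoc]

theorem ran_mul_ran (x y : S) : P.ran x * P.ran y = P.ran (x * x⁻¹ * y) := by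
  rw [mul_ran, idem_ran]

theorem mul_comm' (P : PureGrading S A G) (a b : A) : a * b = b * a := by
  apply P.idem.injective
  rw [map_mul, map_mul]
  exact Subtype.ext (idem_comm (P.idem a).2 (P.idem b).2)

/-- The ideal of the range idempotents of the elements of degree `γ`. -/
def D (γ : G) : Set A := {a | ∃ x, P.HasDeg x γ ∧ P.ran x = a}

/-- The partial bijection given by an element of the group, extended by zero. -/
def θ (γ : G) (a : A) : A :=
  if h : ∃ x, P.HasDeg x γ⁻¹ ∧ P.ran x = a then P.ran h.choose⁻¹ else 0

variable {P}

/-- The choice in `θ` is harmless, since range idempotent and degree determine the element. So `θ`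
sends `x x⁻¹` to `x⁻¹ x`. -/
theorem θ_ran {x : S} {γ : G} (hx : P.HasDeg x γ⁻¹) : P.θ γ (P.ran x) = P.ran x⁻¹ := by
  have h : ∃ y, P.HasDeg y γ⁻¹ ∧ P.ran y = P.ran x := ⟨x, hx, rfl⟩
  rw [θ, dif_pos h]
  have h2 := h.choose_spec.2
  rw [ran_eq_iff, idem_ran] at h2
  rw [h.choose_spec.1.eq hx h2.symm]

theorem θ_inv_ran {x : S} {γ : G} (hx : P.HasDeg x γ) : P.θ γ⁻¹ (P.ran x) = P.ran x⁻¹ :=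
  θ_ran (by rwa [inv_inv])

theorem ran_mem_D {x : S} {γ : G} (hx : P.HasDeg x γ) : P.ran x ∈ P.D γ := ⟨x, hx, rfl⟩

theorem hasDeg_idem_mul {x : S} {γ : G} (hx : P.HasDeg x γ) (a : A) :
    P.HasDeg ((P.idem a).1 * x) γ := by
  have := (hasDeg_of_idem (P := P) (P.idem a).2).mul hx
  rwa [one_mul] at this

variable (P)

/-- The partial action on the semilattice of idempotents defined by an idempotent pure partial
homomorphism. -/
def partialAction : PartialAction G A where
  D := P.D
  θ γ :=
    { toFun := P.θ γ
      invFun := P.θ γ⁻¹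
      source := P.D γ⁻¹
      target := P.D γ
      map_source' := by
        rintro _ ⟨x, hx, rfl⟩
        rw [θ_ran hx]
        have := hx.inv
        rw [inv_inv] at this
        exact ran_mem_D this
      map_target' := by
        rintro _ ⟨x, hx, rfl⟩
        rw [θ_inv_ran hx]
        exact ran_mem_D hx.inv
      left_inv' := by
        rintro _ ⟨x, hx, rfl⟩
        have := hx.inv
        rw [inv_inv] at this
        rw [θ_ran hx, θ_inv_ran this, inv_inv]
      right_inv' := by
        rintro _ ⟨x, hx, rfl⟩
        rw [θ_inv_ran hx, θ_ran hx.inv, inv_inv] }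
  source_eq _ := rfl
  target_eq _ := rfl
  zero_mem _ := ⟨0, fun h => absurd rfl h, P.ran_zero⟩
  mul_mem_left := by
    rintro γ a _ ⟨x, hx, rfl⟩
    rw [mul_ran]
    exact ran_mem_D (hasDeg_idem_mul hx a)
  mul_mem_right := by
    rintro γ _ ⟨x, hx, rfl⟩ a
    rw [P.mul_comm', mul_ran]
    exact ran_mem_D (hasDeg_idem_mul hx a)
  map_mul := by
    rintro γ _ ⟨x, hx, rfl⟩ _ ⟨y, hy, rfl⟩
    -- The product of the two range idempotents is the range of `y y⁻¹ x`, which has the same degree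
    -- as `x`, so `θ_ran` applies to it.
    have hz : P.HasDeg (y * y⁻¹ * x) γ⁻¹ := by
      have := hasDeg_idem_mul hx (P.ran y)
      rwa [idem_ran] at this
    change P.θ γ _ = P.θ γ _ * P.θ γ _
    rw [P.mul_comm', ran_mul_ran, θ_ran hz, θ_ran hx, θ_ran hy, P.mul_comm', ran_mul_ran]
    have h1 : y * y⁻¹ * x = x * y⁻¹ * y := by
      rw [mul_assoc, ← hx.inv_mul_comm hy, ← mul_assoc, hx.mul_inv_comm hy]
    rw [h1]
    refine congrArg P.ran ?_
    simp only [InvSemigroupZero.mul_inv_rev, inv_inv, mul_assoc]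
  D_one := by
    ext a
    exact ⟨fun _ => trivial, fun _ => ⟨_, hasDeg_of_idem (P.idem a).2, P.ran_idem a⟩⟩
  θ_one a := by
    have h : P.HasDeg (P.idem a).1 (1 : G)⁻¹ := by
      rw [inv_one]
      exact hasDeg_of_idem (P.idem a).2
    change P.θ 1 a = a
    conv_lhs => rw [← P.ran_idem a]
    rw [θ_ran h, inv_of_idem (P.idem a).2, ran_idem]
  θ_mul := by
    rintro γ δ _ ⟨x, hx, rfl⟩ h
    change P.θ δ _ ∈ P.D _ at h
    change _ ∧ P.θ _ _ = P.θ _ (P.θ _ _)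
    rw [θ_ran hx] at h ⊢
    obtain ⟨y, hy, hxy⟩ := h
    have h1 := hxy
    rw [ran_eq_iff, idem_ran, inv_inv] at h1
    -- By `h1` the source idempotent of `x` is the range idempotent of `y`. Hence `x y` has the
    -- range of `x` and the source of `y`, and it witnesses the composite.
    have hz : P.HasDeg (x * y) (γ * δ)⁻¹ := by
      rw [_root_.mul_inv_rev]
      exact hx.mul hy
    have h2 : P.ran x = P.ran (x * y) := by
      refine P.ran_congr ?_
      calc x * x⁻¹ = x * (x⁻¹ * x) * x⁻¹ := by rw [← mul_assoc, mul_inv_mul]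
        _ = x * y * (x * y)⁻¹ := by
          rw [h1, InvSemigroupZero.mul_inv_rev]; simp only [mul_assoc]
    rw [h2]
    refine ⟨ran_mem_D hz, ?_⟩
    rw [θ_ran hz, ← hxy, θ_ran hy]
    refine P.ran_congr ?_
    simp only [InvSemigroupZero.mul_inv_rev, inv_inv]
    calc y⁻¹ * x⁻¹ * (x * y) = y⁻¹ * (x⁻¹ * x) * y := by simp only [mul_assoc]
      _ = y⁻¹ * y * y⁻¹ * y := by rw [h1]; simp only [mul_assoc]
      _ = y⁻¹ * y := by
        have := mul_inv_mul y⁻¹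
        rw [inv_inv] at this
        rw [this]

/-- The degree, with value `1` at zero. -/
def deg (x : S) : G := if h : x ≠ 0 then P.π ⟨x, h⟩ else 1

theorem hasDeg_deg (x : S) : P.HasDeg x (P.deg x) := fun h => by rw [deg, dif_pos h]

theorem HasDeg.deg_eq {P : PureGrading S A G} {x : S} {γ : G} (hx : P.HasDeg x γ) (h : x ≠ 0) :
    P.deg x = γ := by
  rw [deg, dif_pos h, hx h]

/-- The map to the restricted semidirect product. -/
def toSemidirect (x : S) : RestrictedSemidirect P.partialAction :=
  RestrictedSemidirect.mk (P.ran x) (P.deg x) (ran_mem_D (P.hasDeg_deg x))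

theorem mk_of_eq_zero {a : A} {γ : G} (ha : a ∈ P.partialAction.D γ) (h : a = 0) :
    RestrictedSemidirect.mk a γ ha = 0 := dif_pos h

theorem mk_of_ne_zero {a : A} {γ : G} (ha : a ∈ P.partialAction.D γ) (h : a ≠ 0) :
    RestrictedSemidirect.mk a γ ha =
      (some ⟨(a, γ), ha, h⟩ : Option (SemidirectPair P.partialAction)) := dif_neg h

theorem mk_eq {a b : A} {γ δ : G} (ha : a ∈ P.partialAction.D γ) (hb : b ∈ P.partialAction.D δ)
    (hab : a = b) (h : a ≠ 0 → γ = δ) :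
    RestrictedSemidirect.mk a γ ha = RestrictedSemidirect.mk b δ hb := by
  subst hab
  by_cases h0 : a = 0
  · rw [P.mk_of_eq_zero _ h0, P.mk_of_eq_zero _ h0]
  · obtain rfl := h h0
    rfl

theorem mk_mul_mk {a b : A} {γ δ : G} (ha : a ∈ P.partialAction.D γ)
    (hb : b ∈ P.partialAction.D δ) :
    RestrictedSemidirect.mk a γ ha * RestrictedSemidirect.mk b δ hb =
      RestrictedSemidirect.mk _ _ (RestrictedSemidirect.mul_mem ha hb) := by
  have hθ : ∀ γ : G, P.partialAction.θ γ 0 = 0 := by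
    intro γ
    change P.θ γ 0 = 0
    have h : P.HasDeg 0 γ⁻¹ := fun h => absurd rfl h
    rw [← P.ran_zero, θ_ran h, InvSemigroupZero.inv_zero]
  have h0 : ∀ c : A, c * 0 = 0 := by
    intro c
    rw [← P.ran_zero, mul_ran, mul_zero]
  by_cases ha0 : a = 0
  · subst ha0
    have h1 : P.partialAction.θ γ (P.partialAction.θ γ⁻¹ 0 * b) = 0 := by
      rw [hθ, P.mul_comm', h0, hθ]
    rw [P.mk_of_eq_zero _ rfl, P.mk_of_eq_zero _ h1]
    rfl
  · by_cases hb0 : b = 0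
    · subst hb0
      have h1 : P.partialAction.θ γ (P.partialAction.θ γ⁻¹ a * 0) = 0 := by
        rw [h0, hθ]
      rw [P.mk_of_eq_zero hb rfl, P.mk_of_eq_zero _ h1, P.mk_of_ne_zero _ ha0]
      rfl
    · rw [P.mk_of_ne_zero ha ha0, P.mk_of_ne_zero hb hb0]
      rfl

/-- For `x` of degree `γ`, `θ_{γ⁻¹}` sends `x x⁻¹` to `x⁻¹ x`. Its product with `y y⁻¹` is the range
of `y y⁻¹ x⁻¹`, of degree `γ⁻¹`. Applying `θ_γ` gives the range of the inverse `x y y⁻¹`, which is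
that of `x y`. -/
theorem toSemidirect_mul (x y : S) :
    P.toSemidirect (x * y) = P.toSemidirect x * P.toSemidirect y := by
  refine Eq.trans ?_ (P.mk_mul_mk _ _).symm
  refine P.mk_eq _ _ ?_ ?_
  · change _ = P.θ _ (P.θ _ _ * _)
    rw [θ_inv_ran (P.hasDeg_deg x), ran_mul_ran]
    have h : P.HasDeg (x⁻¹ * x⁻¹⁻¹ * (y * y⁻¹) * x⁻¹) (P.deg x)⁻¹ := by
      have h1 := hasDeg_idem_mul (P.hasDeg_deg x).inv (P.ran (x⁻¹ * x⁻¹⁻¹ * y))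
      rw [idem_ran] at h1
      have h2 : x⁻¹ * x⁻¹⁻¹ * y * (x⁻¹ * x⁻¹⁻¹ * y)⁻¹ * x⁻¹ =
          x⁻¹ * x⁻¹⁻¹ * (y * y⁻¹) * x⁻¹ := by
        have h3 : x⁻¹ * x * (y * y⁻¹) = y * y⁻¹ * (x⁻¹ * x) := InvSemigroupZero.inv_mul_comm x y
        simp only [InvSemigroupZero.mul_inv_rev, inv_inv]
        calc x⁻¹ * x * y * (y⁻¹ * (x⁻¹ * x)) * x⁻¹
            = x⁻¹ * x * (y * y⁻¹ * (x⁻¹ * x)) * x⁻¹ := by simp only [mul_assoc]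
          _ = x⁻¹ * x * x⁻¹ * x * (y * y⁻¹) * x⁻¹ := by rw [← h3]; simp only [mul_assoc]
          _ = x⁻¹ * x * (y * y⁻¹) * x⁻¹ := by
            have := mul_inv_mul x⁻¹
            rw [inv_inv] at this
            rw [this]
      rwa [h2] at h1
    have h3 : x⁻¹ * x * (y * y⁻¹) = y * y⁻¹ * (x⁻¹ * x) := InvSemigroupZero.inv_mul_comm x y
    have h4 : x⁻¹ * x * x⁻¹ = x⁻¹ := by
      have := mul_inv_mul x⁻¹
      rwa [inv_inv] at this
    have h5 : x⁻¹ * x⁻¹⁻¹ * (y * y⁻¹) * x⁻¹ = y * y⁻¹ * x⁻¹ := by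
      rw [inv_inv, h3, mul_assoc, h4]
    rw [h5] at h
    have h6 : P.ran (x⁻¹ * x⁻¹⁻¹ * y) = P.ran (y * y⁻¹ * x⁻¹) := by
      rw [← ran_mul_ran, P.mul_comm', ran_mul_ran]
    rw [h6, θ_ran h]
    refine P.ran_congr ?_
    simp only [InvSemigroupZero.mul_inv_rev, inv_inv]
    calc x * y * (y⁻¹ * x⁻¹) = x * (y * y⁻¹ * (y * y⁻¹)) * x⁻¹ := by
          rw [mul_inv_idem]; simp only [mul_assoc]
      _ = x * (y * y⁻¹) * (y * y⁻¹ * x⁻¹) := by simp only [mul_assoc]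
  · intro h
    exact ((P.hasDeg_deg x).mul (P.hasDeg_deg y)).deg_eq fun h0 => h (by rw [h0, ran_zero])

theorem toSemidirect_zero : P.toSemidirect 0 = 0 := dif_pos P.ran_zero

theorem toSemidirect_of_ne_zero {x : S} (hx : x ≠ 0) : P.toSemidirect x =
    (some ⟨(P.ran x, P.deg x), ran_mem_D (P.hasDeg_deg x), fun h => hx (P.ran_eq_zero.1 h)⟩ :
      Option (SemidirectPair P.partialAction)) :=
  dif_neg fun h => hx (P.ran_eq_zero.1 h)

theorem toSemidirect_injective : Function.Injective P.toSemidirect := by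
  intro x y h
  by_cases hx : x = 0
  · by_cases hy : y = 0
    · rw [hx, hy]
    · rw [hx, toSemidirect_zero, P.toSemidirect_of_ne_zero hy] at h
      exact absurd h.symm (Option.some_ne_none _)
  · by_cases hy : y = 0
    · rw [hy, toSemidirect_zero, P.toSemidirect_of_ne_zero hx] at h
      exact absurd h (Option.some_ne_none _)
    · rw [P.toSemidirect_of_ne_zero hx, P.toSemidirect_of_ne_zero hy] at h
      obtain ⟨h1, h2⟩ := Prod.ext_iff.1 (congrArg Subtype.val (Option.some.inj h))
      dsimp only at h1 h2
      rw [ran_eq_iff, idem_ran] at h1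
      have hx' := P.hasDeg_deg x
      rw [h2] at hx'
      exact hx'.eq (P.hasDeg_deg y) h1.symm

theorem toSemidirect_surjective : Function.Surjective P.toSemidirect := by
  rintro (_ | ⟨⟨a, γ⟩, ⟨x, hx, h1⟩, h0⟩)
  · exact ⟨0, P.toSemidirect_zero⟩
  · dsimp only at hx h1 h0
    have hne : x ≠ 0 := fun h => h0 (by rw [← h1, h, ran_zero])
    refine ⟨x, ?_⟩
    rw [P.toSemidirect_of_ne_zero hne]
    exact congrArg some (Subtype.ext (Prod.ext h1 (hx.deg_eq hne)))

/-- The isomorphism with the restricted semidirect product. -/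
def semidirectEquiv : S ≃* RestrictedSemidirect P.partialAction :=
  MulEquiv.ofBijective (⟨P.toSemidirect, P.toSemidirect_mul⟩ :
    S →ₙ* RestrictedSemidirect P.partialAction)
    ⟨P.toSemidirect_injective, P.toSemidirect_surjective⟩

end PureGrading

/-! ### Independence of representatives -/

section Representatives
variable {E : DirGraph.{u, w}} {C : Separation E}

/-- Representatives share `nred`, hence `T_L`. The formulas for product and inverse with arbitrary
representatives then follow because `toLM` is a homomorphism. -/
theorem LMTree.of_eq_toLM (p : LMTree C) {T' : Set (RedPath E)} (hT : IsY C p.path.src T')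
    (hr : IsRep C p.path.src p.tree T') (hm : p.path ∈ T') :
    LM.of p = toLM C (FreeIS.of ⟨T', p.path, hT.isTree, hm⟩) := by
  rw [toLM_of (p := ⟨T', p.path, hT.isTree, hm⟩) hT.compatible]
  refine congrArg LM.of (LMTree.ext ?_ rfl)
  have hp := p.isYL.isY.isTree
  exact p.treeL_eq.symm.trans ((treeL_eq_iff hp hT.isTree).2 ((isRep_iff hp).1 hr).2.symm)

theorem LMTree.exists_mul_eq (p q : LMTree C) {T₁ T₂ : Set (RedPath E)}
    (h₁ : IsY C p.path.src T₁) (hr₁ : IsRep C p.path.src p.tree T₁) (hm₁ : p.path ∈ T₁)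
    (h₂ : IsY C q.path.src T₂) (hr₂ : IsRep C q.path.src q.tree T₂) (hm₂ : q.path ∈ T₂)
    (hc : p.path.rng = q.path.src) (h : IsCompatible C (T₁ ∪ p.path.translate T₂)) :
    ∃ t : LMTree C, t.tree = treeL C (T₁ ∪ p.path.translate T₂) ∧
      t.path = p.path.comp q.path hc ∧ LM.of p * LM.of q = LM.of t := by
  refine ⟨LM.ofMunn (FreeIS.mulTree ⟨T₁, p.path, h₁.isTree, hm₁⟩ ⟨T₂, q.path, h₂.isTree, hm₂⟩ hc)
    h, rfl, rfl, ?_⟩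
  rw [p.of_eq_toLM h₁ hr₁ hm₁, q.of_eq_toLM h₂ hr₂ hm₂, ← toLM_mul,
    FreeIS.of_mul_of (p := ⟨T₁, p.path, h₁.isTree, hm₁⟩) hc]
  exact toLM_of h

theorem LMTree.mul_eq_zero (p q : LMTree C) {T₁ T₂ : Set (RedPath E)}
    (h₁ : IsY C p.path.src T₁) (hr₁ : IsRep C p.path.src p.tree T₁) (hm₁ : p.path ∈ T₁)
    (h₂ : IsY C q.path.src T₂) (hr₂ : IsRep C q.path.src q.tree T₂) (hm₂ : q.path ∈ T₂)
    (h : ¬ (p.path.rng = q.path.src ∧ IsCompatible C (T₁ ∪ p.path.translate T₂))) :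
    LM.of p * LM.of q = 0 := by
  rw [p.of_eq_toLM h₁ hr₁ hm₁, q.of_eq_toLM h₂ hr₂ hm₂, ← toLM_mul]
  by_cases hc : p.path.rng = q.path.src
  · rw [FreeIS.of_mul_of (p := ⟨T₁, p.path, h₁.isTree, hm₁⟩) hc]
    exact toLM_of_eq_zero fun h' => h ⟨hc, h'⟩
  · rw [FreeIS.of_mul_of_ne (p := ⟨T₁, p.path, h₁.isTree, hm₁⟩) hc, toLM_zero]

theorem LMTree.exists_inv_eq (p : LMTree C) {T' : Set (RedPath E)} (hT : IsY C p.path.src T')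
    (hr : IsRep C p.path.src p.tree T') (hm : p.path ∈ T') :
    ∃ t : LMTree C, t.tree = treeL C (p.path.inv.translate T') ∧ t.path = p.path.inv ∧
      (LM.of p)⁻¹ = LM.of t := by
  refine ⟨LM.ofMunn (FreeIS.invTree ⟨T', p.path, hT.isTree, hm⟩) (hT.translate_inv hm).compatible,
    rfl, rfl, ?_⟩
  rw [p.of_eq_toLM hT hr hm, ← toLM_inv, FreeIS.inv_of]
  exact toLM_of (hT.translate_inv hm).compatible

theorem isRep_treeL {v : E.Vert} {T : Set (RedPath E)} (hT : IsETree v T) :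
    IsRep C v T (treeL C T) :=
  (isRep_iff hT).2 ⟨isETree_treeL hT, nred_treeL hT⟩

theorem IsRep.eq_treeL {v : E.Vert} {S T : Set (RedPath E)} (h : IsRep C v T S)
    (hS : IsLReduced C S) : S = treeL C T := by
  obtain ⟨hT, -, -⟩ := id h
  obtain ⟨hS', hn⟩ := (isRep_iff hT).1 h
  rw [← hS.treeL_eq hS']
  exact (treeL_eq_iff hS' hT).2 hn

end Representatives

/-! ### The semilattice `𝒴/∼_L`, the degree and the partial action -/

section Semilattice
variable {E : DirGraph.{u, w}} {C : Separation E}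

theorem Y.of_mul_of_eq_zero {S T : YTree C} (h : ¬ IsCompatible C (S.tree ∪ T.tree)) :
    Y.of S.isY * Y.of T.isY = 0 := dif_neg h

theorem Y.of_mul_of {S T : YTree C} (h : IsCompatible C (S.tree ∪ T.tree)) :
    Y.of S.isY * Y.of T.isY = Y.of (Y.isY_union S T h) := dif_pos h

@[elab_as_elim]
theorem Y.cases_of {P : Y C → Prop} (zero : P 0) (of : ∀ S : YTree C, P (Y.of S.isY))
    (a : Y C) : P a := by
  rcases a with _ | S
  exacts [zero, of S]

protected theorem Y.mul_zero (a : Y C) : a * 0 = 0 := by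
  rcases a with _ | S <;> rfl

/-- The map `T ↦ (T_L, v)`, for `T` in `𝒴(v)`. -/
def Y.toLM (a : Y C) : LM C := LeavittMunn.toLM C a.toFreeIS

theorem Y.toLM_of {v : E.Vert} {T : Set (RedPath E)} (hT : IsY C v T) :
    (Y.of hT).toLM =
      LM.of (LM.ofMunn ⟨T, RedPath.unit v, hT.isTree, hT.isTree.unit_mem⟩ hT.compatible) :=
  LeavittMunn.toLM_of (p := ⟨T, RedPath.unit v, hT.isTree, hT.isTree.unit_mem⟩) hT.compatible

theorem Y.toLM_mul (a b : Y C) : (a * b).toLM = a.toLM * b.toLM := by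
  rw [Y.toLM, Y.toLM, Y.toLM, ← LeavittMunn.toLM_mul]
  induction a using Y.cases_of with
  | zero => rfl
  | of S =>
  induction b using Y.cases_of with
  | zero =>
    rw [Y.mul_zero]
    exact congrArg (LeavittMunn.toLM C) (FreeIS.mul_zero _).symm
  | of T =>
  obtain ⟨v, S, hS⟩ := S
  obtain ⟨v', T, hT⟩ := T
  by_cases h : IsCompatible C (S ∪ T)
  · have hv : v = v' := by
      have h1 := Y.isY_union ⟨v, S, hS⟩ ⟨v', T, hT⟩ h
      exact (h1.isTree.src_eq _ (Or.inr hT.isTree.unit_mem)).symm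
    subst hv
    rw [Y.of_mul_of (S := ⟨v, S, hS⟩) (T := ⟨v, T, hT⟩) h]
    exact congrArg (LeavittMunn.toLM C) (FreeIS.idem_mul_idem hS.isTree hT.isTree).symm
  · rw [Y.of_mul_of_eq_zero (S := ⟨v, S, hS⟩) (T := ⟨v', T, hT⟩) h]
    change (0 : LM C) = LeavittMunn.toLM C (FreeIS.idem hS.isTree * FreeIS.idem hT.isTree)
    by_cases hv : v = v'
    · subst hv
      rw [FreeIS.idem_mul_idem]
      exact (toLM_of_eq_zero (p := ⟨S ∪ T, _, _, _⟩) h).symm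
    · rw [FreeIS.idem_mul_idem_ne _ _ hv]
      rfl

theorem Y.toLM_eq_iff {a b : Y C} : a.toLM = b.toLM ↔ simL C a.toFreeIS b.toFreeIS := by
  induction a using Y.cases_of with
  | zero =>
    induction b using Y.cases_of with
    | zero => exact ⟨fun _ => (simL C).refl _, fun _ => rfl⟩
    | of T =>
      refine iff_of_false ?_ ?_
      · rw [Y.toLM_of]
        exact (LM.of_ne_zero _).symm
      · exact fun h => FreeIS.of_ne_zero _ (simL_zero_iff.1 ((simL C).symm h))
  | of S =>
    induction b using Y.cases_of with
    | zero =>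
      refine iff_of_false ?_ ?_
      · rw [Y.toLM_of]
        exact LM.of_ne_zero _
      · exact fun h => FreeIS.of_ne_zero _ (simL_zero_iff.1 h)
    | of T =>
      obtain ⟨v, S, hS⟩ := S
      obtain ⟨v', T, hT⟩ := T
      rw [Y.toLM_of, Y.toLM_of]
      refine Iff.trans ?_ simL_of_iff.symm
      constructor
      · intro h
        have h1 := LM.of_injective h
        have h2 : RedPath.unit v = RedPath.unit v' := congrArg LMTree.path h1
        obtain rfl : v = v' := congrArg RedPath.src h2
        exact ⟨rfl, (treeL_eq_iff hS.isTree hT.isTree).1 (congrArg LMTree.tree h1)⟩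
      · rintro ⟨h2, h3⟩
        obtain rfl : v = v' := congrArg RedPath.src h2
        exact congrArg LM.of (LMTree.ext ((treeL_eq_iff hS.isTree hT.isTree).2 h3) rfl)

/-- The restriction of `∼_L` is the kernel of the multiplicative map `Y.toLM`. It is already a
congruence on `𝒴`, and generating one from it adds nothing. -/
theorem simY_iff {a b : Y C} : simY C a b ↔ simL C a.toFreeIS b.toFreeIS := by
  refine ⟨fun h => ?_, fun h => ConGen.Rel.of _ _ h⟩
  let c : Con (Y C) :=
    { r := fun a b => a.toLM = b.toLM
      iseqv := ⟨fun _ => rfl, Eq.symm, Eq.trans⟩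
      mul' := by
        intro a b c d h h'
        rw [Y.toLM_mul, Y.toLM_mul, h, h'] }
  have hle : simY C ≤ c := Con.conGen_le.2 fun _ _ h => Y.toLM_eq_iff.2 h
  exact Y.toLM_eq_iff.1 (hle h)

theorem cls_congr {v v' : E.Vert} {T T' : Set (RedPath E)} (h : IsY C v T) (h' : IsY C v' T')
    (hv : v = v') (hT : T = T') : cls h = cls h' := by
  subst hv
  subst hT
  rfl

/-- The map `[T] ↦ (T_L, v)`, for `T` in `𝒴(v)`. -/
def YL.toLM : YL C → LM C :=
  Quotient.lift Y.toLM fun _ _ h => Y.toLM_eq_iff.2 (simY_iff.1 h)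

theorem YL.toLM_cls {v : E.Vert} {T : Set (RedPath E)} (hT : IsY C v T) :
    YL.toLM (cls hT) =
      LM.of (LM.ofMunn ⟨T, RedPath.unit v, hT.isTree, hT.isTree.unit_mem⟩ hT.compatible) :=
  Y.toLM_of hT

theorem YL.toLM_mul (a b : YL C) : YL.toLM (a * b) = YL.toLM a * YL.toLM b := by
  induction a using Con.induction_on
  induction b using Con.induction_on
  exact Y.toLM_mul _ _

theorem YL.toLM_injective : Function.Injective (YL.toLM (C := C)) := by
  intro a b h
  induction a using Con.induction_on
  induction b using Con.induction_on
  exact (Con.eq _).2 (simY_iff.2 (Y.toLM_eq_iff.1 h))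

theorem Y.toLM_idem (a : Y C) : a.toLM * a.toLM = a.toLM := by
  rw [Y.toLM, ← LeavittMunn.toLM_mul]
  induction a using Y.cases_of with
  | zero => rfl
  | of S =>
    refine congrArg (LeavittMunn.toLM C) ?_
    exact (FreeIS.idem_mul_idem _ _).trans (FreeIS.idem_congr _ _ (Set.union_self _))

theorem YL.toLM_idem (a : YL C) : YL.toLM a * YL.toLM a = YL.toLM a := by
  induction a using Con.induction_on
  exact Y.toLM_idem _

/-- The element `ω(g)` of the free group, for a Leavitt-Munn tree `(T, g)`. -/
def LM.deg : LM C → FreeGroup E.Edge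
  | some p => p.path.toFree
  | none => 1

theorem LM.deg_of (p : LMTree C) : LM.deg (LM.of p) = p.path.toFree := rfl

theorem LM.deg_mul {a b : LM C} (h : a * b ≠ 0) : LM.deg (a * b) = LM.deg a * LM.deg b := by
  rcases LM.eq_zero_or_of a with rfl | ⟨p, rfl⟩
  · exact absurd (zero_mul b) h
  rcases LM.eq_zero_or_of b with rfl | ⟨q, rfl⟩
  · exact absurd (mul_zero _) h
  by_cases hc : ∃ _ : p.path.rng = q.path.src, IsCompatible C (LM.prodTree p q)
  · obtain ⟨h1, h2⟩ := hc
    rw [LM.of_mul_of h1 h2]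
    exact RedPath.toFree_comp _ _ h1
  · exact absurd (LM.of_mul_of_eq_zero hc) h

/-- A reduced path with trivial image in the free group is a vertex, so elements of degree `1` are
the `(T, v)`. -/
theorem LM.of_eq_toLM_cls {p : LMTree C} (h : p.path.toFree = 1) :
    LM.of p = YL.toLM (cls p.isYL.isY) := by
  rw [YL.toLM_cls]
  exact congrArg LM.of (LMTree.ext p.treeL_eq.symm (RedPath.eq_unit_of_toFree h))

theorem LM.deg_eq_one_iff {a : LM C} (ha : a ≠ 0) : LM.deg a = 1 ↔ a * a = a := by
  constructor
  · intro h
    rcases LM.eq_zero_or_of a with rfl | ⟨p, rfl⟩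
    · exact absurd rfl ha
    · rw [LM.of_eq_toLM_cls h, YL.toLM_idem]
  · intro h
    have h1 := LM.deg_mul (a := a) (b := a) (by rwa [h])
    rw [h] at h1
    exact left_eq_mul.1 h1

theorem LM.of_mul_inv (p : LMTree C) :
    LM.of p * (LM.of p)⁻¹ = YL.toLM (cls p.isYL.isY) := by
  rw [← toLM_toMunn, ← toLM_inv, ← toLM_mul, FreeIS.of_mul_inv]
  exact toLM_congr (p := ⟨_, _, _, _⟩) (q := ⟨_, _, _, _⟩) p.isY_union.compatible
    p.isYL.isY.compatible rfl p.nred_union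

theorem LI.equivLM_inv (x : LI C) : LI.equivLM C x⁻¹ = (LI.equivLM C x)⁻¹ := LI.toLM_inv x

theorem LI.equivLM_zero : LI.equivLM C 0 = 0 := rfl

theorem LI.equivLM_ne_zero {x : LI C} (hx : x ≠ 0) : LI.equivLM C x ≠ 0 :=
  fun h => hx ((LI.equivLM C).injective (h.trans LI.equivLM_zero.symm))

variable (C)

/-- The map of `𝒴/∼_L` to the idempotents of the Leavitt inverse semigroup. -/
def YL.toIdem (a : YL C) : Idem (LI C) :=
  ⟨(LI.equivLM C).symm (YL.toLM a), by rw [← map_mul, YL.toLM_idem]⟩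

theorem YL.equivLM_toIdem (a : YL C) : LI.equivLM C (YL.toIdem C a).1 = YL.toLM a :=
  (LI.equivLM C).apply_symm_apply _

theorem YL.toIdem_mul (a b : YL C) : YL.toIdem C (a * b) = YL.toIdem C a * YL.toIdem C b := by
  refine Subtype.ext ((LI.equivLM C).injective ?_)
  change _ = LI.equivLM C ((YL.toIdem C a).1 * (YL.toIdem C b).1)
  rw [map_mul, YL.equivLM_toIdem, YL.equivLM_toIdem, YL.equivLM_toIdem, YL.toLM_mul]

theorem YL.toIdem_bijective : Function.Bijective (YL.toIdem C) := by
  constructor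
  · intro a b h
    apply YL.toLM_injective
    rw [← YL.equivLM_toIdem, h, YL.equivLM_toIdem]
  · rintro ⟨x, hx⟩
    -- A nonzero idempotent has degree `1`, so its Leavitt–Munn tree is based on a vertex and comes
    -- from `𝒴`.
    have key : ∃ a : YL C, YL.toLM a = LI.equivLM C x := by
      by_cases h0 : x = 0
      · exact ⟨0, by rw [h0]; rfl⟩
      obtain ⟨p, hp⟩ := (LM.eq_zero_or_of (LI.equivLM C x)).resolve_left (LI.equivLM_ne_zero h0)
      refine ⟨cls p.isYL.isY, ?_⟩
      rw [hp, LM.of_eq_toLM_cls]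
      rw [← LM.deg_of, ← hp, LM.deg_eq_one_iff (LI.equivLM_ne_zero h0), ← map_mul, hx]
    obtain ⟨a, ha⟩ := key
    refine ⟨a, Subtype.ext ((LI.equivLM C).injective ?_)⟩
    rw [YL.equivLM_toIdem, ha]

/-- The isomorphism of `𝒴/∼_L` with the idempotents of the Leavitt inverse semigroup. -/
def YL.equivIdem : YL C ≃* Idem (LI C) :=
  MulEquiv.ofBijective (⟨YL.toIdem C, YL.toIdem_mul C⟩ : YL C →ₙ* Idem (LI C))
    (YL.toIdem_bijective C)

/-- The grading `(T, g) ↦ ω(g)` of the Leavitt inverse semigroup. -/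
def LI.grading : PureGrading (LI C) (YL C) (FreeGroup E.Edge) where
  π x := LM.deg (LI.equivLM C x.1)
  isPartialHom x y h := by
    have h1 := LI.equivLM_ne_zero h
    rw [map_mul] at h1
    change LM.deg (LI.equivLM C (x.1 * y.1)) = _
    rw [map_mul]
    exact LM.deg_mul h1
  isIdempotentPure x := by
    rw [LM.deg_eq_one_iff (LI.equivLM_ne_zero x.2), ← map_mul, (LI.equivLM C).injective.eq_iff]
  idem := YL.equivIdem C
  idem_zero := (LI.equivLM C).injective (YL.equivLM_toIdem C 0)

variable {C}

theorem LI.hasDeg {x : LI C} {p : LMTree C} (h : LI.equivLM C x = LM.of p) :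
    (LI.grading C).HasDeg x p.path.toFree := by
  intro hx
  change LM.deg (LI.equivLM C x) = _
  rw [h, LM.deg_of]

theorem LI.ran_eq {x : LI C} {p : LMTree C} (h : LI.equivLM C x = LM.of p) :
    (LI.grading C).ran x = cls p.isYL.isY := by
  rw [PureGrading.ran_eq_iff]
  apply (LI.equivLM C).injective
  rw [map_mul, LI.equivLM_inv, h, LM.of_mul_inv]
  exact YL.equivLM_toIdem C _

theorem LI.mem_D_iff {γ : FreeGroup E.Edge} {y : YL C} : y ∈ (LI.grading C).D γ ↔
    y = 0 ∨ ∃ p : LMTree C, p.path.toFree = γ ∧ y = cls p.isYL.isY := by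
  constructor
  · rintro ⟨x, hx, rfl⟩
    by_cases h0 : x = 0
    · exact Or.inl ((LI.grading C).ran_eq_zero.2 h0)
    · obtain ⟨p, hp⟩ := (LM.eq_zero_or_of (LI.equivLM C x)).resolve_left (LI.equivLM_ne_zero h0)
      exact Or.inr ⟨p, (LI.hasDeg hp h0).symm.trans (hx h0), LI.ran_eq hp⟩
  · rintro (rfl | ⟨p, rfl, rfl⟩)
    · exact (LI.grading C).partialAction.zero_mem γ
    · have h := (LI.equivLM C).apply_symm_apply (LM.of p)
      rw [← LI.ran_eq h]
      exact PureGrading.ran_mem_D (LI.hasDeg h)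

/-- A nonempty word fixes its source through its first letter. Only the vertices are collapsed by
`ω`, which is why the domains are described for paths of positive length. -/
theorem RedPath.eq_of_toFree_eq {g h : RedPath E} (hw : g.word ≠ [])
    (h1 : h.toFree = g.toFree) : h = g := by
  refine RedPath.ext_toFree ?_ h1
  have h2 : h.word = g.word := by
    have := FreeGroup.reduce.sound h1
    rwa [g.reduced.reduce_eq, h.reduced.reduce_eq] at this
  obtain ⟨x, l, hx⟩ := List.exists_cons_of_ne_nil hw
  have h3 := g.isPath
  have h4 := h.isPath
  rw [hx] at h3
  rw [h2, hx] at h4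
  exact h4.1.symm.trans h3.1

theorem LI.D_toFree {g : RedPath E} (hs : IsSeparated C g) (hw : g.word ≠ []) :
    (LI.grading C).D g.toFree = {y | y = 0 ∨ ∃ (T : Set (RedPath E)) (hT : IsYL C g.src T),
      pathL C g ∈ T ∧ y = cls hT.isY} := by
  ext y
  rw [LI.mem_D_iff]
  refine or_congr_right ?_
  constructor
  · rintro ⟨⟨T, g', hT, hs', hm⟩, h1, rfl⟩
    obtain rfl : g' = g := RedPath.eq_of_toFree_eq hw h1
    exact ⟨T, hT, hm, rfl⟩
  · rintro ⟨T, hT, hm, rfl⟩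
    exact ⟨⟨T, g, hT, hs, hm⟩, rfl, rfl⟩

theorem LI.D_eq_zero {γ : FreeGroup E.Edge}
    (h : ∀ g : RedPath E, IsSeparated C g → g.toFree ≠ γ) : (LI.grading C).D γ = {0} := by
  ext y
  rw [LI.mem_D_iff, Set.mem_singleton_iff]
  refine or_iff_left ?_
  rintro ⟨p, hp, -⟩
  exact h _ p.sep hp

/-- The pair `(T, g⁻¹)` is a Leavitt–Munn tree with range idempotent `T` and degree `ω(g)⁻¹`. So `θ`
sends the class of `T` to the range idempotent of the inverse, whose tree is `(g · T')_L`. -/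
theorem LI.θ_toFree {g : RedPath E} (hs : IsSeparated C g) {T T' : Set (RedPath E)}
    (hT : IsYL C g.rng T) (hm : pathL C g.inv ∈ T) (hT' : IsY C g.rng T')
    (hr : IsRep C g.rng T T') (hm' : g.inv ∈ T') :
    ∃ hS : IsYL C g.src (treeL C (g.translate T')),
      (LI.grading C).θ g.toFree (cls hT.isY) = cls hS.isY := by
  let p : LMTree C := ⟨T, g.inv, hT, sep_inv hs, hm⟩
  obtain ⟨t, h1, h2, h3⟩ := p.exists_inv_eq hT' hr hm'
  have hx := (LI.equivLM C).apply_symm_apply (LM.of p)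
  set x := (LI.equivLM C).symm (LM.of p)
  have hx' : LI.equivLM C x⁻¹ = LM.of t := by rw [LI.equivLM_inv, hx, h3]
  have h4 : t.path = g := h2.trans (RedPath.inv_inv g)
  have h5 : t.tree = treeL C (g.translate T') := by
    rw [h1]
    change treeL C (g.inv.inv.translate T') = _
    rw [RedPath.inv_inv]
  have hS : IsYL C g.src (treeL C (g.translate T')) := by
    rw [← h5, ← h4]
    exact t.isYL
  refine ⟨hS, ?_⟩
  have h6 : (LI.grading C).HasDeg x g.toFree⁻¹ := by
    rw [← RedPath.toFree_inv]
    exact LI.hasDeg hx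
  have h7 := PureGrading.θ_ran h6
  rw [LI.ran_eq hx, LI.ran_eq hx'] at h7
  exact h7.trans (cls_congr _ _ (by rw [h4]) h5)

theorem treeL_unit (v : E.Vert) : treeL C {RedPath.unit v} = {RedPath.unit v} := by
  ext k
  rw [mem_treeL_iff (isETree_unit v), nred_unit]
  simp

end Semilattice

end

end LeavittMunn

/-! ### The main theorem -/

theorem theorem3p10 (E : DirGraph.{u, w}) (C : Separation E) :
    -- `T_L` is the unique element of the `∼_L`-class of the `E`-tree `T` none of whose maximal
    -- elements ends in some `e⁻¹`, or in some `e` with `{e} ∈ C`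
    (∀ (v : E.Vert) (T : Set (RedPath E)), IsETree v T →
      IsRep C v T (treeL C T) ∧ IsLReduced C (treeL C T) ∧
        ∀ S, IsRep C v T S → IsLReduced C S → S = treeL C T) ∧
    -- for a Leavitt-Munn tree `(T, g)`, the tree `T ∪ g↓` is a representative of `T` in `𝒴`
    (∀ p : LMTree C, IsY C p.path.src (p.tree ∪ p.path.lower) ∧
      IsRep C p.path.src p.tree (p.tree ∪ p.path.lower)) ∧
    -- the congruence on `𝒴` is the restriction of the congruence `∼_L` on the free inverse semigroup
    (∀ a b : Y C, simY C a b ↔ simL C a.toFreeIS b.toFreeIS) ∧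
    -- the product of Leavitt-Munn trees, for any representatives
    (∀ (p q : LMTree C) (T₁ T₂ : Set (RedPath E)),
      IsY C p.path.src T₁ → IsRep C p.path.src p.tree T₁ → p.path ∈ T₁ →
      IsY C q.path.src T₂ → IsRep C q.path.src q.tree T₂ → q.path ∈ T₂ →
      (∀ hc : p.path.rng = q.path.src, IsCompatible C (T₁ ∪ p.path.translate T₂) →
        ∃ t : LMTree C, t.tree = treeL C (T₁ ∪ p.path.translate T₂) ∧
          t.path = p.path.comp q.path hc ∧ LM.of p * LM.of q = LM.of t) ∧
      (¬ (p.path.rng = q.path.src ∧ IsCompatible C (T₁ ∪ p.path.translate T₂)) →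
        LM.of p * LM.of q = 0)) ∧
    -- the inverse of a Leavitt-Munn tree, for any representative
    (∀ (p : LMTree C) (T' : Set (RedPath E)),
      IsY C p.path.src T' → IsRep C p.path.src p.tree T' → p.path ∈ T' →
      ∃ t : LMTree C, t.tree = treeL C (p.path.inv.translate T') ∧
        t.path = p.path.inv ∧ (LM.of p)⁻¹ = LM.of t) ∧
    -- the isomorphism with the semigroup of Leavitt-Munn trees, with its values on the generators
    ∃ Φ : LI C ≃* LM C,
      Φ 0 = 0 ∧ (∀ x, Φ x⁻¹ = (Φ x)⁻¹) ∧
      (∀ v : E.Vert, ∃ p : LMTree C, p.tree = {RedPath.unit v} ∧ p.path = RedPath.unit v ∧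
        Φ (LI.vert C v) = LM.of p) ∧
      (∀ x : Letter E, ∃ p : LMTree C, p.tree = treeL C (RedPath.letter x).lower ∧
        p.path = RedPath.letter x ∧ Φ (LI.letter C x) = LM.of p) ∧
      -- the idempotent pure partial homomorphism `(T, g) ↦ ω(g)`
      (∃ π : {x : LI C // x ≠ 0} → FreeGroup E.Edge,
        (∀ (x : {x : LI C // x ≠ 0}) (p : LMTree C), Φ x.1 = LM.of p → π x = p.path.toFree) ∧
        IsPartialHom π ∧ IsIdempotentPure π) ∧
      -- the isomorphism `𝒴/∼_L ≅ ℰ(LI(E, C))`, `[T] ↦ (T_L, v)`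
      (∃ ε : YL C ≃* Idem (LI C),
        ∀ (v : E.Vert) (T : Set (RedPath E)) (hT : IsY C v T), ∃ p : LMTree C,
          p.tree = treeL C T ∧ p.path = RedPath.unit v ∧ Φ (ε (cls hT)).1 = LM.of p) ∧
      -- the partial action and the restricted semidirect product decomposition
      ∃ α : PartialAction (FreeGroup E.Edge) (YL C),
        (∀ g : RedPath E, IsSeparated C g → g.word ≠ [] →
          α.D g.toFree = {y | y = 0 ∨ ∃ (T : Set (RedPath E)) (hT : IsYL C g.src T),
            pathL C g ∈ T ∧ y = cls hT.isY}) ∧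
        (∀ γ : FreeGroup E.Edge, γ ≠ 1 → (∀ g : RedPath E, IsSeparated C g → g.toFree ≠ γ) →
          α.D γ = {0}) ∧
        (∀ g : RedPath E, IsSeparated C g → g.word ≠ [] →
          ∀ (T : Set (RedPath E)) (hT : IsYL C g.rng T), pathL C g.inv ∈ T →
          ∀ T' : Set (RedPath E), IsY C g.rng T' → IsRep C g.rng T T' → g.inv ∈ T' →
          ∃ hS : IsYL C g.src (treeL C (g.translate T')),
            α.θ g.toFree (cls hT.isY) = cls hS.isY) ∧
        ∃ Ψ : LI C ≃* RestrictedSemidirect α,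
          Ψ 0 = 0 ∧
          ∀ (x : LI C) (p : LMTree C), Φ x = LM.of p →
            ∃ h : cls p.isYL.isY ∈ α.D p.path.toFree,
              Ψ x = RestrictedSemidirect.mk (cls p.isYL.isY) p.path.toFree h := by
  refine ⟨fun v T hT => ⟨isRep_treeL hT, isLReduced_treeL T, fun S hS hS' => hS.eq_treeL hS'⟩,
    fun p => ⟨p.isY_union, ?_⟩, fun a b => simY_iff, ?_, ?_, LI.equivLM C, LI.equivLM_zero,
    LI.equivLM_inv, ?_, ?_, ⟨(LI.grading C).π, ?_, (LI.grading C).isPartialHom,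
      (LI.grading C).isIdempotentPure⟩, ⟨YL.equivIdem C, ?_⟩, (LI.grading C).partialAction,
    fun g hs hw => LI.D_toFree hs hw, fun γ _ h => LI.D_eq_zero h, ?_,
    (LI.grading C).semidirectEquiv, (LI.grading C).toSemidirect_zero, ?_⟩
  · exact (isRep_iff p.isYL.isY.isTree).2 ⟨p.isY_union.isTree, p.nred_union⟩
  · intro p q T₁ T₂ h₁ hr₁ hm₁ h₂ hr₂ hm₂
    exact ⟨fun hc h => p.exists_mul_eq q h₁ hr₁ hm₁ h₂ hr₂ hm₂ hc h,
      fun h => p.mul_eq_zero q h₁ hr₁ hm₁ h₂ hr₂ hm₂ h⟩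
  · intro p T' hT hr hm
    exact p.exists_inv_eq hT hr hm
  · intro v
    have hY : IsCompatible C {RedPath.unit v} :=
      (isY_lower (isSeparated_unit (C := C) v)).compatible.mono
        (Set.singleton_subset_iff.2 (RedPath.mem_lower_self _))
    exact ⟨LM.ofMunn ⟨{RedPath.unit v}, RedPath.unit v, isETree_unit v, rfl⟩ hY,
      treeL_unit v, rfl, toLM_of hY⟩
  · intro x
    have hY := (isY_lower (isSeparated_letter (C := C) x)).compatible
    exact ⟨LM.ofMunn ⟨_, RedPath.letter x, isETree_lower _, RedPath.mem_lower_self _⟩ hY,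
      rfl, rfl, toLM_of hY⟩
  · rintro ⟨x, hx⟩ p hp
    exact LI.hasDeg hp hx
  · intro v T hT
    exact ⟨_, rfl, rfl, (YL.equivLM_toIdem C _).trans (YL.toLM_cls hT)⟩
  · intro g hs _ T hT hm T' hT' hr hm'
    exact LI.θ_toFree hs hT hm hT' hr hm'
  · intro x p hp
    have hD : cls p.isYL.isY ∈ (LI.grading C).partialAction.D p.path.toFree :=
      LI.mem_D_iff.2 (Or.inr ⟨p, rfl, rfl⟩)
    refine ⟨hD, PureGrading.mk_eq _
      (PureGrading.ran_mem_D ((LI.grading C).hasDeg_deg x)) hD (LI.ran_eq hp) fun h => ?_⟩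
    exact (LI.hasDeg hp).deg_eq fun h0 => h ((LI.grading C).ran_eq_zero.2 h0)
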